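/- Notation: $\|\cdot\|$ and $\|\cdot\|_\infty$ are the $\ell^2$ and $\ell^\infty$ norms on $\mathbb R^d$; $L,C_0,\epsilon_0>0$ and $\delta\in(0,1)$. **Setting.** Let $f:\mathbb R^d\to\mathbb R$ be differentiable, bounded below by $f^*\in\mathbb R$, and $L$-smooth: $|f(y)-f(x)-\langle\nabla f(x),y-x\rangle|\le\frac L2\|x-y\|^2$ for all $x,y$ (equivalently, $\nabla f$ is $L$-Lipschitz). A stochastic gradient oracle returns, for every $x$, a random vector $g(x)=g(x,z)$, $z\sim\nu$ ($g$ jointly measurable), such that for all $x\in\mathbb R^d$ and all coordinates $i$: $\mathbb E[g(x)]=\nabla f(x)$, and $(g(x)_i-\nabla f(x)_i)^2\le\sigma_{0,i}^2+\sigma_{1,i}^2\,(\nabla f(x)_i)^2$ almost surely, where $\boldsymbol\sigma_0,\boldsymbol\sigma_1\in[0,\infty)^d$. Adam with parameters $\beta_1,\beta_2,\eta,\epsilon$ and starting point $x_1$ sets $m_0=v_0=0$ and, for $s=1,\dots,T$, calls the oracle at $x_s$ with a fresh independent draw, $g_s=g(x_s,z_s)$, and puts for every coordinate $i$ $$m_{s,i}=\beta_1m_{s-1,i}+(1-\beta_1)g_{s,i},\quad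 v_{s,i}=\beta_2v_{s-1,i}+(1-\beta_2)g_{s,i}^2,\quad x_{s+1,i}=x_{s,i}-\frac{\eta_s}{\sqrt{v_{s,i}}+\epsilon_s}\,m_{s,i},$$ with $\eta_s=\eta\sqrt{1-\beta_2^s}/(1-\beta_1^s)$ and $\epsilon_s=\epsilon\sqrt{1-\beta_2^s}$. **Claim.** There is a universal constant $K>0$ such that the following holds for all such $d$, $f$, $f^*$, $x_1$, $L$, $\boldsymbol\sigma_0,\boldsymbol\sigma_1$, $C_0,\epsilon_0,\delta$, every constant $\beta_1\ge 0$, and every integer $T\ge2$ with $\beta_1<\beta_2:=1-1/T$. Run Adam with $\eta=C_0\sqrt{1-\beta_2}$ and $\epsilon=\epsilon_0\sqrt{1-\beta_2}$, on any oracle as above. Then with probability at least $1-\delta$, $$\frac1T\sum_{s=1}^T\|\nabla f(x_s)\|^2\le K\left\{\frac1T\cdot\frac{\epsilon_0G_1}{LC_0}+\frac{G_1}{LC_0}\sqrt{\frac{\|\boldsymbol\sigma_0\|^2+(1+\|\boldsymbol\sigma_1\|_\infty^2)G_1}{T}}\right\}.$$ Here, with $\Sigma_{\max}=\max\{1,\sqrt{(1+\beta_2)/\beta_2}-1\}$,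 $$\mathcal F(T)=1+\frac2{\epsilon^2}\left[\left(\|\boldsymbol\sigma_0\|_\infty^2+2(1+\|\boldsymbol\sigma_1\|_\infty^2)\|\nabla f(x_1)\|^2\right)T+\frac{2(1+\|\boldsymbol\sigma_1\|_\infty^2)dL^2C_0^2}{1-\beta_1/\beta_2}T^3\right],$$ $\ell_1=\log\frac{dT}\delta$ (read as $0$ if $d=0$) and $\ell_2=\log(\mathrm e^2\mathcal F(T))$, $$\begin{aligned}G_1&=8L(f(x_1)-f^*)+\frac{256L^2C_0^2\beta_1^2d^2}{(1-\beta_1)^3(1-\beta_1/\beta_2)}+\frac{4L^2C_0^2\beta_1^2d}{(1-\beta_1)^2(1-\beta_1/\beta_2)}+\frac{48LC_0\|\boldsymbol\sigma_0\|_\infty}{1-\beta_1}d\,\ell_1\\&\quad+\frac{8LC_0\beta_1^2}{(1-\beta_1)^2(1-\beta_1/\beta_2)}\left[\frac{4\|\boldsymbol\sigma_0\|_\infty}{\beta_2}+\frac{\epsilon_0+\sqrt2\|\boldsymbol\sigma_0\|_\infty}{\sqrt{\beta_2}}+\frac{LC_0}2(1+4\Sigma_{\max}^2)\right]d\,\ell_2\\&\quad+8\left(\frac{3L^2C_0^2}{(1-\beta_1)^2}+\frac{8L\|\boldsymbol\sigma_0\|_\infty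 C_0}{1-\beta_1}\right)d\,\ell_2+\frac{2304L^2C_0^2\|\boldsymbol\sigma_1\|_\infty^2}{(1-\beta_1)^2}d^2\ell_1^2\\&\quad+256\left[\frac{16L^2C_0^2\|\boldsymbol\sigma_1\|_\infty^2}{(1-\beta_1)^2}+\frac{9L^2C_0^2\beta_1^4(1+\|\boldsymbol\sigma_1\|_\infty^2)}{\beta_2^2(1-\beta_1)^4(1-\beta_1/\beta_2)^2}\right]d^2\ell_2^2.\end{aligned}$$ Moreover $G_1=\mathcal O(\mathrm{poly}(\log T))$, and the resulting rate is $\mathcal O(\mathrm{poly}(\log T)/\sqrt T)$: there is an integer $k\ge 0$ and, for all fixed $f,f^*,x_1,L,\boldsymbol\sigma_0,\boldsymbol\sigma_1,\beta_1,C_0,\epsilon_0,\delta$, a constant $C>0$ such that for every $T\ge2$ with $\beta_1<1-1/T$ and every oracle as above, $G_1\le C(\log T)^k$, and with probability at least $1-\delta$ both the bound above and $\frac1T\sum_{s=1}^T\|\nabla f(x_s)\|^2\le C(\log T)^k/\sqrt T$ hold. -/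

import Mathlib

open MeasureTheory ProbabilityTheory

noncomputable section

namespace AdamConv

/-- The Euclidean space `ℝ^d` with the `ℓ²` norm. -/
abbrev E (d : ℕ) : Type := EuclideanSpace ℝ (Fin d)

/-- The `ℓ^∞` norm of a vector of `ℝ^d` (the norm of `Fin d → ℝ` is the sup norm). -/
def supNorm {d : ℕ} (w : E d) : ℝ := ‖(WithLp.ofLp w : Fin d → ℝ)‖

/-- `f` is `L`-smooth: differentiable, and the first order expansion of `f` is accurate up to
`(L / 2) * ‖x - y‖ ^ 2` (equivalently, the gradient of `f` is `L`-Lipschitz). -/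
def IsLSmooth {d : ℕ} (L : ℝ) (f : E d → ℝ) : Prop :=
  Differentiable ℝ f ∧
    ∀ x y : E d, |f y - f x - inner ℝ (gradient f x) (y - x)| ≤ L / 2 * ‖x - y‖ ^ 2

/-- A stochastic gradient oracle for `f`: the random vector `g(x)` is `z ↦ g x z`, where `z` is
drawn from the probability measure `ν`. It is unbiased, and its noise satisfies, in every
coordinate and almost surely, the affine bound with parameters `σ₀`, `σ₁`. -/
structure IsGradientOracle {d : ℕ} {Z : Type*} [MeasurableSpace Z] (f : E d → ℝ)
    (σ₀ σ₁ : E d) (ν : Measure Z) (g : E d → Z → E d) : Prop where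
  measurable : Measurable (Function.uncurry g)
  integrable : ∀ x, Integrable (g x) ν
  unbiased : ∀ x, ∫ z, g x z ∂ν = gradient f x
  affine_noise : ∀ x, ∀ i, ∀ᵐ z ∂ν,
    (g x z i - gradient f x i) ^ 2 ≤ σ₀ i ^ 2 + σ₁ i ^ 2 * (gradient f x i) ^ 2

/-- `ζ 1, ζ 2, …` are independent draws from `ν`, on the probability space `(Ω, P)`. -/
structure IsSampling {Z Ω : Type*} [MeasurableSpace Z] [MeasurableSpace Ω]
    (ν : Measure Z) (P : Measure Ω) (ζ : ℕ → Ω → Z) : Prop where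
  measurable : ∀ s, Measurable (ζ s)
  law : ∀ s, P.map (ζ s) = ν
  indep : iIndepFun ζ P

/-- The variables carried by Adam: the current point and the two moment estimates. -/
structure AdamState (d : ℕ) where
  x : E d
  m : Fin d → ℝ
  v : Fin d → ℝ

/-- Iteration number `s ≥ 1` of Adam, run on the stochastic gradient `gs`. -/
def adamStep {d : ℕ} (β₁ β₂ η ε : ℝ) (s : ℕ) (gs : E d) (S : AdamState d) : AdamState d :=
  let m' : Fin d → ℝ := fun i => β₁ * S.m i + (1 - β₁) * gs i
  let v' : Fin d → ℝ := fun i => β₂ * S.v i + (1 - β₂) * gs i ^ 2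
  let ηs : ℝ := η * √(1 - β₂ ^ s) / (1 - β₁ ^ s)
  let εs : ℝ := ε * √(1 - β₂ ^ s)
  { x := WithLp.toLp 2 (fun i => S.x i - ηs / (√(v' i) + εs) * m' i)
    m := m'
    v := v' }

/-- The state of Adam after `n` iterations, started at `x₁`; iteration `s` calls the oracle `g` at
the current point with the sample `z s`. -/
def adamState {d : ℕ} {Z : Type*} (β₁ β₂ η ε : ℝ) (g : E d → Z → E d) (x₁ : E d) (z : ℕ → Z) :
    ℕ → AdamState d
  | 0 => { x := x₁, m := 0, v := 0 }
  | n + 1 =>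
      let S := adamState β₁ β₂ η ε g x₁ z n
      adamStep β₁ β₂ η ε (n + 1) (g S.x (z (n + 1))) S

/-- The iterate `x_s`, for `s ≥ 1`: the point reached after `s - 1` iterations. -/
def adamIterate {d : ℕ} {Z : Type*} (β₁ β₂ η ε : ℝ) (g : E d → Z → E d) (x₁ : E d) (z : ℕ → Z)
    (s : ℕ) : E d :=
  (adamState β₁ β₂ η ε g x₁ z (s - 1)).x

/-- The polynomial `𝓕(T)`; here `ε = ε₀ √(1 - β₂)`, and `g₁` is the norm of the gradient at the
starting point. -/
def calF (d T : ℕ) (L C₀ ε₀ β₁ β₂ g₁ : ℝ) (σ₀ σ₁ : E d) : ℝ :=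
  1 + 2 / (ε₀ * √(1 - β₂)) ^ 2 *
    ((supNorm σ₀ ^ 2 + 2 * (1 + supNorm σ₁ ^ 2) * g₁ ^ 2) * T +
      2 * (1 + supNorm σ₁ ^ 2) * d * L ^ 2 * C₀ ^ 2 / (1 - β₁ / β₂) * T ^ 3)

/-- `Σ_max = max {1, √((1 + β₂) / β₂) - 1}`. -/
def sigmaMax (β₂ : ℝ) : ℝ := max 1 (√((1 + β₂) / β₂) - 1)

/-- The quantity `G`, with `Δ = f(x₁) - f^*`, `g₁ = ‖∇f(x₁)‖`, and with `q` in the place of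
`β₂ ^ T` in the factors `log (𝓕(T) / β₂ ^ T)`. -/
def adamG (d T : ℕ) (L C₀ ε₀ β₁ β₂ δ Δ g₁ : ℝ) (σ₀ σ₁ : E d) (q : ℝ) : ℝ :=
  let F : ℝ := calF d T L C₀ ε₀ β₁ β₂ g₁ σ₀ σ₁
  let s₀ : ℝ := supNorm σ₀
  let s₁ : ℝ := supNorm σ₁
  8 * L * Δ
  + 256 * L ^ 2 * C₀ ^ 2 * β₁ ^ 2 * d ^ 2 / ((1 - β₁) ^ 3 * (1 - β₁ / β₂))
  + 4 * L ^ 2 * C₀ ^ 2 * β₁ ^ 2 * d / ((1 - β₁) ^ 2 * (1 - β₁ / β₂))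
  + 48 * L * C₀ * s₀ / (1 - β₁) * d * Real.log (d * T / δ)
  + 8 * L * C₀ * β₁ ^ 2 / ((1 - β₁) ^ 2 * (1 - β₁ / β₂))
      * (4 * s₀ / β₂ + (ε₀ + √2 * s₀) / √β₂ + L * C₀ / 2 * (1 + 4 * sigmaMax β₂ ^ 2))
      * d * Real.log (F / q)
  + 8 * (3 * L ^ 2 * C₀ ^ 2 / (1 - β₁) ^ 2 + 8 * L * s₀ * C₀ / (1 - β₁)) * d * Real.log (F / q)
  + 2304 * L ^ 2 * C₀ ^ 2 * s₁ ^ 2 / (1 - β₁) ^ 2 * d ^ 2 * Real.log (d * T / δ) ^ 2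
  + 256 * (16 * L ^ 2 * C₀ ^ 2 * s₁ ^ 2 / (1 - β₁) ^ 2
      + 9 * L ^ 2 * C₀ ^ 2 * β₁ ^ 4 * (1 + s₁ ^ 2)
          / (β₂ ^ 2 * (1 - β₁) ^ 4 * (1 - β₁ / β₂) ^ 2))
      * d ^ 2 * Real.log (F / q) ^ 2

/-- The quantity `G₁`: this is `G` for `β₂ = 1 - 1 / T`, with `1 / β₂ ^ T` replaced by `e ^ 2`. -/
def adamG₁ (d T : ℕ) (L C₀ ε₀ β₁ δ Δ g₁ : ℝ) (σ₀ σ₁ : E d) : ℝ :=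
  adamG d T L C₀ ε₀ β₁ (1 - 1 / (T : ℝ)) δ Δ g₁ σ₀ σ₁ (Real.exp (-2))

end AdamConv

end

noncomputable section

namespace AdamConv

/-! Index the iterations from `n = 0`, with `X n` the point and `gs n` the stochastic gradient drawn
there. With `κ = β₁ / (1 - β₁)`, the extrapolated points `X n - κ * (step * momentum)` (`shifted`)
move by the fresh gradient times the new step size, plus `κ` times the change of step size applied
to the old momentum. A descent inequality is run along these points, with the gradient taken at `X
n`.

The Adam step size depends on the fresh sample, so its product with the noise is not centred. It is
replaced by a predictable proxy, whose denominator puts `y ^ 2 + N ^ 2` (gradient coordinate and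
noise level) in the place of the new squared sample. The replacement error (`proxy_error_le`) and
the momentum error (`momentum_error_le`) each cost a quarter of the progress `∑ proxy * y ^ 2`, plus
terms whose sums over time are logarithmic (`sum_sq_div_le`, `sum_accum_div_le`) or telescope
(`sum_biasDrop_le`). This leaves half of the progress (`energy_le`).

What remains is a martingale with predictable envelopes. Hoeffding's lemma makes its exponential a
supermartingale, and Markov's inequality with a union bound over the `T` times controls it with
probability `1 - δ` (`measureReal_exists_lt_logSupermartingale_le`). The squared envelopes are
dominated by the progress, so the noise costs one more quarter (`sum_noiseTerm_le`).

On that event everything is deterministic. If all earlier squared gradients are at most `G`, the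
noise level is at most `‖σ₀‖_∞ + ‖σ₁‖_∞ √G`, and the energy bound grows only linearly in `√G`. The
constant `G` is large enough to absorb this by AM-GM (`budget`), so the gradient bound propagates by
induction (`gradient_bound_step`) and the total progress is at most `G / L`. Bounded gradients bound
the proxy denominators, so the progress dominates a multiple of the sum of squared gradients
(`progress_ge`, `average_le`). Finally `G₁` is `O(log² T)`, so the rate, of order `G₁ ^ (3/2) / √T`,
is `O(log³ T / √T)`. -/

/-- The exponential moving average of a real sequence. -/
def mom (β : ℝ) (g : ℕ → ℝ) : ℕ → ℝ
  | 0 => 0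
  | n + 1 => β * mom β g n + (1 - β) * g n

/-- The discounted sum of squares of a real sequence. -/
def accum (β : ℝ) (g : ℕ → ℝ) : ℕ → ℝ
  | 0 => 0
  | n + 1 => β * accum β g n + g n ^ 2

/-- The bias-corrected second moment estimate. -/
def vhat (β₂ : ℝ) (g : ℕ → ℝ) (n : ℕ) : ℝ := (1 - β₂) * accum β₂ g n / (1 - β₂ ^ n)

/-- The bias-corrected denominator of Adam. -/
def bhat (β₂ ε : ℝ) (g : ℕ → ℝ) (n : ℕ) : ℝ := √(vhat β₂ g n) + ε

/-- The effective step size of Adam. -/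
def stepSize (β₁ β₂ η ε : ℝ) (g : ℕ → ℝ) (n : ℕ) : ℝ := η / (1 - β₁ ^ n) / bhat β₂ ε g n

/-- The weight of the newest sample in the bias-corrected second moment after `n + 1` samples. -/
def newWeight (β₂ : ℝ) (n : ℕ) : ℝ := (1 - β₂) / (1 - β₂ ^ (n + 1))

/-- The predictable proxy of the denominator, computed from the old bias-corrected second moment
`w`, the gradient coordinate `y` and the noise level `N`. -/
def proxyDen (β₂ ε : ℝ) (n : ℕ) (w y N : ℝ) : ℝ :=
  √((1 - newWeight β₂ n) * w + newWeight β₂ n * (y ^ 2 + N ^ 2)) + ε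

/-! ### Scalar sequences: moving averages, logarithmic sums, denominators and their proxies. -/

section scalar

variable {β β₁ β₂ ε η C₀ : ℝ} {g : ℕ → ℝ}

theorem accum_nonneg (hβ : 0 ≤ β) (n : ℕ) : 0 ≤ accum β g n := by
  induction n with
  | zero => simp [accum]
  | succ n ih => simp only [accum]; positivity

theorem accum_mono (h₁ : 0 ≤ β₁) (h : β₁ ≤ β₂) (n : ℕ) : accum β₁ g n ≤ accum β₂ g n := by
  induction n with
  | zero => simp [accum]
  | succ n ih =>
    simp only [accum]
    have := mul_le_mul h ih (accum_nonneg h₁ n) (h₁.trans h)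
    linarith

theorem accum_le_sum (h₁ : 0 ≤ β) (h : β ≤ 1) (n : ℕ) :
    accum β g n ≤ ∑ k ∈ Finset.range n, g k ^ 2 := by
  induction n with
  | zero => simp [accum]
  | succ n ih =>
    rw [Finset.sum_range_succ]
    simp only [accum]
    nlinarith [accum_nonneg (g := g) h₁ n]

/-- Cauchy-Schwarz for the weights `(1 - β) * β ^ j`, `j < n`, whose sum is `1 - β ^ n`. Keeping the
factor `1 - β ^ n` is what later cancels the bias correction of the momentum. -/
theorem mom_sq_le (h₀ : 0 ≤ β) (h : β < 1) (n : ℕ) :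
    mom β g n ^ 2 ≤ (1 - β) * (1 - β ^ n) * accum β g n := by
  induction n with
  | zero => simp [mom, accum]
  | succ n ih =>
    simp only [mom, accum]
    set m := mom β g n
    set A := accum β g n with hA
    have hA0 : 0 ≤ A := accum_nonneg h₀ n
    have hq0 : 0 ≤ 1 - β ^ n := by linarith [pow_le_one₀ (n := n) h₀ h.le]
    have hq : 1 - β ^ (n + 1) = β * (1 - β ^ n) + (1 - β) := by ring
    rw [hq]
    set q := 1 - β ^ n
    -- The induction hypothesis says that `(m * g n) ^ 2` is at most the product of the two summands
    -- on the right; AM-GM then bounds the cross term by their sum.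
    have hcross : 2 * m * g n ≤ A * (1 - β) + q * g n ^ 2 := by
      have h1 : (m * g n) ^ 2 ≤ (A * (1 - β)) * (q * g n ^ 2) := by
        have := mul_le_mul_of_nonneg_right ih (sq_nonneg (g n))
        nlinarith
      have h2 : 0 ≤ A * (1 - β) := mul_nonneg hA0 (by linarith)
      have h3 : 0 ≤ q * g n ^ 2 := by positivity
      nlinarith [sq_nonneg (A * (1 - β) - q * g n ^ 2), abs_le_abs (le_refl (m * g n)),
        abs_le_of_sq_le_sq' (show (2 * (m * g n)) ^ 2 ≤ (A * (1 - β) + q * g n ^ 2) ^ 2 by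
          nlinarith [sq_nonneg (A * (1 - β) - q * g n ^ 2)]) (by positivity)]
    have h1 : β ^ 2 * m ^ 2 ≤ β ^ 2 * ((1 - β) * q * A) := by gcongr
    have h2 : β * (1 - β) * (2 * m * g n) ≤ β * (1 - β) * (A * (1 - β) + q * g n ^ 2) := by
      have : 0 ≤ β * (1 - β) := mul_nonneg h₀ (by linarith)
      gcongr
    nlinarith

theorem Q_succ_ge (hβ1 : β₂ ≤ 1) (n : ℕ) :
    β₂ * (accum β₂ g n + ε ^ 2) + g n ^ 2 ≤ accum β₂ g (n + 1) + ε ^ 2 := by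
  simp only [accum]
  nlinarith [sq_nonneg ε]

theorem Q_pos (hβ : 0 ≤ β₂) (hε : 0 < ε) (n : ℕ) : 0 < accum β₂ g n + ε ^ 2 := by
  have := accum_nonneg (g := g) hβ n
  positivity

/-- With `Q n = accum β₂ g n + ε ^ 2`, each term is at most `1 - β₂ Q n / Q (n + 1)`, hence at most
`log Q (n + 1) - log Q n - log β₂`, which telescopes. -/
theorem sum_sq_div_le (hβ : 0 < β₂) (hβ1 : β₂ ≤ 1) (hε : 0 < ε) (t : ℕ) :
    ∑ n ∈ Finset.range t, g n ^ 2 / (accum β₂ g (n + 1) + ε ^ 2)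
      ≤ Real.log ((accum β₂ g t + ε ^ 2) / ε ^ 2) - t * Real.log β₂ := by
  induction t with
  | zero =>
    have : ε ^ 2 ≠ 0 := by positivity
    simp [accum, this]
  | succ t ih =>
    rw [Finset.sum_range_succ]
    have hQ := Q_pos (g := g) hβ.le hε t
    have hQ' := Q_pos (g := g) hβ.le hε (t + 1)
    have hr := Q_succ_ge (g := g) (ε := ε) hβ1 t
    set Q := accum β₂ g t + ε ^ 2
    set Q' := accum β₂ g (t + 1) + ε ^ 2
    have h1 : g t ^ 2 / Q' ≤ 1 - β₂ * Q / Q' := by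
      rw [div_le_iff₀ hQ', sub_mul, div_mul_cancel₀ _ hQ'.ne']
      linarith
    have h2 : Real.log (β₂ * Q / Q') ≤ β₂ * Q / Q' - 1 :=
      Real.log_le_sub_one_of_pos (by positivity)
    have he : (0 : ℝ) < ε ^ 2 := by positivity
    rw [Real.log_div (by positivity) hQ'.ne', Real.log_mul hβ.ne' hQ.ne'] at h2
    rw [Real.log_div hQ.ne' he.ne'] at ih
    rw [Real.log_div hQ'.ne' he.ne']
    push_cast
    linarith

/-- The ratio contracts: passing from `n` to `n + 1` multiplies it by at most `β₁ / β₂` and adds one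
term of the right-hand sum. Summing this recursion gives the geometric factor; the last ratio is
kept during the induction and dropped at the end. -/
theorem sum_accum_div_le (h₁ : 0 ≤ β₁) (h : β₁ < β₂) (hβ1 : β₂ ≤ 1) (hε : 0 < ε) (t : ℕ) :
    (1 - β₁ / β₂) * ∑ n ∈ Finset.range t, accum β₁ g n / (accum β₂ g n + ε ^ 2)
      ≤ ∑ n ∈ Finset.range t, g n ^ 2 / (accum β₂ g (n + 1) + ε ^ 2) := by
  have hβ : 0 < β₂ := h₁.trans_lt h
  have key : ∀ t : ℕ, (1 - β₁ / β₂) * ∑ n ∈ Finset.range t, accum β₁ g n / (accum β₂ g n + ε ^ 2)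
      + accum β₁ g t / (accum β₂ g t + ε ^ 2)
      ≤ ∑ n ∈ Finset.range t, g n ^ 2 / (accum β₂ g (n + 1) + ε ^ 2) := by
    intro t
    induction t with
    | zero => simp [accum]
    | succ t ih =>
      rw [Finset.sum_range_succ, Finset.sum_range_succ]
      have hQ := Q_pos (g := g) hβ.le hε t
      have hQ' := Q_pos (g := g) hβ.le hε (t + 1)
      have hr := Q_succ_ge (g := g) (ε := ε) hβ1 t
      have hA : accum β₁ g (t + 1) = β₁ * accum β₁ g t + g t ^ 2 := rfl
      have hA0 := accum_nonneg (g := g) h₁ t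
      set Q := accum β₂ g t + ε ^ 2
      set Q' := accum β₂ g (t + 1) + ε ^ 2
      rw [hA, add_div]
      have h1 : β₁ * accum β₁ g t / Q' ≤ β₁ / β₂ * (accum β₁ g t / Q) := by
        rw [div_mul_div_comm]
        apply div_le_div_of_nonneg_left (by positivity) (by positivity)
        nlinarith [sq_nonneg (g t)]
      linarith
  have := key t
  have h2 : 0 ≤ accum β₁ g t / (accum β₂ g t + ε ^ 2) :=
    div_nonneg (accum_nonneg h₁ t) (Q_pos hβ.le hε t).le
  linarith

theorem one_sub_pow_pos (h₀ : 0 ≤ β) (h : β < 1) {n : ℕ} (hn : n ≠ 0) : 0 < 1 - β ^ n := by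
  linarith [pow_lt_one₀ h₀ h hn]

theorem one_sub_le_one_sub_pow (h₀ : 0 ≤ β) (h : β < 1) {n : ℕ} (hn : n ≠ 0) :
    1 - β ≤ 1 - β ^ n := by
  linarith [pow_le_of_le_one h₀ h.le hn]

theorem vhat_nonneg (h₀ : 0 ≤ β₂) (h : β₂ ≤ 1) (n : ℕ) : 0 ≤ vhat β₂ g n :=
  div_nonneg (mul_nonneg (by linarith) (accum_nonneg h₀ n))
    (by linarith [pow_le_one₀ (n := n) h₀ h])

theorem bhat_pos (hε : 0 < ε) (n : ℕ) : 0 < bhat β₂ ε g n := by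
  unfold bhat
  positivity

/-- Links the bias-corrected denominator of the algorithm to the uncorrected quantity `accum + ε ^
2` of the logarithmic sums. -/
theorem mul_Q_le (h₀ : 0 ≤ β₂) (h : β₂ < 1) (hε : 0 < ε) {n : ℕ} (hn : n ≠ 0) :
    (1 - β₂) * (accum β₂ g n + ε ^ 2) ≤ (1 - β₂ ^ n) * bhat β₂ ε g n ^ 2 := by
  have hr := one_sub_pow_pos h₀ h hn
  have hw := vhat_nonneg (g := g) h₀ h.le n
  have h1 : vhat β₂ g n + ε ^ 2 ≤ bhat β₂ ε g n ^ 2 := by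
    unfold bhat
    nlinarith [Real.sq_sqrt hw, Real.sqrt_nonneg (vhat β₂ g n)]
  have h2 : (1 - β₂ ^ n) * vhat β₂ g n = (1 - β₂) * accum β₂ g n := by
    unfold vhat; field_simp
  have h3 := one_sub_le_one_sub_pow h₀ h hn
  have h4 := mul_le_mul_of_nonneg_left h1 hr.le
  nlinarith [sq_nonneg ε]

theorem newWeight_pos (h₀ : 0 ≤ β₂) (h : β₂ < 1) (n : ℕ) : 0 < newWeight β₂ n :=
  div_pos (by linarith) (one_sub_pow_pos h₀ h n.succ_ne_zero)

theorem newWeight_le_one (h₀ : 0 ≤ β₂) (h : β₂ < 1) (n : ℕ) : newWeight β₂ n ≤ 1 :=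
  (div_le_one (one_sub_pow_pos h₀ h n.succ_ne_zero)).2
    (one_sub_le_one_sub_pow h₀ h n.succ_ne_zero)

/-- Bias correction turns the recursion into a true convex combination. At `n = 0` the new weight is
`1`, so the junk value `vhat β₂ g 0 = 0 / 0 = 0` does no harm. -/
theorem vhat_succ (h₀ : 0 ≤ β₂) (h : β₂ < 1) (n : ℕ) :
    vhat β₂ g (n + 1) = (1 - newWeight β₂ n) * vhat β₂ g n + newWeight β₂ n * g n ^ 2 := by
  have hr' := (one_sub_pow_pos h₀ h n.succ_ne_zero).ne'
  rcases eq_or_ne n 0 with rfl | hn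
  · have : 1 - β₂ ≠ 0 := by linarith
    simp [vhat, newWeight, accum, this]
  · have hr := (one_sub_pow_pos h₀ h hn).ne'
    simp only [vhat, newWeight, accum, Nat.succ_eq_add_one] at *
    field_simp
    ring

theorem vhat_le_sq (h₀ : 0 ≤ β₂) (h : β₂ < 1) {B : ℝ} {n : ℕ} (hB : ∀ k < n, |g k| ≤ B) :
    vhat β₂ g n ≤ B ^ 2 := by
  induction n with
  | zero => simp [vhat, accum]; positivity
  | succ n ih =>
    rw [vhat_succ h₀ h]
    have h1 := ih (fun k hk => hB k (hk.trans n.lt_succ_self))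
    have h2 : g n ^ 2 ≤ B ^ 2 := sq_le_sq' (abs_le.1 (hB n n.lt_succ_self)).1
      (abs_le.1 (hB n n.lt_succ_self)).2
    have h3 := newWeight_pos h₀ h n
    have h4 := newWeight_le_one h₀ h n
    nlinarith [mul_le_mul_of_nonneg_left h1 (sub_nonneg.2 h4), mul_le_mul_of_nonneg_left h2 h3.le]

theorem abs_sqrt_sub_sqrt_le {a b : ℝ} (ha : 0 ≤ a) (hb : 0 ≤ b) :
    |√a - √b| ≤ √|a - b| := by
  apply Real.le_sqrt_of_sq_le
  rw [sq_abs]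
  have h1 := Real.sq_sqrt ha
  have h2 := Real.sq_sqrt hb
  have h3 := Real.sqrt_nonneg a
  have h4 := Real.sqrt_nonneg b
  rcases le_total a b with h | h
  · rw [abs_of_nonpos (by linarith)]
    nlinarith [Real.sqrt_le_sqrt h]
  · rw [abs_of_nonneg (by linarith)]
    nlinarith [Real.sqrt_le_sqrt h]

theorem abs_bhat_sub_le (h₀ : 0 ≤ β₂) (h : β₂ < 1) {B : ℝ} {n : ℕ} (hB : ∀ k < n + 1, |g k| ≤ B) :
    |bhat β₂ ε g (n + 1) - bhat β₂ ε g n| ≤ √(newWeight β₂ n) * B := by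
  have hB0 : 0 ≤ B := (abs_nonneg _).trans (hB n n.lt_succ_self)
  have hw := vhat_nonneg (g := g) h₀ h.le n
  have hp := newWeight_pos h₀ h n
  have h1 : vhat β₂ g n ≤ B ^ 2 := vhat_le_sq h₀ h (fun k hk => hB k (hk.trans n.lt_succ_self))
  have h2 : g n ^ 2 ≤ B ^ 2 := sq_le_sq' (abs_le.1 (hB n n.lt_succ_self)).1
    (abs_le.1 (hB n n.lt_succ_self)).2
  calc |bhat β₂ ε g (n + 1) - bhat β₂ ε g n| = |√(vhat β₂ g (n + 1)) - √(vhat β₂ g n)| := by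
        unfold bhat; congr 1; ring
    _ ≤ √|vhat β₂ g (n + 1) - vhat β₂ g n| :=
        abs_sqrt_sub_sqrt_le (vhat_nonneg h₀ h.le _) hw
    _ = √(newWeight β₂ n * |g n ^ 2 - vhat β₂ g n|) := by
        rw [vhat_succ h₀ h, ← abs_of_pos hp, ← abs_mul, abs_of_pos hp]; congr 2; ring
    _ ≤ √(newWeight β₂ n * B ^ 2) := by
        apply Real.sqrt_le_sqrt
        gcongr
        rw [abs_le]
        constructor <;> nlinarith [sq_nonneg (g n)]
    _ = √(newWeight β₂ n) * B := by
        rw [Real.sqrt_mul hp.le, Real.sqrt_sq hB0]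

/-- From the second sample on, the new weight is at most `1 / (1 + β₂) ≤ 3 / 4`, so at least a
quarter of the old second moment survives. For `n = 0` the weight is `1` and nothing survives. -/
theorem bhat_le_two_mul (h₀ : 1 / 2 ≤ β₂) (h : β₂ < 1) (hε : 0 < ε) {n : ℕ} (hn : n ≠ 0) :
    bhat β₂ ε g n ≤ 2 * bhat β₂ ε g (n + 1) := by
  have h0 : 0 ≤ β₂ := by linarith
  have hw := vhat_nonneg (g := g) h0 h.le n
  have h1 : newWeight β₂ n ≤ 3 / 4 := by
    unfold newWeight
    have : β₂ ^ (n + 1) ≤ β₂ ^ 2 := pow_le_pow_of_le_one h0 h.le (by omega)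
    rw [div_le_iff₀ (by nlinarith)]
    nlinarith
  have h2 : vhat β₂ g n ≤ 4 * vhat β₂ g (n + 1) := by
    rw [vhat_succ h0 h]
    nlinarith [newWeight_pos h0 h n, mul_nonneg (newWeight_pos h0 h n).le (sq_nonneg (g n))]
  have h3 : √(vhat β₂ g n) ≤ 2 * √(vhat β₂ g (n + 1)) := by
    rw [show (2 : ℝ) = √4 by rw [show (4 : ℝ) = 2 ^ 2 by norm_num, Real.sqrt_sq (by norm_num)],
      ← Real.sqrt_mul (by norm_num)]
    exact Real.sqrt_le_sqrt h2
  unfold bhat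
  linarith

theorem proxyDen_pos (hε : 0 < ε) (n : ℕ) (w y N : ℝ) : 0 < proxyDen β₂ ε n w y N := by
  unfold proxyDen
  positivity

theorem sqrt_newWeight_mul_le (h₀ : 0 ≤ β₂) (h : β₂ < 1) (hε : 0 < ε) (n : ℕ) {w y N : ℝ}
    (hw : 0 ≤ w) (hN : 0 ≤ N) : √(newWeight β₂ n) * N ≤ proxyDen β₂ ε n w y N := by
  have hp := newWeight_pos h₀ h n
  have hp1 := newWeight_le_one h₀ h n
  have : √(newWeight β₂ n) * N = √(newWeight β₂ n * N ^ 2) := by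
    rw [Real.sqrt_mul hp.le, Real.sqrt_sq hN]
  rw [this]
  unfold proxyDen
  have : √(newWeight β₂ n * N ^ 2)
      ≤ √((1 - newWeight β₂ n) * w + newWeight β₂ n * (y ^ 2 + N ^ 2)) := by
    apply Real.sqrt_le_sqrt
    nlinarith [mul_nonneg (sub_nonneg.2 hp1) hw, mul_nonneg hp.le (sq_nonneg y)]
  linarith

theorem proxyDen_le (h₀ : 0 ≤ β₂) (h : β₂ < 1) (n : ℕ) {w y N B : ℝ}
    (hw : w ≤ B ^ 2) (hB : 0 ≤ B) (hy : y ^ 2 + N ^ 2 ≤ B ^ 2) :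
    proxyDen β₂ ε n w y N ≤ B + ε := by
  have hp := newWeight_pos h₀ h n
  have hp1 := newWeight_le_one h₀ h n
  unfold proxyDen
  have : √((1 - newWeight β₂ n) * w + newWeight β₂ n * (y ^ 2 + N ^ 2)) ≤ √(B ^ 2) := by
    apply Real.sqrt_le_sqrt
    nlinarith [mul_le_mul_of_nonneg_left hw (sub_nonneg.2 hp1),
      mul_le_mul_of_nonneg_left hy hp.le]
  rw [Real.sqrt_sq hB] at this
  linarith

/-- The radicands `a`, `b` differ by at most `p N (|g n| + |y| + N)`, and `√p |g n| ≤ √a`, while `√p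
|y|` and `√p N` are at most `√b`. Dividing by `√a + √b` leaves `2 √p N`, which is proportional to
the noise and not to the size of the gradient. -/
theorem abs_bhat_sub_proxyDen_le (h₀ : 0 ≤ β₂) (h : β₂ < 1) (n : ℕ) {y N : ℝ}
    (hN : |g n - y| ≤ N) :
    |bhat β₂ ε g (n + 1) - proxyDen β₂ ε n (vhat β₂ g n) y N| ≤ 2 * √(newWeight β₂ n) * N := by
  have hN0 : 0 ≤ N := (abs_nonneg _).trans hN
  have hw := vhat_nonneg (g := g) h₀ h.le n
  have hp := newWeight_pos h₀ h n
  have hp1 := newWeight_le_one h₀ h n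
  have hu : bhat β₂ ε g (n + 1) - proxyDen β₂ ε n (vhat β₂ g n) y N =
      √((1 - newWeight β₂ n) * vhat β₂ g n + newWeight β₂ n * g n ^ 2)
      - √((1 - newWeight β₂ n) * vhat β₂ g n + newWeight β₂ n * (y ^ 2 + N ^ 2)) := by
    unfold bhat proxyDen
    rw [vhat_succ h₀ h]; ring
  rw [hu]
  set p := newWeight β₂ n
  set w := vhat β₂ g n
  have hpw : 0 ≤ (1 - p) * w := mul_nonneg (by linarith) hw
  set a := (1 - p) * w + p * g n ^ 2 with ha
  set b := (1 - p) * w + p * (y ^ 2 + N ^ 2) with hb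
  have ha0 : 0 ≤ a := by positivity
  have hb0 : 0 ≤ b := by positivity
  have h1 := Real.sq_sqrt ha0
  have h2 := Real.sq_sqrt hb0
  have h3 : √p * |g n| ≤ √a := by
    rw [← Real.sqrt_sq_eq_abs, ← Real.sqrt_mul hp.le]
    exact Real.sqrt_le_sqrt (by linarith)
  have h4 : √p * |y| ≤ √b := by
    rw [← Real.sqrt_sq_eq_abs, ← Real.sqrt_mul hp.le]
    exact Real.sqrt_le_sqrt (by nlinarith [mul_nonneg hp.le (sq_nonneg N)])
  have h5 : √p * N ≤ √b := by
    rw [show √p * N = √(p * N ^ 2) by rw [Real.sqrt_mul hp.le, Real.sqrt_sq hN0]]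
    exact Real.sqrt_le_sqrt (by nlinarith [mul_nonneg hp.le (sq_nonneg y)])
  have h6 : |a - b| ≤ p * (N * (|g n| + |y|) + N ^ 2) := by
    have : a - b = p * ((g n - y) * (g n + y) - N ^ 2) := by rw [ha, hb]; ring
    rw [this, abs_mul, abs_of_pos hp]
    gcongr
    calc |(g n - y) * (g n + y) - N ^ 2| ≤ |(g n - y) * (g n + y)| + |N ^ 2| := abs_sub _ _
      _ ≤ N * (|g n| + |y|) + N ^ 2 := by
        rw [abs_mul, abs_of_nonneg (sq_nonneg N)]
        gcongr
        exact abs_add_le _ _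
  have hsp : √p * √p = p := Real.mul_self_sqrt hp.le
  have hsp0 : 0 < √p := Real.sqrt_pos.2 hp
  have h7 : |√a - √b| * (√a + √b) = |a - b| := by
    rw [← abs_of_nonneg (show 0 ≤ √a + √b by positivity), ← abs_mul]
    congr 1
    nlinarith
  -- By contradiction, so that the division by `√a + √b` becomes a multiplication; the case where
  -- that sum vanishes is separate.
  by_contra hcon
  push Not at hcon
  have hN' : 0 ≤ √p * N := by positivity
  have h8 : |a - b| ≤ √p * N * (√a + 2 * √b) := by
    refine h6.trans ?_
    have := mul_le_mul_of_nonneg_left (add_le_add (add_le_add h3 h4) h5) hN'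
    calc p * (N * (|g n| + |y|) + N ^ 2)
        = √p * N * (√p * |g n| + √p * |y| + √p * N) := by
          linear_combination (-(N * (|g n| + |y|) + N ^ 2)) * hsp
      _ ≤ √p * N * (√a + 2 * √b) := by linarith
  rcases (add_nonneg (Real.sqrt_nonneg a) (Real.sqrt_nonneg b)).eq_or_lt with h0 | h0
  · have e1 : √a = 0 := by linarith [Real.sqrt_nonneg a, Real.sqrt_nonneg b]
    have e2 : √b = 0 := by linarith [Real.sqrt_nonneg a, Real.sqrt_nonneg b]
    rw [e1, e2] at hcon
    simp at hcon
    linarith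
  · have := mul_lt_mul_of_pos_right hcon h0
    nlinarith [mul_nonneg hN' (Real.sqrt_nonneg a)]

end scalar

/-! ### Step sizes: second-order terms, proxy error and momentum error in one coordinate. -/

/-- The decrease of the factor `1 / (1 - β₁ ^ n)` from `n` to `n + 1`, for `n ≥ 1`. -/
def biasDrop (β₁ : ℝ) (n : ℕ) : ℝ :=
  if n = 0 then 0 else 1 / (1 - β₁ ^ n) - 1 / (1 - β₁ ^ (n + 1))

/-- The step size computed with the predictable proxy of the denominator. -/
def proxyStep (β₁ β₂ η ε : ℝ) (n : ℕ) (w y N : ℝ) : ℝ :=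
  η / (1 - β₁ ^ (n + 1)) / proxyDen β₂ ε n w y N

section step

variable {β₁ β₂ ε η C₀ : ℝ} {g : ℕ → ℝ}

theorem inv_one_sub_pow_anti (h₀ : 0 ≤ β₁) (h : β₁ < 1) {n k : ℕ} (hn : n ≠ 0) (hk : n ≤ k) :
    1 / (1 - β₁ ^ k) ≤ 1 / (1 - β₁ ^ n) :=
  one_div_le_one_div_of_le (one_sub_pow_pos h₀ h hn)
    (by linarith [pow_le_pow_of_le_one h₀ h.le hk])

theorem biasDrop_nonneg (h₀ : 0 ≤ β₁) (h : β₁ < 1) (n : ℕ) : 0 ≤ biasDrop β₁ n := by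
  unfold biasDrop
  split_ifs with hn
  · exact le_rfl
  · exact sub_nonneg.2 (inv_one_sub_pow_anti h₀ h hn n.le_succ)

/-- Telescoping from `n = 1`. The value `0` at `n = 0` replaces a meaningless `1 / 0`; it is the
right one because the momentum is still zero there. -/
theorem sum_biasDrop_le (h₀ : 0 ≤ β₁) (h : β₁ < 1) (t : ℕ) :
    ∑ n ∈ Finset.range t, biasDrop β₁ n ≤ 1 / (1 - β₁) := by
  have key : ∀ t : ℕ, ∑ n ∈ Finset.range (t + 1), biasDrop β₁ n
      = 1 / (1 - β₁) - 1 / (1 - β₁ ^ (t + 1)) := by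
    intro t
    induction t with
    | zero => simp [biasDrop]
    | succ t ih =>
      rw [Finset.sum_range_succ, ih]
      simp [biasDrop]
  cases t with
  | zero =>
    simp; linarith
  | succ t =>
    rw [key t]
    have := one_sub_pow_pos h₀ h t.succ_ne_zero
    have : 0 ≤ 1 / (1 - β₁ ^ (t + 1)) := by positivity
    linarith

/-- The factor `√(1 - β₂)` comes from `η` and the factor `√p` from a perturbation of the
denominator; together they turn `1 / bhat ^ 2` into `1 / (accum + ε ^ 2)`. The product is `(1 - β₂)
/ √(1 - β₂ ^ (n + 1))`, and `1 - β₂ ^ k` is at most that square root because it is at most `1 - β₂ ^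
(n + 1) ≤ 1`. -/
theorem sqrt_mul_sqrt_newWeight_mul_Q_le (h₀ : 0 ≤ β₂) (h : β₂ < 1) (hε : 0 < ε) {n k : ℕ}
    (hk : k ≠ 0) (hkn : k ≤ n + 1) :
    √(1 - β₂) * √(newWeight β₂ n) * (accum β₂ g k + ε ^ 2) ≤ bhat β₂ ε g k ^ 2 := by
  have hr := one_sub_pow_pos h₀ h n.succ_ne_zero
  have hr1 : 1 - β₂ ^ (n + 1) ≤ 1 := by linarith [pow_nonneg h₀ (n + 1)]
  have h1 := mul_Q_le (g := g) h₀ h hε hk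
  simp only [Nat.succ_eq_add_one] at hr
  have hs : 0 < √(1 - β₂ ^ (n + 1)) := Real.sqrt_pos.2 hr
  have hs2 := Real.sq_sqrt hr.le
  have hs1 : √(1 - β₂ ^ (n + 1)) ≤ 1 := by simpa using Real.sqrt_le_sqrt hr1
  have h2 : √(1 - β₂) * √(newWeight β₂ n) = (1 - β₂) / √(1 - β₂ ^ (n + 1)) := by
    unfold newWeight
    rw [Real.sqrt_div (by linarith), ← mul_div_assoc, Real.mul_self_sqrt (by linarith)]
  rw [h2, div_mul_eq_mul_div, div_le_iff₀ hs]
  refine h1.trans ?_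
  rw [mul_comm]
  gcongr
  have : β₂ ^ (n + 1) ≤ β₂ ^ k := pow_le_pow_of_le_one h₀ h.le hkn
  nlinarith

theorem stepSize_mul_mom_sq_le (h₀ : 0 ≤ β₁) (h₁ : β₁ < β₂) (h : β₂ < 1) (hε : 0 < ε)
    (hη : η = C₀ * √(1 - β₂)) (n : ℕ) :
    (stepSize β₁ β₂ η ε g n * mom β₁ g n) ^ 2
      ≤ C₀ ^ 2 * (accum β₁ g n / (accum β₂ g n + ε ^ 2)) := by
  rcases eq_or_ne n 0 with rfl | hn
  · simp [mom, accum]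
  have h20 : 0 ≤ β₂ := h₀.trans h₁.le
  have hb := bhat_pos (β₂ := β₂) (g := g) hε n
  have hQ := Q_pos (g := g) h20 hε n
  have hA := accum_nonneg (g := g) h₀ n
  have hq := one_sub_pow_pos h₀ (h₁.trans h) hn
  have h1 := mul_Q_le (g := g) h20 h hε hn
  have h2 := mom_sq_le (g := g) h₀ (h₁.trans h) n
  have h3 := one_sub_le_one_sub_pow h₀ (h₁.trans h) hn
  have h4 : mom β₁ g n ^ 2 / (1 - β₁ ^ n) ^ 2 ≤ accum β₁ g n := by
    rw [div_le_iff₀ (by positivity)]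
    refine h2.trans ?_
    have : (1 - β₁) * (1 - β₁ ^ n) ≤ (1 - β₁ ^ n) ^ 2 := by nlinarith
    nlinarith
  have h5 : (1 - β₂) / bhat β₂ ε g n ^ 2 ≤ 1 / (accum β₂ g n + ε ^ 2) := by
    rw [div_le_div_iff₀ (by positivity) hQ]
    nlinarith [pow_nonneg h20 n, sq_nonneg (bhat β₂ ε g n)]
  have h6 : (stepSize β₁ β₂ η ε g n * mom β₁ g n) ^ 2
      = C₀ ^ 2 * ((mom β₁ g n ^ 2 / (1 - β₁ ^ n) ^ 2) * ((1 - β₂) / bhat β₂ ε g n ^ 2)) := by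
    have : √(1 - β₂) ^ 2 = 1 - β₂ := Real.sq_sqrt (by linarith)
    simp only [stepSize, hη, div_pow, mul_pow, this]
    ring
  have h7 : 0 ≤ (1 - β₂) / bhat β₂ ε g n ^ 2 := div_nonneg (by linarith) (by positivity)
  rw [h6, div_eq_mul_one_div (accum β₁ g n)]
  exact mul_le_mul_of_nonneg_left (mul_le_mul h4 h5 h7 hA) (sq_nonneg _)

theorem stepSize_mul_sq_le (h₀ : 0 ≤ β₁) (h₁ : β₁ < β₂) (h : β₂ < 1) (hε : 0 < ε)
    (hη : η = C₀ * √(1 - β₂)) (n : ℕ) :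
    (stepSize β₁ β₂ η ε g (n + 1) * g n) ^ 2
      ≤ (C₀ / (1 - β₁)) ^ 2 * (g n ^ 2 / (accum β₂ g (n + 1) + ε ^ 2)) := by
  have h20 : 0 ≤ β₂ := h₀.trans h₁.le
  have hb := bhat_pos (β₂ := β₂) (g := g) hε (n + 1)
  have hQ := Q_pos (g := g) h20 hε (n + 1)
  have hq := one_sub_pow_pos h₀ (h₁.trans h) n.succ_ne_zero
  have h1 := mul_Q_le (g := g) h20 h hε n.succ_ne_zero
  have h3 := one_sub_le_one_sub_pow h₀ (h₁.trans h) n.succ_ne_zero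
  have hq1 : 0 < 1 - β₁ := by linarith
  simp only [Nat.succ_eq_add_one] at *
  have h5 : (1 - β₂) / bhat β₂ ε g (n + 1) ^ 2 ≤ 1 / (accum β₂ g (n + 1) + ε ^ 2) := by
    rw [div_le_div_iff₀ (by positivity) hQ]
    nlinarith [pow_nonneg h20 (n + 1), sq_nonneg (bhat β₂ ε g (n + 1))]
  have h6 : (stepSize β₁ β₂ η ε g (n + 1) * g n) ^ 2
      = (C₀ / (1 - β₁ ^ (n + 1))) ^ 2 * (g n ^ 2 * ((1 - β₂) / bhat β₂ ε g (n + 1) ^ 2)) := by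
    have : √(1 - β₂) ^ 2 = 1 - β₂ := Real.sq_sqrt (by linarith)
    simp only [stepSize, hη, div_pow, mul_pow, this]
    ring
  have h7 : (C₀ / (1 - β₁ ^ (n + 1))) ^ 2 ≤ (C₀ / (1 - β₁)) ^ 2 := by
    rw [div_pow, div_pow]
    gcongr
  rw [h6, div_eq_mul_one_div (g n ^ 2)]
  have : 0 ≤ (1 - β₂) / bhat β₂ ε g (n + 1) ^ 2 := div_nonneg (by linarith) (by positivity)
  gcongr

theorem stepSize_nonneg (h₀ : 0 ≤ β₁) (h : β₁ < 1) (hε : 0 < ε) (hη : 0 ≤ η) (n : ℕ) :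
    0 ≤ stepSize β₁ β₂ η ε g n := by
  unfold stepSize
  have := bhat_pos (β₂ := β₂) (g := g) hε n
  have : 0 ≤ 1 - β₁ ^ n := by linarith [pow_le_one₀ (n := n) h₀ h.le]
  positivity

theorem stepSize_succ_le (h₀ : 0 ≤ β₁) (h : β₁ < 1) (h2 : 1 / 2 ≤ β₂) (h2' : β₂ < 1)
    (hε : 0 < ε) (hη : 0 ≤ η) {n : ℕ} (hn : n ≠ 0) :
    stepSize β₁ β₂ η ε g (n + 1) ≤ 2 * stepSize β₁ β₂ η ε g n := by
  have hb := bhat_pos (β₂ := β₂) (g := g) hε n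
  have hb' := bhat_pos (β₂ := β₂) (g := g) hε (n + 1)
  have h1 := inv_one_sub_pow_anti h₀ h hn n.le_succ
  have h3 := bhat_le_two_mul (g := g) h2 h2' hε hn
  have hq := one_sub_pow_pos h₀ h hn
  have hq' := one_sub_pow_pos h₀ h n.succ_ne_zero
  simp only [Nat.succ_eq_add_one] at *
  have h4 : 1 / bhat β₂ ε g (n + 1) ≤ 2 * (1 / bhat β₂ ε g n) := by
    rw [mul_one_div, div_le_div_iff₀ hb' hb]
    linarith
  unfold stepSize
  rw [div_eq_mul_one_div η, div_eq_mul_one_div η, div_eq_mul_one_div (η * _),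
    div_eq_mul_one_div (η * (1 / (1 - β₁ ^ n)))]
  calc η * (1 / (1 - β₁ ^ (n + 1))) * (1 / bhat β₂ ε g (n + 1))
      ≤ η * (1 / (1 - β₁ ^ n)) * (2 * (1 / bhat β₂ ε g n)) := by gcongr
    _ = _ := by ring

/-- Consecutive step sizes satisfy `0 ≤ s' ≤ 2 s`, hence `|s' - s| ≤ s`, and the bound for the step
itself applies. -/
theorem stepSize_sub_mul_mom_sq_le (h₀ : 0 ≤ β₁) (h₁ : β₁ < β₂) (h2 : 1 / 2 ≤ β₂) (h : β₂ < 1)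
    (hε : 0 < ε) (hη : η = C₀ * √(1 - β₂)) (hC : 0 ≤ C₀) (n : ℕ) :
    ((stepSize β₁ β₂ η ε g (n + 1) - stepSize β₁ β₂ η ε g n) * mom β₁ g n) ^ 2
      ≤ C₀ ^ 2 * (accum β₁ g n / (accum β₂ g n + ε ^ 2)) := by
  rcases eq_or_ne n 0 with rfl | hn
  · simp [mom, accum]
  refine le_trans ?_ (stepSize_mul_mom_sq_le (g := g) h₀ h₁ h hε hη n)
  have hη0 : 0 ≤ η := by rw [hη]; positivity
  have e1 := stepSize_nonneg (β₂ := β₂) (g := g) h₀ (h₁.trans h) hε hη0 n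
  have e2 := stepSize_nonneg (β₂ := β₂) (g := g) h₀ (h₁.trans h) hε hη0 (n + 1)
  have e3 := stepSize_succ_le (g := g) h₀ (h₁.trans h) h2 h hε hη0 hn
  rw [mul_pow, mul_pow]
  exact mul_le_mul_of_nonneg_right (sq_le_sq' (by linarith) (by linarith)) (sq_nonneg _)

theorem proxyStep_nonneg (h₀ : 0 ≤ β₁) (h : β₁ < 1) (hε : 0 < ε) (hη : 0 ≤ η) (n : ℕ)
    (w y N : ℝ) : 0 ≤ proxyStep β₁ β₂ η ε n w y N := by
  unfold proxyStep
  have := proxyDen_pos (β₂ := β₂) hε n w y N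
  have := one_sub_pow_pos h₀ h n.succ_ne_zero
  positivity

theorem proxyStep_mul_le (h₀ : 0 ≤ β₁) (h₁ : β₁ < β₂) (h : β₂ < 1) (hε : 0 < ε)
    (hη : η = C₀ * √(1 - β₂)) (hC : 0 ≤ C₀) (n : ℕ) {w y N : ℝ} (hw : 0 ≤ w) (hN : 0 ≤ N) :
    proxyStep β₁ β₂ η ε n w y N * N ≤ C₀ / (1 - β₁) := by
  have h20 : 0 ≤ β₂ := h₀.trans h₁.le
  have ha := proxyDen_pos (β₂ := β₂) hε n w y N
  have h1 := sqrt_newWeight_mul_le (y := y) h20 h hε n hw hN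
  have hq := one_sub_pow_pos h₀ (h₁.trans h) n.succ_ne_zero
  have h3 := one_sub_le_one_sub_pow h₀ (h₁.trans h) n.succ_ne_zero
  have hq1 : 0 < 1 - β₁ := by linarith
  have hr := one_sub_pow_pos h20 h n.succ_ne_zero
  have hr1 : 1 - β₂ ^ (n + 1) ≤ 1 := by linarith [pow_nonneg h20 (n + 1)]
  simp only [Nat.succ_eq_add_one] at *
  have h4 : √(1 - β₂) ≤ √(newWeight β₂ n) := by
    apply Real.sqrt_le_sqrt
    unfold newWeight
    rw [le_div_iff₀ hr]
    nlinarith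
  unfold proxyStep
  rw [div_mul_eq_mul_div, div_le_iff₀ ha, div_mul_eq_mul_div, div_mul_eq_mul_div]
  rw [div_le_div_iff₀ hq hq1, hη]
  have h5 : √(1 - β₂) * N ≤ proxyDen β₂ ε n w y N :=
    (mul_le_mul_of_nonneg_right h4 hN).trans h1
  calc C₀ * √(1 - β₂) * N * (1 - β₁) = C₀ * (√(1 - β₂) * N) * (1 - β₁) := by ring
    _ ≤ C₀ * proxyDen β₂ ε n w y N * (1 - β₁ ^ (n + 1)) := by gcongr

/-- Price of making the step size predictable. Since `|b - a| ≤ 2 √p N` and `√p N ≤ a`, the relative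
quantity `(b - a) ^ 2 / a` is at most `4 √p N`; the weighted AM-GM inequality then separates a
quarter of the progress from a summable term. -/
theorem proxy_error_le (h₀ : 0 ≤ β₁) (h₁ : β₁ < β₂) (h : β₂ < 1)
    (hε : 0 < ε) (hη : η = C₀ * √(1 - β₂)) (hC : 0 ≤ C₀) (n : ℕ) {y N : ℝ}
    (hN : |g n - y| ≤ N) :
    (proxyStep β₁ β₂ η ε n (vhat β₂ g n) y N - stepSize β₁ β₂ η ε g (n + 1)) * (y * g n)
      ≤ proxyStep β₁ β₂ η ε n (vhat β₂ g n) y N * y ^ 2 / 4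
        + 4 * (C₀ * N / (1 - β₁)) * (g n ^ 2 / (accum β₂ g (n + 1) + ε ^ 2)) := by
  have h20 : 0 ≤ β₂ := h₀.trans h₁.le
  have hN0 : 0 ≤ N := (abs_nonneg _).trans hN
  have hw := vhat_nonneg (g := g) h20 h.le n
  have hη0 : 0 ≤ η := by rw [hη]; positivity
  have ha := proxyDen_pos (β₂ := β₂) hε n (vhat β₂ g n) y N
  have hb := bhat_pos (β₂ := β₂) (g := g) hε (n + 1)
  have hab := abs_bhat_sub_proxyDen_le (ε := ε) h20 h n hN
  have hpa := sqrt_newWeight_mul_le (y := y) h20 h hε n hw hN0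
  have hQ := Q_pos (g := g) h20 hε (n + 1)
  have hpQ := sqrt_mul_sqrt_newWeight_mul_Q_le (g := g) h20 h hε n.succ_ne_zero le_rfl
  have hq := one_sub_pow_pos h₀ (h₁.trans h) n.succ_ne_zero
  have h3 := one_sub_le_one_sub_pow h₀ (h₁.trans h) n.succ_ne_zero
  have hq1 : 0 < 1 - β₁ := by linarith
  simp only [Nat.succ_eq_add_one] at *
  unfold proxyStep stepSize
  set a := proxyDen β₂ ε n (vhat β₂ g n) y N
  set b := bhat β₂ ε g (n + 1)
  set Q := accum β₂ g (n + 1) + ε ^ 2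
  set p := newWeight β₂ n
  set q := 1 - β₁ ^ (n + 1)
  have hba : (b - a) ^ 2 ≤ 4 * (√p * N) * a := by
    have : (b - a) ^ 2 ≤ (2 * √p * N) ^ 2 := sq_le_sq' (abs_le.1 hab).1 (abs_le.1 hab).2
    nlinarith [mul_nonneg (Real.sqrt_nonneg p) hN0]
  have e1 : (η / q / a - η / q / b) * (y * g n)
      -- AM-GM with weight `a`: the difference of the two sides is an explicit square times `η / (q
      -- * a)`.
      ≤ η / q * (y ^ 2 / (4 * a) + (b - a) ^ 2 / a * (g n ^ 2 / b ^ 2)) := by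
    have : η / q * (y ^ 2 / (4 * a) + (b - a) ^ 2 / a * (g n ^ 2 / b ^ 2))
        - (η / q / a - η / q / b) * (y * g n)
        = η / q / a * (y / 2 - (b - a) * g n / b) ^ 2 := by
      field_simp
      ring
    have : 0 ≤ η / q / a * (y / 2 - (b - a) * g n / b) ^ 2 := by positivity
    linarith
  have e2 : (b - a) ^ 2 / a ≤ 4 * (√p * N) := by
    rw [div_le_iff₀ ha]; exact hba
  have e3 : η / q * √p * (g n ^ 2 / b ^ 2) ≤ C₀ / (1 - β₁) * (g n ^ 2 / Q) := by
    have f1 : √(1 - β₂) * √p / b ^ 2 ≤ 1 / Q := by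
      rw [div_le_div_iff₀ (by positivity) hQ]
      linarith
    have f2 : C₀ / q ≤ C₀ / (1 - β₁) := by gcongr
    calc η / q * √p * (g n ^ 2 / b ^ 2) = C₀ / q * (g n ^ 2 * (√(1 - β₂) * √p / b ^ 2)) := by
          rw [hη]; ring
      _ ≤ C₀ / (1 - β₁) * (g n ^ 2 * (1 / Q)) := by gcongr
      _ = _ := by ring
  calc _ ≤ η / q * (y ^ 2 / (4 * a) + (b - a) ^ 2 / a * (g n ^ 2 / b ^ 2)) := e1
    _ ≤ η / q * (y ^ 2 / (4 * a) + 4 * (√p * N) * (g n ^ 2 / b ^ 2)) := by gcongr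
    _ = η / q / a * y ^ 2 / 4 + 4 * N * (η / q * √p * (g n ^ 2 / b ^ 2)) := by
        field_simp
    _ ≤ η / q / a * y ^ 2 / 4 + 4 * N * (C₀ / (1 - β₁) * (g n ^ 2 / Q)) := by gcongr
    _ = _ := by ring

/-- The relative change `(b' - b) / b'` is at most `1` in absolute value, because `0 ≤ b ≤ 2 b'`. So
one of the two factors of its square can be discarded, and `p` occurs only to the first power. -/
theorem mul_sq_div_le {a b b' p B N : ℝ} (hb' : 0 < b') (hN0 : 0 ≤ N) (hp : 0 ≤ p) (hb : 0 ≤ b)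
    (hb2 : b ≤ 2 * b') (hab : |b' - a| ≤ 2 * p * N) (hbb : |b' - b| ≤ p * B) :
    a * ((b' - b) / b') ^ 2 ≤ p * (B + 2 * N) := by
  have hD : |(b' - b) / b'| ≤ 1 := by
    rw [abs_le, le_div_iff₀ hb', div_le_iff₀ hb']
    constructor <;> linarith
  have ha' : a ≤ b' + 2 * p * N := by linarith [(abs_le.1 hab).1]
  have hD2 : ((b' - b) / b') ^ 2 ≤ 1 := by
    rw [← sq_abs]; exact pow_le_one₀ (abs_nonneg _) hD
  have hD3 : b' * ((b' - b) / b') ^ 2 ≤ p * B := by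
    calc b' * ((b' - b) / b') ^ 2 = |(b' - b) / b'| * |b' - b| := by
          rw [← sq_abs, sq, ← mul_assoc, mul_comm b', mul_assoc, mul_comm b', abs_div,
            abs_of_pos hb', div_mul_cancel₀ _ hb'.ne']
      _ ≤ 1 * (p * B) := by gcongr
      _ = _ := one_mul _
  have hD4 : 2 * p * N * ((b' - b) / b') ^ 2 ≤ 2 * p * N * 1 := by gcongr
  have hD5 := mul_le_mul_of_nonneg_right ha' (sq_nonneg ((b' - b) / b'))
  linarith

theorem abs_mul_mom_div_le (h₀ : 0 ≤ β₁) (h₁ : β₁ < β₂) (h : β₂ < 1) (hε : 0 < ε)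
    (hη : η = C₀ * √(1 - β₂)) (hC : 0 ≤ C₀) {n : ℕ} (hn : n ≠ 0) :
    |η * mom β₁ g n / bhat β₂ ε g n| ≤ C₀ * √(1 - β₁) := by
  have h20 : 0 ≤ β₂ := h₀.trans h₁.le
  have h11 : β₁ < 1 := h₁.trans h
  have hb := bhat_pos (β₂ := β₂) (g := g) hε n
  have hQ := Q_pos (g := g) h20 hε n
  have hA := accum_nonneg (g := g) h₀ n
  have hAQ : accum β₁ g n ≤ accum β₂ g n + ε ^ 2 := by
    linarith [accum_mono (g := g) h₀ h₁.le n, sq_nonneg ε]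
  have hmQ := mul_Q_le (g := g) h20 h hε hn
  have hm := mom_sq_le (g := g) h₀ h11 n
  have hq := one_sub_pow_pos h₀ h11 hn
  have hq1 : 0 < 1 - β₁ := by linarith
  have hq1' : 1 - β₁ ^ n ≤ 1 := by linarith [pow_nonneg h₀ n]
  have hr1 : 1 - β₂ ^ n ≤ 1 := by linarith [pow_nonneg h20 n]
  set b := bhat β₂ ε g n
  set Q := accum β₂ g n + ε ^ 2
  set m := mom β₁ g n
  set A := accum β₁ g n
  set q := 1 - β₁ ^ n
  apply abs_le_of_sq_le_sq _ (by positivity)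
  rw [mul_pow C₀, Real.sq_sqrt hq1.le, div_pow, mul_pow, hη, mul_pow,
    Real.sq_sqrt (by linarith), div_le_iff₀ (by positivity)]
  have g1 : m ^ 2 ≤ (1 - β₁) * A := hm.trans (by
    have : 0 ≤ (1 - β₁) * A := by positivity
    nlinarith)
  have g2 : (1 - β₂) * Q ≤ b ^ 2 := hmQ.trans (by nlinarith [sq_nonneg b])
  have g3 : (1 - β₂) * m ^ 2 ≤ (1 - β₁) * b ^ 2 := by
    calc (1 - β₂) * m ^ 2 ≤ (1 - β₂) * ((1 - β₁) * Q) := by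
          apply mul_le_mul_of_nonneg_left _ (by linarith)
          exact g1.trans (by gcongr)
      _ = (1 - β₁) * ((1 - β₂) * Q) := by ring
      _ ≤ (1 - β₁) * b ^ 2 := by gcongr
  nlinarith [mul_le_mul_of_nonneg_left g3 (sq_nonneg C₀)]

/-- The step size changes for two reasons. The change of denominator is treated as in
`proxy_error_le`, at the cost of another quarter of the progress; the change of the bias correction
`1 / (1 - β₁ ^ n)` is monotone, so its total is bounded by telescoping. -/
theorem momentum_error_le {κ B : ℝ} (h₀ : 0 ≤ β₁) (h₁ : β₁ < β₂) (h2 : 1 / 2 ≤ β₂) (h : β₂ < 1)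
    (hε : 0 < ε) (hη : η = C₀ * √(1 - β₂)) (hC : 0 ≤ C₀) (hκ : 0 ≤ κ) (n : ℕ) {y N : ℝ}
    (hN : |g n - y| ≤ N) (hB : ∀ k < n + 1, |g k| ≤ B) :
    κ * (stepSize β₁ β₂ η ε g n - stepSize β₁ β₂ η ε g (n + 1)) * mom β₁ g n * y
      ≤ proxyStep β₁ β₂ η ε n (vhat β₂ g n) y N * y ^ 2 / 4
        + κ ^ 2 * (1 - β₁) * C₀ * (B + 2 * N) * (accum β₁ g n / (accum β₂ g n + ε ^ 2))
        + κ * C₀ * √(1 - β₁) * biasDrop β₁ n * |y| := by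
  have h20 : 0 ≤ β₂ := h₀.trans h₁.le
  have h11 : β₁ < 1 := h₁.trans h
  have hN0 : 0 ≤ N := (abs_nonneg _).trans hN
  have hη0 : 0 ≤ η := by rw [hη]; positivity
  have he := proxyStep_nonneg (β₂ := β₂) h₀ h11 hε hη0 n (vhat β₂ g n) y N
  rcases eq_or_ne n 0 with rfl | hn
  · simp only [mom, accum, biasDrop]
    simp
    positivity
  have hB0 : 0 ≤ B := (abs_nonneg _).trans (hB n n.lt_succ_self)
  have hw := vhat_nonneg (g := g) h20 h.le n
  have ha := proxyDen_pos (β₂ := β₂) hε n (vhat β₂ g n) y N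
  have hb := bhat_pos (β₂ := β₂) (g := g) hε n
  have hb' := bhat_pos (β₂ := β₂) (g := g) hε (n + 1)
  have hab := abs_bhat_sub_proxyDen_le (ε := ε) h20 h n hN
  have hbb := abs_bhat_sub_le (ε := ε) h20 h hB
  have hb2 := bhat_le_two_mul (g := g) h2 h hε hn
  have hQ := Q_pos (g := g) h20 hε n
  have hA := accum_nonneg (g := g) h₀ n
  have hAQ : accum β₁ g n ≤ accum β₂ g n + ε ^ 2 := by
    linarith [accum_mono (g := g) h₀ h₁.le n, sq_nonneg ε]
  have hpQ := sqrt_mul_sqrt_newWeight_mul_Q_le (g := g) h20 h hε hn n.le_succ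
  have hmQ := mul_Q_le (g := g) h20 h hε hn
  have hm := mom_sq_le (g := g) h₀ h11 n
  have hq := one_sub_pow_pos h₀ h11 hn
  have hq' := one_sub_pow_pos h₀ h11 n.succ_ne_zero
  have hqq := inv_one_sub_pow_anti h₀ h11 hn n.le_succ
  have hq1 : 0 < 1 - β₁ := by linarith
  have hq1' : 1 - β₁ ^ n ≤ 1 := by linarith [pow_nonneg h₀ n]
  have hbd := biasDrop_nonneg h₀ h11 n
  have hbd' : biasDrop β₁ n = 1 / (1 - β₁ ^ n) - 1 / (1 - β₁ ^ (n + 1)) := by simp [biasDrop, hn]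
  have hr1 : 1 - β₂ ^ n ≤ 1 := by linarith [pow_nonneg h20 n]
  simp only [Nat.succ_eq_add_one] at *
  unfold proxyStep stepSize at *
  set a := proxyDen β₂ ε n (vhat β₂ g n) y N
  set b := bhat β₂ ε g n
  set b' := bhat β₂ ε g (n + 1)
  set Q := accum β₂ g n + ε ^ 2
  set p := newWeight β₂ n
  set m := mom β₁ g n
  set A := accum β₁ g n
  set q := 1 - β₁ ^ n
  set q' := 1 - β₁ ^ (n + 1)
  -- Separates the change of the denominator, at the new bias correction, from the change of the
  -- bias correction, at the old denominator.
  have split : κ * (η / q / b - η / q' / b') * m * y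
      = η / q' * (κ * ((b' - b) / b') * (m / b) * y) + κ * (η * m / b) * biasDrop β₁ n * y := by
    rw [hbd']
    field_simp
    ring
  have t1 : κ * ((b' - b) / b') * (m / b) * y
      ≤ y ^ 2 / (4 * a) + κ ^ 2 * (a * ((b' - b) / b') ^ 2) * (m ^ 2 / b ^ 2) := by
    have : y ^ 2 / (4 * a) + κ ^ 2 * (a * ((b' - b) / b') ^ 2) * (m ^ 2 / b ^ 2)
        - κ * ((b' - b) / b') * (m / b) * y
        = a * (y / (2 * a) - κ * ((b' - b) / b') * (m / b)) ^ 2 := by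
      field_simp
      ring
    have : 0 ≤ a * (y / (2 * a) - κ * ((b' - b) / b') * (m / b)) ^ 2 := by positivity
    linarith
  have t2 : a * ((b' - b) / b') ^ 2 ≤ √p * (B + 2 * N) :=
    mul_sq_div_le (p := √p) hb' hN0 (Real.sqrt_nonneg _) hb.le hb2 hab hbb
  have t3 : η / q' * √p * (m ^ 2 / b ^ 2) ≤ C₀ * (1 - β₁) * (A / Q) := by
    have f1 : √(1 - β₂) * √p / b ^ 2 ≤ 1 / Q := by
      rw [div_le_div_iff₀ (by positivity) hQ]
      linarith
    have f2 : 1 / q' * m ^ 2 ≤ (1 - β₁) * A := by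
      calc 1 / q' * m ^ 2 ≤ 1 / q * m ^ 2 := by gcongr
        _ ≤ 1 / q * ((1 - β₁) * q * A) := by gcongr
        _ = _ := by field_simp
    calc η / q' * √p * (m ^ 2 / b ^ 2)
        = C₀ * (1 / q' * m ^ 2) * (√(1 - β₂) * √p / b ^ 2) := by rw [hη]; ring
      _ ≤ C₀ * ((1 - β₁) * A) * (1 / Q) := by gcongr
      _ = _ := by ring
  have t4 : |η * m / b| ≤ C₀ * √(1 - β₁) := abs_mul_mom_div_le h₀ h₁ h hε hη hC hn
  rw [split]
  have u1 : η / q' * (κ * ((b' - b) / b') * (m / b) * y)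
      ≤ η / q' / a * y ^ 2 / 4 + κ ^ 2 * (1 - β₁) * C₀ * (B + 2 * N) * (A / Q) := by
    calc _ ≤ η / q' * (y ^ 2 / (4 * a) + κ ^ 2 * (a * ((b' - b) / b') ^ 2) * (m ^ 2 / b ^ 2)) := by
          gcongr
      _ ≤ η / q' * (y ^ 2 / (4 * a) + κ ^ 2 * (√p * (B + 2 * N)) * (m ^ 2 / b ^ 2)) := by gcongr
      _ = η / q' / a * y ^ 2 / 4 + κ ^ 2 * (B + 2 * N) * (η / q' * √p * (m ^ 2 / b ^ 2)) := by
          field_simp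
      _ ≤ η / q' / a * y ^ 2 / 4 + κ ^ 2 * (B + 2 * N) * (C₀ * (1 - β₁) * (A / Q)) := by gcongr
      _ = _ := by ring
  have u2 : κ * (η * m / b) * biasDrop β₁ n * y ≤ κ * C₀ * √(1 - β₁) * biasDrop β₁ n * |y| := by
    calc κ * (η * m / b) * biasDrop β₁ n * y ≤ |κ * (η * m / b) * biasDrop β₁ n * y| := le_abs_self _
      _ = κ * |η * m / b| * biasDrop β₁ n * |y| := by
          rw [abs_mul, abs_mul, abs_mul, abs_of_nonneg hκ, abs_of_nonneg hbd]
      _ ≤ κ * (C₀ * √(1 - β₁)) * biasDrop β₁ n * |y| := by gcongr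
      _ = _ := by ring
  linarith

end step

/-! ### Smooth functions: Lipschitz gradient, self-bounding gradient, descent with a gradient taken
elsewhere. -/

section smooth

variable {d : ℕ} {L fstar : ℝ} {f : E d → ℝ}

/-- The quadratic bounds based at `x` and at `y` are compared at two points symmetric about the
midpoint, `x + w / 2 ± v`. The values of `f` cancel, and the parallelogram law yields `⟪D, v⟫ ≤ L
(‖v‖² + ‖w‖² / 4)` for every `v`, without loss in the constant. -/
theorem IsLSmooth.norm_gradient_sub_le (hf : IsLSmooth L f) (hL : 0 < L) (x y : E d) :
    ‖gradient f y - gradient f x‖ ≤ L * ‖y - x‖ := by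
  set D := gradient f y - gradient f x with hD
  set w := y - x with hw
  have key : ∀ v : E d, inner ℝ D v ≤ L * (‖v‖ ^ 2 + ‖w‖ ^ 2 / 4) := by
    intro v
    have h1 := (abs_le.1 (hf.2 x (x + ((1 / 2 : ℝ) • w + v)))).2
    have h2 := (abs_le.1 (hf.2 y (x + ((1 / 2 : ℝ) • w + v)))).1
    have h3 := (abs_le.1 (hf.2 x (x + ((1 / 2 : ℝ) • w - v)))).1
    have h4 := (abs_le.1 (hf.2 y (x + ((1 / 2 : ℝ) • w - v)))).2
    have hy : y = x + w := by rw [hw]; abel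
    have e1 : x + ((1 / 2 : ℝ) • w + v) - x = (1 / 2 : ℝ) • w + v := by abel
    have e3 : x + ((1 / 2 : ℝ) • w - v) - x = (1 / 2 : ℝ) • w - v := by abel
    have e2 : x + ((1 / 2 : ℝ) • w + v) - y = v - (1 / 2 : ℝ) • w := by
      rw [hy]; module
    have e4 : x + ((1 / 2 : ℝ) • w - v) - y = -v - (1 / 2 : ℝ) • w := by
      rw [hy]; module
    have n1 : ‖x - (x + ((1 / 2 : ℝ) • w + v))‖ ^ 2 = ‖(1 / 2 : ℝ) • w + v‖ ^ 2 := by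
      rw [norm_sub_rev, e1]
    have n2 : ‖y - (x + ((1 / 2 : ℝ) • w + v))‖ ^ 2 = ‖(1 / 2 : ℝ) • w - v‖ ^ 2 := by
      rw [norm_sub_rev, e2, norm_sub_rev]
    have n3 : ‖x - (x + ((1 / 2 : ℝ) • w - v))‖ ^ 2 = ‖(1 / 2 : ℝ) • w - v‖ ^ 2 := by
      rw [norm_sub_rev, e3]
    have n4 : ‖y - (x + ((1 / 2 : ℝ) • w - v))‖ ^ 2 = ‖(1 / 2 : ℝ) • w + v‖ ^ 2 := by
      rw [norm_sub_rev, e4, ← norm_neg]; congr 2; abel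
    rw [e1, n1] at h1
    rw [e2, n2] at h2
    rw [e3, n3] at h3
    rw [e4, n4] at h4
    have par := parallelogram_law_with_norm ℝ ((1 / 2 : ℝ) • w) v
    have hn : ‖(1 / 2 : ℝ) • w‖ = ‖w‖ / 2 := by
      rw [norm_smul]; norm_num; ring
    rw [hn] at par
    simp only [inner_add_right, inner_sub_right, inner_neg_right] at h1 h2 h3 h4
    rw [hD, inner_sub_left]
    nlinarith
  -- This `v` maximises `⟪D, v⟫ - L ‖v‖²`.
  have h := key ((1 / (2 * L)) • D)
  rw [inner_smul_right, real_inner_self_eq_norm_sq, norm_smul, Real.norm_of_nonneg (by positivity)]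
    at h
  have h' : ‖D‖ ^ 2 ≤ (L * ‖w‖) ^ 2 := by
    have e : L * ((1 / (2 * L) * ‖D‖) ^ 2 + ‖w‖ ^ 2 / 4) = ‖D‖ ^ 2 / (4 * L) + L * ‖w‖ ^ 2 / 4 := by
      field_simp
      ring
    rw [e] at h
    have h2 : ‖D‖ ^ 2 / (4 * L) ≤ L * ‖w‖ ^ 2 / 4 := by
      have : 1 / (2 * L) * ‖D‖ ^ 2 = 2 * (‖D‖ ^ 2 / (4 * L)) := by field_simp; ring
      linarith
    rw [div_le_iff₀ (by positivity)] at h2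
    nlinarith
  exact abs_le_of_sq_le_sq' h' (by positivity) |>.2

theorem IsLSmooth.continuous_gradient (hf : IsLSmooth L f) (hL : 0 < L) :
    Continuous (gradient f) := by
  have : LipschitzWith L.toNNReal (gradient f) := by
    apply LipschitzWith.of_dist_le_mul
    intro x y
    rw [dist_eq_norm, dist_eq_norm, Real.coe_toNNReal _ hL.le]
    exact hf.norm_gradient_sub_le hL y x
  exact this.continuous

/-- One gradient step of length `1 / L` decreases `f` by at least `‖∇f‖² / (2 L)` and cannot go
below `fstar`. -/
theorem IsLSmooth.sq_norm_gradient_le (hf : IsLSmooth L f) (hL : 0 < L) (hb : ∀ x, fstar ≤ f x)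
    (x : E d) : ‖gradient f x‖ ^ 2 ≤ 2 * L * (f x - fstar) := by
  have h := (abs_le.1 (hf.2 x (x - (1 / L) • gradient f x))).2
  have e1 : x - (1 / L) • gradient f x - x = -((1 / L) • gradient f x) := by abel
  have e2 : x - (x - (1 / L) • gradient f x) = (1 / L) • gradient f x := by abel
  rw [e1, e2, inner_neg_right, inner_smul_right, real_inner_self_eq_norm_sq, norm_smul,
    Real.norm_of_nonneg (by positivity)] at h
  have h1 := hb (x - (1 / L) • gradient f x)
  have e : L / 2 * (1 / L * ‖gradient f x‖) ^ 2 = ‖gradient f x‖ ^ 2 / (2 * L) := by field_simp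
  have e' : 1 / L * ‖gradient f x‖ ^ 2 = 2 * (‖gradient f x‖ ^ 2 / (2 * L)) := by field_simp
  rw [e, e'] at h
  have : ‖gradient f x‖ ^ 2 / (2 * L) ≤ f x - fstar := by linarith
  rw [div_le_iff₀ (by positivity)] at this
  linarith

theorem IsLSmooth.le_add_inner (hf : IsLSmooth L f) (hL : 0 < L) (x y y' : E d) :
    f y' ≤ f y + inner ℝ (gradient f x) (y' - y) + L * ‖y' - y‖ ^ 2 + L / 2 * ‖y - x‖ ^ 2 := by
  have h1 := (abs_le.1 (hf.2 y y')).2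
  rw [norm_sub_rev] at h1
  have h2 := real_inner_le_norm (gradient f y - gradient f x) (y' - y)
  rw [inner_sub_left] at h2
  have h3 := hf.norm_gradient_sub_le hL x y
  have h4 : ‖gradient f y - gradient f x‖ * ‖y' - y‖ ≤ L * ‖y - x‖ * ‖y' - y‖ := by gcongr
  nlinarith [mul_nonneg hL.le (sq_nonneg (‖y - x‖ - ‖y' - y‖))]

end smooth

/-! ### Noise levels and comparison of norms. -/

/-- The level of the noise in a coordinate in which the gradient is `y`. -/
def noiseLevel (σ₀ σ₁ y : ℝ) : ℝ := √(σ₀ ^ 2 + σ₁ ^ 2 * y ^ 2)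

theorem noiseLevel_nonneg (σ₀ σ₁ y : ℝ) : 0 ≤ noiseLevel σ₀ σ₁ y := Real.sqrt_nonneg _

theorem sq_noiseLevel (σ₀ σ₁ y : ℝ) : noiseLevel σ₀ σ₁ y ^ 2 = σ₀ ^ 2 + σ₁ ^ 2 * y ^ 2 :=
  Real.sq_sqrt (by positivity)

theorem noiseLevel_le {σ₀ σ₁ y s₀ s₁ Y : ℝ} (h₀ : |σ₀| ≤ s₀) (h₁ : |σ₁| ≤ s₁) (hy : |y| ≤ Y) :
    noiseLevel σ₀ σ₁ y ≤ s₀ + s₁ * Y := by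
  have a := abs_nonneg σ₀
  have b := abs_nonneg σ₁
  have c := abs_nonneg y
  apply Real.sqrt_le_iff.2
  constructor
  · nlinarith [mul_nonneg (b.trans h₁) (c.trans hy)]
  · rw [← sq_abs σ₀, ← sq_abs σ₁, ← sq_abs y, ← mul_pow]
    have : |σ₁| * |y| ≤ s₁ * Y := mul_le_mul h₁ hy c (b.trans h₁)
    nlinarith [mul_nonneg b c, mul_nonneg (a.trans h₀) (mul_nonneg (b.trans h₁) (c.trans hy))]

theorem abs_coord_le_supNorm {d : ℕ} (w : E d) (i : Fin d) : |w i| ≤ supNorm w := by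
  have := norm_le_pi_norm (WithLp.ofLp w : Fin d → ℝ) i
  rwa [Real.norm_eq_abs] at this

theorem supNorm_nonneg {d : ℕ} (w : E d) : 0 ≤ supNorm w := norm_nonneg _

theorem supNorm_le_norm {d : ℕ} (w : E d) : supNorm w ≤ ‖w‖ := by
  unfold supNorm
  rw [pi_norm_le_iff_of_nonneg (norm_nonneg _)]
  exact fun i => PiLp.norm_apply_le w i

theorem abs_coord_le_norm {d : ℕ} (w : E d) (i : Fin d) : |w i| ≤ ‖w‖ := by
  rw [← Real.norm_eq_abs]
  exact PiLp.norm_apply_le w i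

theorem norm_sq_le_of_coord {d : ℕ} {w : E d} {b : Fin d → ℝ} (h : ∀ i, w i ^ 2 ≤ b i) :
    ‖w‖ ^ 2 ≤ ∑ i, b i := by
  rw [EuclideanSpace.real_norm_sq_eq]
  exact Finset.sum_le_sum fun i _ => h i

/-! ### One descent step along an Adam trajectory. -/

section path

variable {d : ℕ} {L β₁ β₂ ε η C₀ κ : ℝ} {f : E d → ℝ} {σ₀ σ₁ : E d} {X gs : ℕ → E d}

/-- The points `X n` are produced by Adam from the stochastic gradients `gs n`. -/
def IsAdamPath (β₁ β₂ η ε : ℝ) (X gs : ℕ → E d) : Prop :=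
  ∀ n i, X (n + 1) i = X n i - stepSize β₁ β₂ η ε (fun k => gs k i) (n + 1)
    * mom β₁ (fun k => gs k i) (n + 1)

/-- The extrapolated points of Adam. -/
def shifted (β₁ β₂ η ε κ : ℝ) (X gs : ℕ → E d) (n : ℕ) : E d :=
  WithLp.toLp 2 fun i => X n i - κ * (stepSize β₁ β₂ η ε (fun k => gs k i) n
    * mom β₁ (fun k => gs k i) n)

/-- The proxy step sizes along a path. -/
def pathProxy (β₁ β₂ η ε : ℝ) (f : E d → ℝ) (σ₀ σ₁ : E d) (X gs : ℕ → E d) (n : ℕ) (i : Fin d) :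
    ℝ :=
  proxyStep β₁ β₂ η ε n (vhat β₂ (fun k => gs k i) n) (gradient f (X n) i)
    (noiseLevel (σ₀ i) (σ₁ i) (gradient f (X n) i))

/-- The value of `κ` is chosen so that `(1 + κ) (1 - β₁) = 1` and `(1 + κ) β₁ = κ`. The fresh
gradient then enters with the full step size, and the old momentum only through the change of step
size. -/
theorem shifted_succ_sub (h : β₁ < 1) (hκ : κ = β₁ / (1 - β₁))
    (hX : IsAdamPath β₁ β₂ η ε X gs) (n : ℕ) (i : Fin d) :
    (shifted β₁ β₂ η ε κ X gs (n + 1) - shifted β₁ β₂ η ε κ X gs n) i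
      = -(stepSize β₁ β₂ η ε (fun k => gs k i) (n + 1) * gs n i)
        - κ * ((stepSize β₁ β₂ η ε (fun k => gs k i) (n + 1)
          - stepSize β₁ β₂ η ε (fun k => gs k i) n) * mom β₁ (fun k => gs k i) n) := by
  have h1 : 1 - β₁ ≠ 0 := by linarith
  simp only [shifted, PiLp.sub_apply, hX n i, mom]
  rw [hκ]
  field_simp
  ring

/-- Writing the sample as gradient plus noise gives minus one full progress term and a centred noise
term. The proxy and momentum errors each give back a quarter of the progress, whence the coefficient
`-1/2`. -/
theorem shifted_step_le (hL : 0 < L) (hf : IsLSmooth L f) (h₀ : 0 ≤ β₁) (h₁ : β₁ < β₂)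
    (h2 : 1 / 2 ≤ β₂) (h : β₂ < 1) (hε : 0 < ε) (hη : η = C₀ * √(1 - β₂)) (hC : 0 ≤ C₀)
    (hκ : κ = β₁ / (1 - β₁)) (hX : IsAdamPath β₁ β₂ η ε X gs) (n : ℕ) {N B Y : ℝ}
    (hnoise : ∀ i, |gs n i - gradient f (X n) i|
      ≤ noiseLevel (σ₀ i) (σ₁ i) (gradient f (X n) i))
    (hN : ∀ i, noiseLevel (σ₀ i) (σ₁ i) (gradient f (X n) i) ≤ N)
    (hB : ∀ k < n + 1, ∀ i, |gs k i| ≤ B) (hY : ∀ i, |gradient f (X n) i| ≤ Y) :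
    f (shifted β₁ β₂ η ε κ X gs (n + 1)) ≤ f (shifted β₁ β₂ η ε κ X gs n)
      + ∑ i, (-(1 / 2) * (pathProxy β₁ β₂ η ε f σ₀ σ₁ X gs n i * gradient f (X n) i ^ 2)
        - pathProxy β₁ β₂ η ε f σ₀ σ₁ X gs n i * gradient f (X n) i
            * (gs n i - gradient f (X n) i)
        + (4 * (C₀ * N / (1 - β₁)) + 2 * L * (C₀ / (1 - β₁)) ^ 2)
            * (gs n i ^ 2 / (accum β₂ (fun k => gs k i) (n + 1) + ε ^ 2))
        + (κ ^ 2 * (1 - β₁) * C₀ * (B + 2 * N) + 5 / 2 * L * κ ^ 2 * C₀ ^ 2)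
            * (accum β₁ (fun k => gs k i) n / (accum β₂ (fun k => gs k i) n + ε ^ 2))
        + κ * C₀ * √(1 - β₁) * biasDrop β₁ n * Y) := by
  have h11 : β₁ < 1 := h₁.trans h
  have h20 : 0 ≤ β₂ := h₀.trans h₁.le
  have hq1 : 0 < 1 - β₁ := by linarith
  have hκ0 : 0 ≤ κ := by rw [hκ]; positivity
  have hbd := biasDrop_nonneg h₀ h11 n
  have base := hf.le_add_inner hL (X n) (shifted β₁ β₂ η ε κ X gs n)
    (shifted β₁ β₂ η ε κ X gs (n + 1))
  have b1 : ‖shifted β₁ β₂ η ε κ X gs (n + 1) - shifted β₁ β₂ η ε κ X gs n‖ ^ 2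
      ≤ ∑ i, (2 * ((C₀ / (1 - β₁)) ^ 2
          * (gs n i ^ 2 / (accum β₂ (fun k => gs k i) (n + 1) + ε ^ 2)))
        + 2 * (κ ^ 2 * (C₀ ^ 2 * (accum β₁ (fun k => gs k i) n
          / (accum β₂ (fun k => gs k i) n + ε ^ 2))))) := by
    apply norm_sq_le_of_coord
    intro i
    rw [shifted_succ_sub h11 hκ hX]
    have a1 := stepSize_mul_sq_le (g := fun k => gs k i) h₀ h₁ h hε hη n
    have a2 := mul_le_mul_of_nonneg_left (stepSize_sub_mul_mom_sq_le (g := fun k => gs k i)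
      h₀ h₁ h2 h hε hη hC n) (sq_nonneg κ)
    have gen : ∀ u v U V : ℝ, u ^ 2 ≤ U → κ ^ 2 * v ^ 2 ≤ V →
        (-u - κ * v) ^ 2 ≤ 2 * U + 2 * V := by
      intro u v U V hu hv
      nlinarith [sq_nonneg (u - κ * v)]
    exact gen _ _ _ _ a1 a2
  have b2 : ‖shifted β₁ β₂ η ε κ X gs n - X n‖ ^ 2
      ≤ ∑ i, κ ^ 2 * (C₀ ^ 2 * (accum β₁ (fun k => gs k i) n
          / (accum β₂ (fun k => gs k i) n + ε ^ 2))) := by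
    apply norm_sq_le_of_coord
    intro i
    have a1 := mul_le_mul_of_nonneg_left (stepSize_mul_mom_sq_le (g := fun k => gs k i)
      h₀ h₁ h hε hη n) (sq_nonneg κ)
    have : (shifted β₁ β₂ η ε κ X gs n - X n) i
        = -(κ * (stepSize β₁ β₂ η ε (fun k => gs k i) n * mom β₁ (fun k => gs k i) n)) := by
      simp [shifted]
    rw [this, neg_sq, mul_pow]
    exact a1
  have b3 : inner ℝ (gradient f (X n))
      (shifted β₁ β₂ η ε κ X gs (n + 1) - shifted β₁ β₂ η ε κ X gs n)
      ≤ ∑ i, (-(1 / 2) * (pathProxy β₁ β₂ η ε f σ₀ σ₁ X gs n i * gradient f (X n) i ^ 2)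
        - pathProxy β₁ β₂ η ε f σ₀ σ₁ X gs n i * gradient f (X n) i
            * (gs n i - gradient f (X n) i)
        + 4 * (C₀ * N / (1 - β₁))
            * (gs n i ^ 2 / (accum β₂ (fun k => gs k i) (n + 1) + ε ^ 2))
        + κ ^ 2 * (1 - β₁) * C₀ * (B + 2 * N)
            * (accum β₁ (fun k => gs k i) n / (accum β₂ (fun k => gs k i) n + ε ^ 2))
        + κ * C₀ * √(1 - β₁) * biasDrop β₁ n * Y) := by
    rw [PiLp.inner_apply]
    apply Finset.sum_le_sum
    intro i _
    rw [shifted_succ_sub h11 hκ hX]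
    have a1 := proxy_error_le (g := fun k => gs k i) h₀ h₁ h hε hη hC n (hnoise i)
    have a2 := momentum_error_le (g := fun k => gs k i) h₀ h₁ h2 h hε hη hC hκ0 n (hnoise i)
      (fun k hk => hB k hk i)
    have hQ := Q_pos (g := fun k => gs k i) h20 hε n
    have hQ' := Q_pos (g := fun k => gs k i) h20 hε (n + 1)
    have hA := accum_nonneg (g := fun k => gs k i) h₀ n
    have a3 : 4 * (C₀ * noiseLevel (σ₀ i) (σ₁ i) (gradient f (X n) i) / (1 - β₁))
          * (gs n i ^ 2 / (accum β₂ (fun k => gs k i) (n + 1) + ε ^ 2))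
        ≤ 4 * (C₀ * N / (1 - β₁))
          * (gs n i ^ 2 / (accum β₂ (fun k => gs k i) (n + 1) + ε ^ 2)) := by
      gcongr
      exact hN i
    have a4 : κ ^ 2 * (1 - β₁) * C₀ * (B + 2 * noiseLevel (σ₀ i) (σ₁ i) (gradient f (X n) i))
          * (accum β₁ (fun k => gs k i) n / (accum β₂ (fun k => gs k i) n + ε ^ 2))
        ≤ κ ^ 2 * (1 - β₁) * C₀ * (B + 2 * N)
          * (accum β₁ (fun k => gs k i) n / (accum β₂ (fun k => gs k i) n + ε ^ 2)) := by
      gcongr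
      exact hN i
    have a5 : κ * C₀ * √(1 - β₁) * biasDrop β₁ n * |gradient f (X n) i|
        ≤ κ * C₀ * √(1 - β₁) * biasDrop β₁ n * Y := by
      gcongr
      exact hY i
    simp only [RCLike.inner_apply, conj_trivial, pathProxy] at *
    linarith
  have hsum := add_le_add (add_le_add b3 (mul_le_mul_of_nonneg_left b1 hL.le))
    (mul_le_mul_of_nonneg_left b2 (show 0 ≤ L / 2 by positivity))
  rw [Finset.mul_sum, Finset.mul_sum, ← Finset.sum_add_distrib, ← Finset.sum_add_distrib] at hsum
  rw [add_assoc, add_assoc, ← add_assoc (inner ℝ _ _)] at base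
  refine base.trans (add_le_add le_rfl (hsum.trans (le_of_eq ?_)))
  apply Finset.sum_congr rfl
  intro i _
  ring

end path

/-! ### Summed descent and absorption of the martingale noise. -/

section path

variable {d : ℕ} {L β₁ β₂ ε η C₀ κ : ℝ} {f : E d → ℝ} {σ₀ σ₁ : E d} {X gs : ℕ → E d}

/-- The progress term of the descent inequality at step `n`. -/
def progress (β₁ β₂ η ε : ℝ) (f : E d → ℝ) (σ₀ σ₁ : E d) (X gs : ℕ → E d) (n : ℕ) : ℝ :=
  ∑ i, pathProxy β₁ β₂ η ε f σ₀ σ₁ X gs n i * gradient f (X n) i ^ 2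

/-- The noise term of the descent inequality at step `n`. -/
def noiseTerm (β₁ β₂ η ε : ℝ) (f : E d → ℝ) (σ₀ σ₁ : E d) (X gs : ℕ → E d) (n : ℕ) : ℝ :=
  ∑ i, -(pathProxy β₁ β₂ η ε f σ₀ σ₁ X gs n i * gradient f (X n) i
    * (gs n i - gradient f (X n) i))

/-- A predictable bound for the absolute value of the noise term at step `n`. -/
def noiseEnvelope (β₁ β₂ η ε : ℝ) (f : E d → ℝ) (σ₀ σ₁ : E d) (X gs : ℕ → E d) (n : ℕ) : ℝ :=
  ∑ i, pathProxy β₁ β₂ η ε f σ₀ σ₁ X gs n i * |gradient f (X n) i|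
    * noiseLevel (σ₀ i) (σ₁ i) (gradient f (X n) i)

theorem energy_le (hL : 0 < L) (hf : IsLSmooth L f) (h₀ : 0 ≤ β₁) (h₁ : β₁ < β₂)
    (h2 : 1 / 2 ≤ β₂) (h : β₂ < 1) (hε : 0 < ε) (hη : η = C₀ * √(1 - β₂)) (hC : 0 ≤ C₀)
    (hκ : κ = β₁ / (1 - β₁)) (hX : IsAdamPath β₁ β₂ η ε X gs) (t : ℕ) {N Y ℓ : ℝ}
    (hnoise : ∀ n < t, ∀ i, |gs n i - gradient f (X n) i|
      ≤ noiseLevel (σ₀ i) (σ₁ i) (gradient f (X n) i))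
    (hN : ∀ n < t, ∀ i, noiseLevel (σ₀ i) (σ₁ i) (gradient f (X n) i) ≤ N)
    (hY : ∀ n < t, ∀ i, |gradient f (X n) i| ≤ Y) (hN0 : 0 ≤ N) (hY0 : 0 ≤ Y)
    (hℓ : ∀ i, ∑ n ∈ Finset.range t,
      gs n i ^ 2 / (accum β₂ (fun k => gs k i) (n + 1) + ε ^ 2) ≤ ℓ) :
    f (shifted β₁ β₂ η ε κ X gs t)
        + 1 / 2 * ∑ n ∈ Finset.range t, progress β₁ β₂ η ε f σ₀ σ₁ X gs n
      ≤ f (X 0) + ∑ n ∈ Finset.range t, noiseTerm β₁ β₂ η ε f σ₀ σ₁ X gs n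
        + d * ((4 * (C₀ * N / (1 - β₁)) + 2 * L * (C₀ / (1 - β₁)) ^ 2) * ℓ
          + (κ ^ 2 * (1 - β₁) * C₀ * (N + Y + 2 * N) + 5 / 2 * L * κ ^ 2 * C₀ ^ 2)
            * (ℓ / (1 - β₁ / β₂))
          + κ * C₀ * √(1 - β₁) * Y * (1 / (1 - β₁))) := by
  have h11 : β₁ < 1 := h₁.trans h
  have hβ2 : 0 < β₂ := h₀.trans_lt h₁
  have hq1 : 0 < 1 - β₁ := by linarith
  have hκ0 : 0 ≤ κ := by rw [hκ]; positivity
  have hρ : 0 < 1 - β₁ / β₂ := sub_pos.2 ((div_lt_one hβ2).2 h₁)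
  set a := 4 * (C₀ * N / (1 - β₁)) + 2 * L * (C₀ / (1 - β₁)) ^ 2 with ha
  set b := κ ^ 2 * (1 - β₁) * C₀ * (N + Y + 2 * N) + 5 / 2 * L * κ ^ 2 * C₀ ^ 2 with hb
  set Gt : ℕ → Fin d → ℝ := fun n i => gs n i ^ 2 / (accum β₂ (fun k => gs k i) (n + 1) + ε ^ 2)
    with hGt
  set Bt : ℕ → Fin d → ℝ :=
    fun n i => accum β₁ (fun k => gs k i) n / (accum β₂ (fun k => gs k i) n + ε ^ 2) with hBt
  have ha0 : 0 ≤ a := by positivity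
  have hb0 : 0 ≤ b := by positivity
  have hsteps : ∀ s ≤ t, f (shifted β₁ β₂ η ε κ X gs s) ≤ f (X 0)
      + ∑ n ∈ Finset.range s, (-(1 / 2) * progress β₁ β₂ η ε f σ₀ σ₁ X gs n
        + noiseTerm β₁ β₂ η ε f σ₀ σ₁ X gs n + a * ∑ i, Gt n i + b * ∑ i, Bt n i
        + d * (κ * C₀ * √(1 - β₁) * Y) * biasDrop β₁ n) := by
    intro s
    induction s with
    | zero =>
      intro _
      have : shifted β₁ β₂ η ε κ X gs 0 = X 0 := by
        ext i; simp [shifted, mom]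
      simp [this]
    | succ s ih =>
      intro hs
      rw [Finset.sum_range_succ]
      have h3 := shifted_step_le hL hf h₀ h₁ h2 h hε hη hC hκ hX s (B := N + Y) (N := N) (Y := Y)
        (hnoise s (by omega)) (hN s (by omega)) (fun k hk i => by
          have e1 := hnoise k (by omega) i
          have e2 := hN k (by omega) i
          have e3 := hY k (by omega) i
          have e4 := abs_add_le (gs k i - gradient f (X k) i) (gradient f (X k) i)
          rw [sub_add_cancel] at e4
          linarith) (hY s (by omega))
      refine h3.trans ?_
      rw [← add_assoc]
      refine add_le_add (ih (by omega)) (le_of_eq ?_)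
      have hconst : d * (κ * C₀ * √(1 - β₁) * Y) * biasDrop β₁ s
          = ∑ _i : Fin d, κ * C₀ * √(1 - β₁) * biasDrop β₁ s * Y := by simp; ring
      rw [hconst]
      simp only [progress, noiseTerm, Finset.mul_sum, ← Finset.sum_add_distrib]
      exact Finset.sum_congr rfl fun i _ => by ring
  have h4 := hsteps t le_rfl
  simp only [Finset.sum_add_distrib, ← Finset.mul_sum] at h4
  have hB : ∀ i, ∑ n ∈ Finset.range t, Bt n i ≤ ℓ / (1 - β₁ / β₂) := by
    intro i
    rw [le_div_iff₀ hρ, mul_comm]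
    exact (sum_accum_div_le h₀ h₁ h.le hε t).trans (hℓ i)
  have e1 : ∑ n ∈ Finset.range t, ∑ i, Gt n i ≤ d * ℓ := by
    rw [Finset.sum_comm]
    refine (Finset.sum_le_sum fun i _ => hℓ i).trans (le_of_eq ?_)
    simp
  have e2 : ∑ n ∈ Finset.range t, ∑ i, Bt n i ≤ d * (ℓ / (1 - β₁ / β₂)) := by
    rw [Finset.sum_comm]
    refine (Finset.sum_le_sum fun i _ => hB i).trans (le_of_eq ?_)
    simp
  have e3 := mul_le_mul_of_nonneg_left (sum_biasDrop_le h₀ h11 t)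
    (show 0 ≤ d * (κ * C₀ * √(1 - β₁) * Y) by positivity)
  have e1' := mul_le_mul_of_nonneg_left e1 ha0
  have e2' := mul_le_mul_of_nonneg_left e2 hb0
  linarith

theorem pathProxy_nonneg (h₀ : 0 ≤ β₁) (h : β₁ < 1) (hε : 0 < ε) (hη : 0 ≤ η) (n : ℕ)
    (i : Fin d) : 0 ≤ pathProxy β₁ β₂ η ε f σ₀ σ₁ X gs n i :=
  proxyStep_nonneg h₀ h hε hη n _ _ _

theorem progress_nonneg (h₀ : 0 ≤ β₁) (h : β₁ < 1) (hε : 0 < ε) (hη : 0 ≤ η) (n : ℕ) :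
    0 ≤ progress β₁ β₂ η ε f σ₀ σ₁ X gs n :=
  Finset.sum_nonneg fun i _ => mul_nonneg (pathProxy_nonneg h₀ h hε hη n i) (sq_nonneg _)

/-- Cauchy-Schwarz over the coordinates, then `proxyStep_mul_le`: the proxy denominator contains the
noise level, so proxy step times noise level is bounded. This lets the quadratic variation be paid
by the progress. -/
theorem sq_noiseEnvelope_le (h₀ : 0 ≤ β₁) (h₁ : β₁ < β₂) (h : β₂ < 1) (hε : 0 < ε)
    (hη : η = C₀ * √(1 - β₂)) (hC : 0 ≤ C₀) {n : ℕ} {N : ℝ}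
    (hN : ∀ i, noiseLevel (σ₀ i) (σ₁ i) (gradient f (X n) i) ≤ N) :
    noiseEnvelope β₁ β₂ η ε f σ₀ σ₁ X gs n ^ 2
      ≤ d * C₀ * N / (1 - β₁) * progress β₁ β₂ η ε f σ₀ σ₁ X gs n := by
  have h11 : β₁ < 1 := h₁.trans h
  have hq1 : 0 < 1 - β₁ := by linarith
  have hη0 : 0 ≤ η := by rw [hη]; positivity
  refine sq_sum_le_card_mul_sum_sq.trans ?_
  rw [Finset.card_univ, Fintype.card_fin, mul_assoc, mul_div_assoc, mul_assoc]
  gcongr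
  rw [progress, Finset.mul_sum]
  apply Finset.sum_le_sum
  intro i _
  have he := pathProxy_nonneg (β₂ := β₂) (f := f) (σ₀ := σ₀) (σ₁ := σ₁) (X := X) (gs := gs)
    h₀ h11 hε hη0 n i
  have hn := noiseLevel_nonneg (σ₀ i) (σ₁ i) (gradient f (X n) i)
  have h3 : pathProxy β₁ β₂ η ε f σ₀ σ₁ X gs n i * noiseLevel (σ₀ i) (σ₁ i) (gradient f (X n) i)
      ≤ C₀ / (1 - β₁) :=
    proxyStep_mul_le h₀ h₁ h hε hη hC n (vhat_nonneg (h₀.trans h₁.le) h.le n) hn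
  have hNi := hN i
  set e := pathProxy β₁ β₂ η ε f σ₀ σ₁ X gs n i
  set y := gradient f (X n) i
  set ν := noiseLevel (σ₀ i) (σ₁ i) y
  calc (e * |y| * ν) ^ 2 = e * y ^ 2 * ((e * ν) * ν) := by rw [mul_pow, mul_pow, sq_abs]; ring
    _ ≤ e * y ^ 2 * (C₀ / (1 - β₁) * N) := by gcongr
    _ = C₀ * N / (1 - β₁) * (e * y ^ 2) := by ring

theorem abs_noiseTerm_le (h₀ : 0 ≤ β₁) (h : β₁ < 1) (hε : 0 < ε) (hη : 0 ≤ η) {n : ℕ}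
    (hnoise : ∀ i, |gs n i - gradient f (X n) i|
      ≤ noiseLevel (σ₀ i) (σ₁ i) (gradient f (X n) i)) :
    |noiseTerm β₁ β₂ η ε f σ₀ σ₁ X gs n| ≤ noiseEnvelope β₁ β₂ η ε f σ₀ σ₁ X gs n := by
  refine (Finset.abs_sum_le_sum_abs _ _).trans (Finset.sum_le_sum fun i _ => ?_)
  have he := pathProxy_nonneg (β₂ := β₂) (f := f) (σ₀ := σ₀) (σ₁ := σ₁) (X := X) (gs := gs)
    h₀ h hε hη n i
  rw [abs_neg, abs_mul, abs_mul, abs_of_nonneg he]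
  gcongr
  exact hnoise i

/-- With `c = d C₀ N / (1 - β₁)`, the choice `lam = 1 / (2 c)` makes the quadratic term `lam / 2 *
c` equal to one quarter of the progress. -/
theorem sum_noiseTerm_le (h₀ : 0 ≤ β₁) (h₁ : β₁ < β₂) (h : β₂ < 1) (hε : 0 < ε)
    (hη : η = C₀ * √(1 - β₂)) (hC : 0 ≤ C₀) {t : ℕ} {N lam ℓ : ℝ} (hN0 : 0 ≤ N) (hℓ0 : 0 ≤ ℓ)
    (hnoise : ∀ n < t, ∀ i, |gs n i - gradient f (X n) i|
      ≤ noiseLevel (σ₀ i) (σ₁ i) (gradient f (X n) i))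
    (hN : ∀ n < t, ∀ i, noiseLevel (σ₀ i) (σ₁ i) (gradient f (X n) i) ≤ N)
    (hlam : lam = 1 / (2 * (d * C₀ * N / (1 - β₁))))
    (hmart : lam * ∑ n ∈ Finset.range t, noiseTerm β₁ β₂ η ε f σ₀ σ₁ X gs n
      ≤ lam ^ 2 / 2 * ∑ n ∈ Finset.range t, noiseEnvelope β₁ β₂ η ε f σ₀ σ₁ X gs n ^ 2 + ℓ) :
    ∑ n ∈ Finset.range t, noiseTerm β₁ β₂ η ε f σ₀ σ₁ X gs n
      ≤ 1 / 4 * ∑ n ∈ Finset.range t, progress β₁ β₂ η ε f σ₀ σ₁ X gs n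
        + 2 * (d * C₀ * N / (1 - β₁)) * ℓ := by
  have h11 : β₁ < 1 := h₁.trans h
  have hq1 : 0 < 1 - β₁ := by linarith
  have hη0 : 0 ≤ η := by rw [hη]; positivity
  set c := d * C₀ * N / (1 - β₁) with hc
  have hc0 : 0 ≤ c := by positivity
  have hP : 0 ≤ ∑ n ∈ Finset.range t, progress β₁ β₂ η ε f σ₀ σ₁ X gs n :=
    Finset.sum_nonneg fun n _ => progress_nonneg h₀ h11 hε hη0 n
  have hE : ∑ n ∈ Finset.range t, noiseEnvelope β₁ β₂ η ε f σ₀ σ₁ X gs n ^ 2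
      ≤ c * ∑ n ∈ Finset.range t, progress β₁ β₂ η ε f σ₀ σ₁ X gs n := by
    rw [Finset.mul_sum]
    exact Finset.sum_le_sum fun n hn =>
      sq_noiseEnvelope_le h₀ h₁ h hε hη hC (hN n (Finset.mem_range.1 hn))
  -- If `c = 0` then `lam = 1 / 0 = 0` and `hmart` carries no information; but the envelopes, and so
  -- the noise terms, vanish.
  rcases hc0.eq_or_lt with hc1 | hc1
  · have hz : ∀ n ∈ Finset.range t, noiseTerm β₁ β₂ η ε f σ₀ σ₁ X gs n = 0 := by
      intro n hn
      have a1 := abs_noiseTerm_le (β₂ := β₂) h₀ h11 hε hη0 (hnoise n (Finset.mem_range.1 hn))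
      have a2 : noiseEnvelope β₁ β₂ η ε f σ₀ σ₁ X gs n ^ 2
          ≤ c * progress β₁ β₂ η ε f σ₀ σ₁ X gs n :=
        sq_noiseEnvelope_le h₀ h₁ h hε hη hC (hN n (Finset.mem_range.1 hn))
      rw [← hc1, zero_mul] at a2
      have a3 : noiseEnvelope β₁ β₂ η ε f σ₀ σ₁ X gs n = 0 := by
        have := le_antisymm a2 (sq_nonneg _)
        exact pow_eq_zero_iff (two_ne_zero) |>.1 this
      rw [a3] at a1
      exact abs_eq_zero.1 (le_antisymm a1 (abs_nonneg _))
    rw [Finset.sum_eq_zero hz]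
    positivity
  · have hl : 0 < lam := by rw [hlam]; positivity
    have h5 := mul_le_mul_of_nonneg_left hE (show 0 ≤ lam ^ 2 / 2 by positivity)
    have h6 : lam * c = 1 / 2 := by rw [hlam]; field_simp
    set M := ∑ n ∈ Finset.range t, noiseTerm β₁ β₂ η ε f σ₀ σ₁ X gs n
    set P := ∑ n ∈ Finset.range t, progress β₁ β₂ η ε f σ₀ σ₁ X gs n
    have h7 : lam * M ≤ lam * (1 / 4 * P + 2 * c * ℓ) := by
      calc lam * M ≤ lam ^ 2 / 2 * (c * P) + ℓ := hmart.trans (by gcongr)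
        _ = lam * (1 / 4 * P + 2 * c * ℓ) := by
          linear_combination (lam / 2 * P - 2 * ℓ) * h6
    exact le_of_mul_le_mul_left h7 hl

end path

/-! ### Arithmetic of the constant `G`. -/

/-- Closes the bootstrap. Here `Y = √G`, `u = 1 / (1 - β₁)`, `R = 1 / (1 - β₁ / β₂)`, `w = √(1 -
β₁)`, `b = β₁`. The left side contains four terms linear in `Y`; AM-GM pays for them with half of `Y
^ 2` and squares of their coefficients. These squares, and the terms free of `Y`, fit in half of the
left side of `hG`. -/
theorem budget {L C b u R D s₀ s₁ Y w l₁ l₂ Δ : ℝ} (hL : 0 ≤ L) (hC : 0 ≤ C)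
    (hu : 1 ≤ u) (hR : 1 ≤ R) (hD : 0 ≤ D) (hs₀ : 0 ≤ s₀)
    (hl₁ : 0 ≤ l₁) (hl₂ : 0 ≤ l₂) (hΔ : 0 ≤ Δ) (hw : w ^ 2 * u = 1)
    (hG : 8 * L * Δ + 256 * L ^ 2 * C ^ 2 * b ^ 2 * D ^ 2 * (u ^ 3 * R)
      + 4 * L ^ 2 * C ^ 2 * b ^ 2 * D * (u ^ 2 * R) + 48 * L * C * s₀ * u * D * l₁
      + 8 * L * C * b ^ 2 * (u ^ 2 * R) * (4 * s₀ + 5 / 2 * (L * C)) * D * l₂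
      + 8 * (3 * L ^ 2 * C ^ 2 * u ^ 2 + 8 * L * s₀ * C * u) * D * l₂
      + 2304 * L ^ 2 * C ^ 2 * s₁ ^ 2 * u ^ 2 * D ^ 2 * l₁ ^ 2
      + 256 * (16 * L ^ 2 * C ^ 2 * s₁ ^ 2 * u ^ 2
        + 9 * L ^ 2 * C ^ 2 * b ^ 4 * (1 + s₁ ^ 2) * (u ^ 4 * R ^ 2)) * D ^ 2 * l₂ ^ 2 ≤ Y ^ 2) :
    4 * L * (Δ + 2 * (D * C * (s₀ + s₁ * Y) * u) * l₁
        + D * ((4 * (C * (s₀ + s₁ * Y) * u) + 2 * L * (C * u) ^ 2) * l₂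
          + (b ^ 2 * u * C * (3 * (s₀ + s₁ * Y) + Y) + 5 / 2 * L * (b * u) ^ 2 * C ^ 2) * (l₂ * R)
          + b * u * C * w * Y * u))
      + 2 * L ^ 2 * (b * u) ^ 2 * C ^ 2 * D ≤ Y ^ 2 := by
  have hu0 : 0 ≤ u := by linarith
  have hR0 : 0 ≤ R := by linarith
  -- Each of the four squares `(Y - 4 x) ^ 2` gives `x * Y ≤ Y ^ 2 / 8 + 2 x ^ 2`, for `x` the
  -- coefficient of one linear term.
  have k1 := sq_nonneg (Y - 4 * (16 * L * D * C * u * s₁ * l₂))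
  have k2 := sq_nonneg (Y - 4 * (4 * L * D * b ^ 2 * u * C * (3 * s₁ + 1) * l₂ * R))
  have k3 := sq_nonneg (Y - 4 * (4 * L * D * b * u ^ 2 * C * w))
  have k4 := sq_nonneg (Y - 4 * (8 * L * D * C * u * s₁ * l₁))
  have hx3 : (4 * L * D * b * u ^ 2 * C * w) ^ 2 = 16 * L ^ 2 * D ^ 2 * b ^ 2 * u ^ 3 * C ^ 2 := by
    linear_combination 16 * L ^ 2 * D ^ 2 * b ^ 2 * u ^ 3 * C ^ 2 * hw
  have hx3' : L ^ 2 * D ^ 2 * b ^ 2 * u ^ 3 * C ^ 2 * 1 ≤ L ^ 2 * D ^ 2 * b ^ 2 * u ^ 3 * C ^ 2 * R :=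
    mul_le_mul_of_nonneg_left hR (by positivity)
  have hs : (3 * s₁ + 1) ^ 2 ≤ 10 * (1 + s₁ ^ 2) := by nlinarith [sq_nonneg (s₁ - 3)]
  have hx2 : (L * D * b ^ 2 * u * C * l₂ * R) ^ 2 * (3 * s₁ + 1) ^ 2
      ≤ (L * D * b ^ 2 * u * C * l₂ * R) ^ 2 * (10 * (1 + s₁ ^ 2)) :=
    mul_le_mul_of_nonneg_left hs (sq_nonneg _)
  have hx2' : (L * D * b ^ 2 * u * C * l₂ * R) ^ 2 * (1 + s₁ ^ 2) * 1
      ≤ (L * D * b ^ 2 * u * C * l₂ * R) ^ 2 * (1 + s₁ ^ 2) * u ^ 2 :=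
    mul_le_mul_of_nonneg_left (one_le_pow₀ hu) (by positivity)
  have hx1 : 0 ≤ (L * D * C * u * s₁ * l₂) ^ 2 := sq_nonneg _
  have hx4 : 0 ≤ (L * D * C * u * s₁ * l₁) ^ 2 := sq_nonneg _
  have p1 : 0 ≤ L * D * C * s₀ * u * l₁ := by positivity
  have p2 : 0 ≤ L * D * C * s₀ * u * l₂ := by positivity
  have p3 : 0 ≤ L ^ 2 * D * C ^ 2 * u ^ 2 * l₂ := by positivity
  have p4 : L * D * b ^ 2 * u * C * s₀ * l₂ * R * 1 ≤ L * D * b ^ 2 * u * C * s₀ * l₂ * R * u :=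
    mul_le_mul_of_nonneg_left hu (by positivity)
  have p4' : 0 ≤ L * D * b ^ 2 * u * C * s₀ * l₂ * R := by positivity
  have p5 : L ^ 2 * b ^ 2 * u ^ 2 * C ^ 2 * D * 1 ≤ L ^ 2 * b ^ 2 * u ^ 2 * C ^ 2 * D * R :=
    mul_le_mul_of_nonneg_left hR (by positivity)
  have p6 : 0 ≤ L * Δ := mul_nonneg hL hΔ
  have p7 : 0 ≤ (L * D * b ^ 2 * u * C * l₂ * R) ^ 2 * (1 + s₁ ^ 2) := by positivity
  have p8 : 0 ≤ L ^ 2 * D ^ 2 * b ^ 2 * u ^ 3 * C ^ 2 := by positivity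
  ring_nf at *
  linarith

theorem sigmaMax_ge (β₂ : ℝ) : 1 ≤ sigmaMax β₂ := le_max_left _ _

theorem calF_ge_one {d T : ℕ} {L C₀ ε₀ β₁ β₂ g₁ : ℝ} {σ₀ σ₁ : E d} (h : 0 ≤ 1 - β₁ / β₂) :
    1 ≤ calF d T L C₀ ε₀ β₁ β₂ g₁ σ₀ σ₁ := by
  unfold calF
  have : 0 ≤ 2 / (ε₀ * √(1 - β₂)) ^ 2 *
    ((supNorm σ₀ ^ 2 + 2 * (1 + supNorm σ₁ ^ 2) * g₁ ^ 2) * T +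
      2 * (1 + supNorm σ₁ ^ 2) * d * L ^ 2 * C₀ ^ 2 / (1 - β₁ / β₂) * T ^ 3) := by positivity
  linarith

/-- Reduces `G` to the polynomial form that `budget` needs, discarding surplus: the powers of `β₂ ≤
1` in denominators, the term with `√β₂`, and the excess of `sigmaMax` over `1` (so `1 + 4 * sigmaMax
^ 2` becomes `5`). -/
theorem adamG_ge {d T : ℕ} {L C₀ ε₀ β₁ β₂ δ Δ g₁ q : ℝ} {σ₀ σ₁ : E d} (hL : 0 ≤ L) (hC : 0 ≤ C₀)
    (hε : 0 ≤ ε₀) (h₀ : 0 ≤ β₁) (h₁ : β₁ < β₂) (h : β₂ < 1) {ℓ₁ ℓ₂ : ℝ}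
    (hℓ₁ : ℓ₁ = Real.log (d * T / δ))
    (hℓ₂ : ℓ₂ = Real.log (calF d T L C₀ ε₀ β₁ β₂ g₁ σ₀ σ₁ / q)) (hℓ₂0 : 0 ≤ ℓ₂)
    {u R : ℝ} (hu : u = 1 / (1 - β₁)) (hR : R = 1 / (1 - β₁ / β₂)) :
    8 * L * Δ + 256 * L ^ 2 * C₀ ^ 2 * β₁ ^ 2 * (d : ℝ) ^ 2 * (u ^ 3 * R)
      + 4 * L ^ 2 * C₀ ^ 2 * β₁ ^ 2 * d * (u ^ 2 * R) + 48 * L * C₀ * supNorm σ₀ * u * d * ℓ₁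
      + 8 * L * C₀ * β₁ ^ 2 * (u ^ 2 * R) * (4 * supNorm σ₀ + 5 / 2 * (L * C₀)) * d * ℓ₂
      + 8 * (3 * L ^ 2 * C₀ ^ 2 * u ^ 2 + 8 * L * supNorm σ₀ * C₀ * u) * d * ℓ₂
      + 2304 * L ^ 2 * C₀ ^ 2 * supNorm σ₁ ^ 2 * u ^ 2 * d ^ 2 * ℓ₁ ^ 2
      + 256 * (16 * L ^ 2 * C₀ ^ 2 * supNorm σ₁ ^ 2 * u ^ 2
        + 9 * L ^ 2 * C₀ ^ 2 * β₁ ^ 4 * (1 + supNorm σ₁ ^ 2) * (u ^ 4 * R ^ 2)) * d ^ 2 * ℓ₂ ^ 2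
      ≤ adamG d T L C₀ ε₀ β₁ β₂ δ Δ g₁ σ₀ σ₁ q := by
  have hβ2 : 0 < β₂ := h₀.trans_lt h₁
  have hq1 : 0 < 1 - β₁ := by linarith
  have hρ : 0 < 1 - β₁ / β₂ := sub_pos.2 ((div_lt_one hβ2).2 h₁)
  have hu0 : 0 < u := by rw [hu]; positivity
  have hR0 : 0 < R := by rw [hR]; positivity
  have hs0 := supNorm_nonneg σ₀
  simp only [adamG]
  rw [← hℓ₁, ← hℓ₂]
  have e1 : 256 * L ^ 2 * C₀ ^ 2 * β₁ ^ 2 * (d : ℝ) ^ 2 * (u ^ 3 * R)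
      = 256 * L ^ 2 * C₀ ^ 2 * β₁ ^ 2 * d ^ 2 / ((1 - β₁) ^ 3 * (1 - β₁ / β₂)) := by
    rw [hu, hR, one_div_pow, one_div_mul_one_div, mul_one_div]
  have e2 : 4 * L ^ 2 * C₀ ^ 2 * β₁ ^ 2 * d * (u ^ 2 * R)
      = 4 * L ^ 2 * C₀ ^ 2 * β₁ ^ 2 * d / ((1 - β₁) ^ 2 * (1 - β₁ / β₂)) := by
    rw [hu, hR, one_div_pow, one_div_mul_one_div, mul_one_div]
  have e3 : 48 * L * C₀ * supNorm σ₀ * u = 48 * L * C₀ * supNorm σ₀ / (1 - β₁) := by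
    rw [hu, mul_one_div]
  have e4 : 8 * L * C₀ * β₁ ^ 2 * (u ^ 2 * R)
      = 8 * L * C₀ * β₁ ^ 2 / ((1 - β₁) ^ 2 * (1 - β₁ / β₂)) := by
    rw [hu, hR, one_div_pow, one_div_mul_one_div, mul_one_div]
  have e5 : 3 * L ^ 2 * C₀ ^ 2 * u ^ 2 = 3 * L ^ 2 * C₀ ^ 2 / (1 - β₁) ^ 2 := by
    rw [hu, one_div_pow, mul_one_div]
  have e6 : 8 * L * supNorm σ₀ * C₀ * u = 8 * L * supNorm σ₀ * C₀ / (1 - β₁) := by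
    rw [hu, mul_one_div]
  have e7 : 2304 * L ^ 2 * C₀ ^ 2 * supNorm σ₁ ^ 2 * u ^ 2
      = 2304 * L ^ 2 * C₀ ^ 2 * supNorm σ₁ ^ 2 / (1 - β₁) ^ 2 := by
    rw [hu, one_div_pow, mul_one_div]
  have e8 : 16 * L ^ 2 * C₀ ^ 2 * supNorm σ₁ ^ 2 * u ^ 2
      = 16 * L ^ 2 * C₀ ^ 2 * supNorm σ₁ ^ 2 / (1 - β₁) ^ 2 := by
    rw [hu, one_div_pow, mul_one_div]
  have f1 : 4 * supNorm σ₀ + 5 / 2 * (L * C₀) ≤ 4 * supNorm σ₀ / β₂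
      + (ε₀ + √2 * supNorm σ₀) / √β₂ + L * C₀ / 2 * (1 + 4 * sigmaMax β₂ ^ 2) := by
    have a1 : 4 * supNorm σ₀ ≤ 4 * supNorm σ₀ / β₂ := by
      rw [le_div_iff₀ hβ2]; nlinarith
    have a2 : 0 ≤ (ε₀ + √2 * supNorm σ₀) / √β₂ := by positivity
    have a3 : 1 ≤ sigmaMax β₂ ^ 2 := one_le_pow₀ (sigmaMax_ge β₂)
    have a4 : 0 ≤ L * C₀ := by positivity
    nlinarith
  have f2 : 9 * L ^ 2 * C₀ ^ 2 * β₁ ^ 4 * (1 + supNorm σ₁ ^ 2) * (u ^ 4 * R ^ 2)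
      ≤ 9 * L ^ 2 * C₀ ^ 2 * β₁ ^ 4 * (1 + supNorm σ₁ ^ 2)
          / (β₂ ^ 2 * (1 - β₁) ^ 4 * (1 - β₁ / β₂) ^ 2) := by
    have hX : 0 ≤ 9 * L ^ 2 * C₀ ^ 2 * β₁ ^ 4 * (1 + supNorm σ₁ ^ 2) := by positivity
    generalize 9 * L ^ 2 * C₀ ^ 2 * β₁ ^ 4 * (1 + supNorm σ₁ ^ 2) = A at hX ⊢
    have e : A * (u ^ 4 * R ^ 2) = A / ((1 - β₁) ^ 4 * (1 - β₁ / β₂) ^ 2) := by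
      rw [hu, hR, one_div_pow, one_div_pow, one_div_mul_one_div, mul_one_div]
    rw [e, mul_assoc (β₂ ^ 2)]
    have hpos : 0 < (1 - β₁) ^ 4 * (1 - β₁ / β₂) ^ 2 := by positivity
    exact div_le_div_of_nonneg_left hX (by positivity)
      (mul_le_of_le_one_left hpos.le (pow_le_one₀ hβ2.le h.le))
  rw [e1, e2, e3, ← e4, e5, e6, e7, e8]
  have g1 := mul_le_mul_of_nonneg_left f1
    (show 0 ≤ 8 * L * C₀ * β₁ ^ 2 * (u ^ 2 * R) by positivity)
  have g2 := mul_le_mul_of_nonneg_right (mul_le_mul_of_nonneg_right g1 (Nat.cast_nonneg d)) hℓ₂0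
  have g3 := mul_le_mul_of_nonneg_left (add_le_add_right f2
    (16 * L ^ 2 * C₀ ^ 2 * supNorm σ₁ ^ 2 / (1 - β₁) ^ 2)) (show (0 : ℝ) ≤ 256 by norm_num)
  have g4 := mul_le_mul_of_nonneg_right (mul_le_mul_of_nonneg_right g3
    (sq_nonneg (d : ℝ))) (sq_nonneg ℓ₂)
  linarith

/-! ### Deterministic size of the iterates and of the logarithmic sums. -/

section path

variable {d : ℕ} {L β₁ β₂ ε η C₀ κ fstar : ℝ} {f : E d → ℝ} {σ₀ σ₁ : E d} {X gs : ℕ → E d}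

theorem accum_div_le_one {g : ℕ → ℝ} (h₀ : 0 ≤ β₁) (h₁ : β₁ ≤ β₂) (hε : 0 < ε) (n : ℕ) :
    accum β₁ g n / (accum β₂ g n + ε ^ 2) ≤ 1 := by
  rw [div_le_one (Q_pos (h₀.trans h₁) hε n)]
  linarith [accum_mono (g := g) h₀ h₁ n, sq_nonneg ε]

theorem stepSize_mul_mom_sq_le_sq {g : ℕ → ℝ} (h₀ : 0 ≤ β₁) (h₁ : β₁ < β₂) (h : β₂ < 1)
    (hε : 0 < ε) (hη : η = C₀ * √(1 - β₂)) (n : ℕ) :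
    (stepSize β₁ β₂ η ε g n * mom β₁ g n) ^ 2 ≤ C₀ ^ 2 := by
  refine (stepSize_mul_mom_sq_le h₀ h₁ h hε hη n).trans ?_
  exact mul_le_of_le_one_right (sq_nonneg _) (accum_div_le_one h₀ h₁.le hε n)

theorem sq_norm_shifted_sub_le (h₀ : 0 ≤ β₁) (h₁ : β₁ < β₂) (h : β₂ < 1) (hε : 0 < ε)
    (hη : η = C₀ * √(1 - β₂)) (n : ℕ) :
    ‖shifted β₁ β₂ η ε κ X gs n - X n‖ ^ 2 ≤ κ ^ 2 * C₀ ^ 2 * d := by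
  have : ‖shifted β₁ β₂ η ε κ X gs n - X n‖ ^ 2 ≤ ∑ _i : Fin d, κ ^ 2 * C₀ ^ 2 := by
    apply norm_sq_le_of_coord
    intro i
    have e : (shifted β₁ β₂ η ε κ X gs n - X n) i
        = -(κ * (stepSize β₁ β₂ η ε (fun k => gs k i) n * mom β₁ (fun k => gs k i) n)) := by
      simp [shifted]
    rw [e, neg_sq, mul_pow]
    exact mul_le_mul_of_nonneg_left (stepSize_mul_mom_sq_le_sq h₀ h₁ h hε hη n) (sq_nonneg _)
  refine this.trans (le_of_eq ?_)
  simp; ring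

theorem norm_iterate_sub_le (h₀ : 0 ≤ β₁) (h₁ : β₁ < β₂) (h : β₂ < 1) (hε : 0 < ε)
    (hη : η = C₀ * √(1 - β₂)) (hC : 0 ≤ C₀) (hX : IsAdamPath β₁ β₂ η ε X gs) (n : ℕ) :
    ‖X n - X 0‖ ≤ C₀ * √d * n := by
  induction n with
  | zero => simp
  | succ n ih =>
    have h3 : ‖X (n + 1) - X n‖ ≤ C₀ * √d := by
      have : ‖X (n + 1) - X n‖ ^ 2 ≤ ∑ _i : Fin d, C₀ ^ 2 := by
        apply norm_sq_le_of_coord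
        intro i
        rw [PiLp.sub_apply, hX n i, sub_sub_cancel_left, neg_sq]
        exact stepSize_mul_mom_sq_le_sq h₀ h₁ h hε hη (n + 1)
      apply abs_le_of_sq_le_sq' _ (by positivity) |>.2
      rw [mul_pow, Real.sq_sqrt (Nat.cast_nonneg d)]
      refine this.trans (le_of_eq ?_)
      simp; ring
    have h4 := norm_add_le (X (n + 1) - X n) (X n - X 0)
    rw [sub_add_sub_cancel] at h4
    push_cast
    linarith

theorem sq_le_of_noise {x y σ₀ σ₁ s₀ s₁ Y : ℝ} (h : |x - y| ≤ noiseLevel σ₀ σ₁ y)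
    (h₀ : |σ₀| ≤ s₀) (h₁ : |σ₁| ≤ s₁) (hy : y ^ 2 ≤ Y) :
    y ^ 2 + noiseLevel σ₀ σ₁ y ^ 2 ≤ s₀ ^ 2 + (1 + s₁ ^ 2) * Y
      ∧ x ^ 2 ≤ 2 * (s₀ ^ 2 + (1 + s₁ ^ 2) * Y) := by
  have h2 : (x - y) ^ 2 ≤ noiseLevel σ₀ σ₁ y ^ 2 := sq_le_sq' (abs_le.1 h).1 (abs_le.1 h).2
  rw [sq_noiseLevel] at *
  have a0 : σ₀ ^ 2 ≤ s₀ ^ 2 := sq_le_sq' (abs_le.1 h₀).1 (abs_le.1 h₀).2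
  have a1 : σ₁ ^ 2 ≤ s₁ ^ 2 := sq_le_sq' (abs_le.1 h₁).1 (abs_le.1 h₁).2
  have a2 : σ₁ ^ 2 * y ^ 2 ≤ s₁ ^ 2 * Y := by
    have := sq_nonneg y
    gcongr
  refine ⟨by linarith, ?_⟩
  nlinarith [sq_nonneg (x - 2 * y)]

/-- Each coordinate moves by at most `C₀` per iteration, so gradients, and hence samples, grow at
most polynomially in `T`. This crude bound suffices because it enters only through a logarithm. -/
theorem log_sum_le (hL : 0 < L) (hf : IsLSmooth L f) (h₀ : 0 ≤ β₁) (h₁ : β₁ < β₂)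
    (h : β₂ < 1) {T : ℕ} (hT : 2 ≤ T) (hβ₂ : β₂ = 1 - 1 / (T : ℝ)) {ε₀ : ℝ} (hε₀ : 0 < ε₀)
    (hε : ε = ε₀ * √(1 - β₂))
    (hη : η = C₀ * √(1 - β₂)) (hC : 0 ≤ C₀) (hX : IsAdamPath β₁ β₂ η ε X gs)
    (hnoise : ∀ n < T, ∀ i, |gs n i - gradient f (X n) i|
      ≤ noiseLevel (σ₀ i) (σ₁ i) (gradient f (X n) i)) {t : ℕ} (ht : t ≤ T) (i : Fin d) :
    ∑ n ∈ Finset.range t, gs n i ^ 2 / (accum β₂ (fun k => gs k i) (n + 1) + ε ^ 2)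
      ≤ Real.log (calF d T L C₀ ε₀ β₁ β₂ ‖gradient f (X 0)‖ σ₀ σ₁ / Real.exp (-2)) := by
  have hβ2 : 0 < β₂ := h₀.trans_lt h₁
  have hT0 : (2 : ℝ) ≤ T := by exact_mod_cast hT
  have hε' : 0 < ε := by
    rw [hε]; have : 0 < 1 - β₂ := by linarith
    positivity
  have hρ : 0 < 1 - β₁ / β₂ := sub_pos.2 ((div_lt_one hβ2).2 h₁)
  have hρ1 : 1 - β₁ / β₂ ≤ 1 := by have : 0 ≤ β₁ / β₂ := by positivity
                                   linarith
  have h3 := sum_sq_div_le (g := fun k => gs k i) hβ2 h.le hε' t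
  have hF1 := calF_ge_one (T := T) (d := d) (L := L) (C₀ := C₀) (ε₀ := ε₀)
    (g₁ := ‖gradient f (X 0)‖) (σ₀ := σ₀) (σ₁ := σ₁) hρ.le
  set F := calF d T L C₀ ε₀ β₁ β₂ ‖gradient f (X 0)‖ σ₀ σ₁ with hFdef
  -- Source of the `Real.exp (-2)`: since `β₂ ≥ 1 / 2`, one has `-log β₂ ≤ (1 / T) / β₂ ≤ 2 / T`,
  -- and `t ≤ T`.
  have h4 : -(t * Real.log β₂) ≤ 2 := by
    have a1 : Real.log β₂⁻¹ ≤ β₂⁻¹ - 1 := Real.log_le_sub_one_of_pos (by positivity)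
    rw [Real.log_inv] at a1
    have a2 : β₂⁻¹ - 1 ≤ 2 / T := by
      have hh : (1 : ℝ) / 2 ≤ β₂ := by
        rw [hβ₂]
        have : 1 / (T : ℝ) ≤ 1 / 2 := one_div_le_one_div_of_le (by norm_num) hT0
        linarith
      have : β₂⁻¹ - 1 = (1 / T) / β₂ := by
        rw [eq_div_iff hβ2.ne', sub_mul, inv_mul_cancel₀ hβ2.ne', hβ₂]; ring
      rw [this, div_le_iff₀ hβ2]
      have : 0 ≤ 1 / (T : ℝ) := by positivity
      have e : 2 / (T : ℝ) = 2 * (1 / T) := by ring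
      rw [e]; nlinarith
    have a3 : (t : ℝ) * -Real.log β₂ ≤ T * (2 / T) := by
      have : 0 ≤ -Real.log β₂ := by linarith [Real.log_nonpos hβ2.le h.le]
      have : (t : ℝ) ≤ T := by exact_mod_cast ht
      exact mul_le_mul this (a1.trans a2) (by assumption) (by positivity)
    rw [mul_div_cancel₀ _ (by positivity)] at a3
    linarith
  have h5 : (accum β₂ (fun k => gs k i) t + ε ^ 2) / ε ^ 2 ≤ F := by
    have b1 := accum_le_sum (g := fun k => gs k i) hβ2.le h.le t
    have b2 : ∑ k ∈ Finset.range t, gs k i ^ 2 ≤ T * (2 * (supNorm σ₀ ^ 2 + (1 + supNorm σ₁ ^ 2)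
        * (2 * ‖gradient f (X 0)‖ ^ 2 + 2 * L ^ 2 * C₀ ^ 2 * d * T ^ 2))) := by
      have : ∀ k ∈ Finset.range t, gs k i ^ 2 ≤ 2 * (supNorm σ₀ ^ 2 + (1 + supNorm σ₁ ^ 2)
          * (2 * ‖gradient f (X 0)‖ ^ 2 + 2 * L ^ 2 * C₀ ^ 2 * d * T ^ 2)) := by
        intro k hk
        have hk' : k < T := (Finset.mem_range.1 hk).trans_le ht
        refine (sq_le_of_noise (hnoise k hk' i) (abs_coord_le_supNorm σ₀ i)
          (abs_coord_le_supNorm σ₁ i) ?_).2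
        have c1 := abs_coord_le_norm (gradient f (X k)) i
        have c2 := hf.norm_gradient_sub_le hL (X 0) (X k)
        have c3 := norm_iterate_sub_le h₀ h₁ h hε' hη hC hX k
        have c4 : ‖gradient f (X k)‖ ≤ ‖gradient f (X 0)‖ + L * (C₀ * √d * T) := by
          have := norm_add_le (gradient f (X k) - gradient f (X 0)) (gradient f (X 0))
          rw [sub_add_cancel] at this
          have c5 : L * ‖X k - X 0‖ ≤ L * (C₀ * √d * T) := by
            have : (k : ℝ) ≤ T := by exact_mod_cast hk'.le
            gcongr
            exact c3.trans (by gcongr)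
          linarith
        have c6 : gradient f (X k) i ^ 2 ≤ (‖gradient f (X 0)‖ + L * (C₀ * √d * T)) ^ 2 := by
          rw [← sq_abs]
          exact pow_le_pow_left₀ (abs_nonneg _) (c1.trans c4) 2
        have c7 : (L * (C₀ * √d * T)) ^ 2 = L ^ 2 * C₀ ^ 2 * d * T ^ 2 := by
          have := Real.sq_sqrt (Nat.cast_nonneg (α := ℝ) d)
          rw [mul_pow, mul_pow, mul_pow, this]; ring
        nlinarith [sq_nonneg (‖gradient f (X 0)‖ - L * (C₀ * √d * T))]
      refine (Finset.sum_le_card_nsmul _ _ _ this).trans ?_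
      rw [Finset.card_range, nsmul_eq_mul]
      gcongr
    have b3 : F = 1 + 2 / ε ^ 2 * ((supNorm σ₀ ^ 2 + 2 * (1 + supNorm σ₁ ^ 2)
        * ‖gradient f (X 0)‖ ^ 2) * T
        + 2 * (1 + supNorm σ₁ ^ 2) * d * L ^ 2 * C₀ ^ 2 / (1 - β₁ / β₂) * T ^ 3) := by
      rw [hFdef, calF, hε]
    have b4 : 2 * (1 + supNorm σ₁ ^ 2) * d * L ^ 2 * C₀ ^ 2
        ≤ 2 * (1 + supNorm σ₁ ^ 2) * d * L ^ 2 * C₀ ^ 2 / (1 - β₁ / β₂) := by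
      rw [le_div_iff₀ hρ]
      exact mul_le_of_le_one_right (by positivity) hρ1
    rw [add_div, div_self (by positivity), b3, add_comm, div_mul_eq_mul_div]
    gcongr
    have b5 := mul_le_mul_of_nonneg_right b4 (show (0 : ℝ) ≤ T ^ 3 by positivity)
    refine (b1.trans b2).trans ?_
    ring_nf at b5 ⊢
    linarith
  rw [Real.log_div (by linarith) (Real.exp_pos _).ne', Real.log_exp]
  have h6 : Real.log ((accum β₂ (fun k => gs k i) t + ε ^ 2) / ε ^ 2) ≤ Real.log F :=
    Real.log_le_log (div_pos (Q_pos hβ2.le hε' t) (by positivity)) h5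
  linarith

end path

/-! ### Bootstrap of the gradient bound and the deterministic average bound. -/

section path

variable {d : ℕ} {L β₁ β₂ ε η C₀ κ fstar δ ε₀ G : ℝ} {f : E d → ℝ} {σ₀ σ₁ : E d}
  {X gs : ℕ → E d} {T : ℕ}

theorem half_le_one_sub_inv (hT : 2 ≤ T) (hβ₂ : β₂ = 1 - 1 / (T : ℝ)) : 1 / 2 ≤ β₂ := by
  have hT0 : (2 : ℝ) ≤ T := by exact_mod_cast hT
  have : 1 / (T : ℝ) ≤ 1 / 2 := one_div_le_one_div_of_le (by norm_num) hT0
  linarith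

theorem one_sub_inv_lt_one (hT : 2 ≤ T) (hβ₂ : β₂ = 1 - 1 / (T : ℝ)) : β₂ < 1 := by
  have hT0 : (2 : ℝ) ≤ T := by exact_mod_cast hT
  have : 0 < 1 / (T : ℝ) := by positivity
  linarith

theorem two_le_log_calF {F : ℝ} (hF : 1 ≤ F) : 2 ≤ Real.log (F / Real.exp (-2)) := by
  rw [Real.log_div (by linarith) (Real.exp_pos _).ne', Real.log_exp]
  linarith [Real.log_nonneg hF]

theorem log_card_div_nonneg (hT : 2 ≤ T) (hδ : 0 < δ) (hδ1 : δ < 1) :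
    0 ≤ Real.log (d * T / δ) := by
  rcases Nat.eq_zero_or_pos d with rfl | hd
  · simp
  apply Real.log_nonneg
  rw [le_div_iff₀ hδ]
  have : (1 : ℝ) ≤ d := by exact_mod_cast hd
  have : (2 : ℝ) ≤ T := by exact_mod_cast hT
  nlinarith

/-- The energy inequality bounds `f y - fstar` plus a quarter of the progress, `y` being the
extrapolated point. From `‖∇f(X t)‖² ≤ 2 ‖∇f(y)‖² + 2 L² ‖X t - y‖²` and `‖∇f(y)‖² ≤ 2 L (f y -
fstar)`, both conclusions reduce to `budget`, whose factor `4 * L` fits the two uses. -/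
theorem gradient_bound_step (hL : 0 < L) (hf : IsLSmooth L f) (hb : ∀ x, fstar ≤ f x)
    (h₀ : 0 ≤ β₁) (h₁ : β₁ < β₂) (hT : 2 ≤ T) (hβ₂ : β₂ = 1 - 1 / (T : ℝ)) (hδ : 0 < δ)
    (hδ1 : δ < 1) (hd : 0 < d) (hε₀ : 0 < ε₀) (hε : ε = ε₀ * √(1 - β₂))
    (hη : η = C₀ * √(1 - β₂)) (hC : 0 < C₀) (hX : IsAdamPath β₁ β₂ η ε X gs)
    (hG : G = adamG₁ d T L C₀ ε₀ β₁ δ (f (X 0) - fstar) ‖gradient f (X 0)‖ σ₀ σ₁)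
    {N lam : ℝ} (hN : N = supNorm σ₀ + supNorm σ₁ * √G)
    (hlam : lam = 1 / (2 * (d * C₀ * N / (1 - β₁))))
    (hnoise : ∀ n < T, ∀ i, |gs n i - gradient f (X n) i|
      ≤ noiseLevel (σ₀ i) (σ₁ i) (gradient f (X n) i))
    {t : ℕ} (ht : t ≤ T)
    (hmart : lam * ∑ n ∈ Finset.range t, noiseTerm β₁ β₂ η ε f σ₀ σ₁ X gs n
      ≤ lam ^ 2 / 2 * ∑ n ∈ Finset.range t, noiseEnvelope β₁ β₂ η ε f σ₀ σ₁ X gs n ^ 2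
        + Real.log (T / δ))
    (hprev : ∀ n < t, ‖gradient f (X n)‖ ^ 2 ≤ G) :
    ‖gradient f (X t)‖ ^ 2 ≤ G
      ∧ ∑ n ∈ Finset.range t, progress β₁ β₂ η ε f σ₀ σ₁ X gs n ≤ G / L := by
  have h2 := half_le_one_sub_inv hT hβ₂
  have h := one_sub_inv_lt_one hT hβ₂
  have h11 : β₁ < 1 := h₁.trans h
  have hβ2 : 0 < β₂ := h₀.trans_lt h₁
  have hq1 : 0 < 1 - β₁ := by linarith
  have hq2 : 0 < 1 - β₂ := by linarith
  have hρ : 0 < 1 - β₁ / β₂ := sub_pos.2 ((div_lt_one hβ2).2 h₁)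
  have hε' : 0 < ε := by rw [hε]; positivity
  have hη0 : 0 ≤ η := by rw [hη]; positivity
  have hs0 := supNorm_nonneg σ₀
  have hs1 := supNorm_nonneg σ₁
  have hΔ : 0 ≤ f (X 0) - fstar := sub_nonneg.2 (hb _)
  have hT0 : (2 : ℝ) ≤ T := by exact_mod_cast hT
  have hd1 : (1 : ℝ) ≤ d := by exact_mod_cast hd
  obtain ⟨ℓ₁, hℓ₁⟩ : ∃ ℓ₁, ℓ₁ = Real.log (d * T / δ) := ⟨_, rfl⟩
  obtain ⟨ℓ₂, hℓ₂⟩ : ∃ ℓ₂, ℓ₂ = Real.log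
    (calF d T L C₀ ε₀ β₁ β₂ ‖gradient f (X 0)‖ σ₀ σ₁ / Real.exp (-2)) := ⟨_, rfl⟩
  have hℓ₂0 : 0 ≤ ℓ₂ := by
    have := two_le_log_calF (calF_ge_one (T := T) (d := d) (L := L) (C₀ := C₀) (ε₀ := ε₀)
      (g₁ := ‖gradient f (X 0)‖) (σ₀ := σ₀) (σ₁ := σ₁) hρ.le)
    linarith
  have hℓ₁0 : 0 ≤ ℓ₁ := hℓ₁ ▸ log_card_div_nonneg hT hδ hδ1
  have hℓ₁' : Real.log (T / δ) ≤ ℓ₁ := by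
    rw [hℓ₁]
    apply Real.log_le_log (by positivity)
    gcongr
    nlinarith
  obtain ⟨u, hu⟩ : ∃ u, u = 1 / (1 - β₁) := ⟨_, rfl⟩
  obtain ⟨R, hR⟩ : ∃ R, R = 1 / (1 - β₁ / β₂) := ⟨_, rfl⟩
  have hu1 : 1 ≤ u := by rw [hu, le_div_iff₀ hq1]; linarith
  have hR1 : 1 ≤ R := by
    rw [hR, le_div_iff₀ hρ]; have : 0 ≤ β₁ / β₂ := by positivity
    linarith
  have hGge := adamG_ge (d := d) (T := T) (δ := δ) (Δ := f (X 0) - fstar) (σ₀ := σ₀) (σ₁ := σ₁)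
    hL.le hC.le hε₀.le h₀ h₁ h hℓ₁ hℓ₂ hℓ₂0 hu hR
  have hG' : G = adamG d T L C₀ ε₀ β₁ β₂ δ (f (X 0) - fstar) ‖gradient f (X 0)‖ σ₀ σ₁
      (Real.exp (-2)) := by rw [hG, adamG₁, hβ₂]
  rw [← hG'] at hGge
  have hG0 : 0 ≤ G := by
    refine le_trans ?_ hGge
    positivity
  set Y := √G with hY
  have hYsq : Y ^ 2 = G := Real.sq_sqrt hG0
  have hY0 : 0 ≤ Y := Real.sqrt_nonneg _
  rw [← hYsq] at hGge
  have hw : √(1 - β₁) ^ 2 * u = 1 := by rw [Real.sq_sqrt hq1.le, hu]; field_simp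
  have hbud := budget hL.le hC.le hu1 hR1 (Nat.cast_nonneg d) hs0 hℓ₁0 hℓ₂0 hΔ hw hGge
  rw [← hN, hYsq] at hbud
  have hN0 : 0 ≤ N := by rw [hN]; positivity
  have hYb : ∀ n < t, ∀ i, |gradient f (X n) i| ≤ Y := fun n hn i =>
    (abs_coord_le_norm _ i).trans (Real.le_sqrt_of_sq_le (hprev n hn))
  have hNb : ∀ n < t, ∀ i, noiseLevel (σ₀ i) (σ₁ i) (gradient f (X n) i) ≤ N := by
    intro n hn i
    rw [hN]
    exact noiseLevel_le (abs_coord_le_supNorm _ i) (abs_coord_le_supNorm _ i) (hYb n hn i)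
  obtain ⟨κ, hκ⟩ : ∃ κ, κ = β₁ / (1 - β₁) := ⟨_, rfl⟩
  have henergy := energy_le hL hf h₀ h₁ h2 h hε' hη hC.le hκ hX t (ℓ := ℓ₂)
    (fun n hn => hnoise n (hn.trans_le ht)) hNb hYb hN0 hY0 (fun i => by
      rw [hℓ₂]
      exact log_sum_le hL hf h₀ h₁ h hT hβ₂ hε₀ hε hη hC.le hX hnoise ht i)
  have hM := sum_noiseTerm_le (ℓ := ℓ₁) h₀ h₁ h hε' hη hC.le hN0 hℓ₁0
    (fun n hn => hnoise n (hn.trans_le ht)) hNb hlam (hmart.trans (by gcongr))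
  have hP : 0 ≤ ∑ n ∈ Finset.range t, progress β₁ β₂ η ε f σ₀ σ₁ X gs n :=
    Finset.sum_nonneg fun n _ => progress_nonneg h₀ h11 hε' hη0 n
  set P := ∑ n ∈ Finset.range t, progress β₁ β₂ η ε f σ₀ σ₁ X gs n
  set M := ∑ n ∈ Finset.range t, noiseTerm β₁ β₂ η ε f σ₀ σ₁ X gs n
  set y := shifted β₁ β₂ η ε κ X gs t
  set rhs := f (X 0) - fstar + 2 * (d * C₀ * N * u) * ℓ₁
    + d * ((4 * (C₀ * N * u) + 2 * L * (C₀ * u) ^ 2) * ℓ₂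
      + (β₁ ^ 2 * u * C₀ * (3 * N + Y) + 5 / 2 * L * (β₁ * u) ^ 2 * C₀ ^ 2) * (ℓ₂ * R)
      + β₁ * u * C₀ * √(1 - β₁) * Y * u)
  have hκu : κ = β₁ * u := by rw [hκ, hu, mul_one_div]
  have hκ1 : κ ^ 2 * (1 - β₁) = β₁ ^ 2 * u := by rw [hκ, hu]; field_simp
  have hE : f y - fstar + 1 / 4 * P ≤ rhs := by
    have e1 : 2 * (d * C₀ * N / (1 - β₁)) * ℓ₁ = 2 * (d * C₀ * N * u) * ℓ₁ := by
      rw [hu, mul_one_div]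
    have e2 : (4 * (C₀ * N / (1 - β₁)) + 2 * L * (C₀ / (1 - β₁)) ^ 2) * ℓ₂
        + (κ ^ 2 * (1 - β₁) * C₀ * (N + Y + 2 * N) + 5 / 2 * L * κ ^ 2 * C₀ ^ 2)
          * (ℓ₂ / (1 - β₁ / β₂)) + κ * C₀ * √(1 - β₁) * Y * (1 / (1 - β₁))
        = (4 * (C₀ * N * u) + 2 * L * (C₀ * u) ^ 2) * ℓ₂
        + (β₁ ^ 2 * u * C₀ * (3 * N + Y) + 5 / 2 * L * (β₁ * u) ^ 2 * C₀ ^ 2) * (ℓ₂ * R)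
        + β₁ * u * C₀ * √(1 - β₁) * Y * u := by
      rw [hκ1, ← hu, hκu, hR, div_eq_mul_one_div (C₀ * N), div_eq_mul_one_div C₀ (1 - β₁), ← hu,
        mul_one_div]
      ring
    rw [e2] at henergy
    rw [e1] at hM
    simp only [rhs]
    linarith
  have hκb : 2 * L ^ 2 * (β₁ * u) ^ 2 * C₀ ^ 2 * d = 2 * L ^ 2 * (κ ^ 2 * C₀ ^ 2 * d) := by
    rw [hκu]; ring
  rw [hκb] at hbud
  have hyb : 0 ≤ f y - fstar := sub_nonneg.2 (hb _)
  have hκ0 : 0 ≤ 2 * L ^ 2 * (κ ^ 2 * C₀ ^ 2 * d) := by positivity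
  clear_value rhs P M
  have hE' : 4 * (L * (f y - fstar)) + L * P ≤ 4 * L * rhs := by
    have := mul_le_mul_of_nonneg_left hE (show 0 ≤ 4 * L by positivity)
    linarith
  have hLP : 0 ≤ L * P := mul_nonneg hL.le hP
  have hLy : 0 ≤ L * (f y - fstar) := mul_nonneg hL.le hyb
  constructor
  · have a1 := hf.sq_norm_gradient_le hL hb y
    have a2 := hf.norm_gradient_sub_le hL y (X t)
    have a3 : ‖y - X t‖ ^ 2 ≤ κ ^ 2 * C₀ ^ 2 * d := sq_norm_shifted_sub_le h₀ h₁ h hε' hη t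
    have a4 := norm_add_le (gradient f (X t) - gradient f y) (gradient f y)
    rw [sub_add_cancel] at a4
    rw [norm_sub_rev] at a3
    have a5 : ‖gradient f (X t)‖ ^ 2 ≤ (‖gradient f y‖ + L * ‖X t - y‖) ^ 2 :=
      pow_le_pow_left₀ (norm_nonneg _) (by linarith) 2
    have a6 := mul_le_mul_of_nonneg_left a3 (sq_nonneg L)
    have a7 := sq_nonneg (‖gradient f y‖ - L * ‖X t - y‖)
    linarith
  · rw [le_div_iff₀ hL]
    linarith

/-- Bounded gradients and affine noise bound all samples by `B`, so the proxy denominators are at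
most `B + ε`. -/
theorem progress_ge (h₀ : 0 ≤ β₁) (h11 : β₁ < 1) (hβ2 : 0 ≤ β₂) (h : β₂ < 1)
    (hε : 0 < ε) (hη : 0 ≤ η) {B : ℝ} (hB : 0 ≤ B) {n : ℕ}
    (hBsq : B ^ 2 = 2 * (supNorm σ₀ ^ 2 + (1 + supNorm σ₁ ^ 2) * G))
    (hnoise : ∀ k ≤ n, ∀ i, |gs k i - gradient f (X k) i|
      ≤ noiseLevel (σ₀ i) (σ₁ i) (gradient f (X k) i))
    (hgrad : ∀ k ≤ n, ‖gradient f (X k)‖ ^ 2 ≤ G) :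
    η / (B + ε) * ‖gradient f (X n)‖ ^ 2 ≤ progress β₁ β₂ η ε f σ₀ σ₁ X gs n := by
  rw [EuclideanSpace.real_norm_sq_eq, Finset.mul_sum, progress]
  apply Finset.sum_le_sum
  intro i _
  have hcoord : ∀ k ≤ n, gradient f (X k) i ^ 2 ≤ G := by
    intro k hk
    rw [← sq_abs]
    exact (pow_le_pow_left₀ (abs_nonneg _) (abs_coord_le_norm _ i) 2).trans (hgrad k hk)
  have hG0 : 0 ≤ G := (sq_nonneg _).trans (hcoord n le_rfl)
  have key := fun k (hk : k ≤ n) => sq_le_of_noise (hnoise k hk i) (abs_coord_le_supNorm σ₀ i)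
    (abs_coord_le_supNorm σ₁ i) (hcoord k hk)
  have hv : vhat β₂ (fun k => gs k i) n ≤ B ^ 2 := by
    apply vhat_le_sq hβ2 h
    intro k hk
    apply abs_le_of_sq_le_sq _ hB
    rw [hBsq]
    exact (key k hk.le).2
  have hp := proxyDen_pos (β₂ := β₂) hε n (vhat β₂ (fun k => gs k i) n) (gradient f (X n) i)
    (noiseLevel (σ₀ i) (σ₁ i) (gradient f (X n) i))
  have hpl : proxyDen β₂ ε n (vhat β₂ (fun k => gs k i) n) (gradient f (X n) i)
      (noiseLevel (σ₀ i) (σ₁ i) (gradient f (X n) i)) ≤ B + ε := by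
    apply proxyDen_le hβ2 h n hv hB
    rw [hBsq]
    have := (key n le_rfl).1
    have : 0 ≤ supNorm σ₀ ^ 2 + (1 + supNorm σ₁ ^ 2) * G := by positivity
    linarith
  have hq := one_sub_pow_pos h₀ h11 n.succ_ne_zero
  have hq' : 1 - β₁ ^ (n + 1) ≤ 1 := by linarith [pow_nonneg h₀ (n + 1)]
  simp only [Nat.succ_eq_add_one] at hq
  unfold pathProxy proxyStep
  gcongr
  rw [le_div_iff₀ hq]
  nlinarith

theorem average_le (hL : 0 < L) (hf : IsLSmooth L f) (hb : ∀ x, fstar ≤ f x)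
    (h₀ : 0 ≤ β₁) (h₁ : β₁ < β₂) (hT : 2 ≤ T) (hβ₂ : β₂ = 1 - 1 / (T : ℝ)) (hδ : 0 < δ)
    (hδ1 : δ < 1) (hd : 0 < d) (hε₀ : 0 < ε₀) (hε : ε = ε₀ * √(1 - β₂))
    (hη : η = C₀ * √(1 - β₂)) (hC : 0 < C₀) (hX : IsAdamPath β₁ β₂ η ε X gs)
    (hG : G = adamG₁ d T L C₀ ε₀ β₁ δ (f (X 0) - fstar) ‖gradient f (X 0)‖ σ₀ σ₁)
    {N lam : ℝ} (hN : N = supNorm σ₀ + supNorm σ₁ * √G)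
    (hlam : lam = 1 / (2 * (d * C₀ * N / (1 - β₁))))
    (hnoise : ∀ n < T, ∀ i, |gs n i - gradient f (X n) i|
      ≤ noiseLevel (σ₀ i) (σ₁ i) (gradient f (X n) i))
    (hmart : ∀ t ≤ T, lam * ∑ n ∈ Finset.range t, noiseTerm β₁ β₂ η ε f σ₀ σ₁ X gs n
      ≤ lam ^ 2 / 2 * ∑ n ∈ Finset.range t, noiseEnvelope β₁ β₂ η ε f σ₀ σ₁ X gs n ^ 2
        + Real.log (T / δ)) :
    1 / (T : ℝ) * ∑ n ∈ Finset.range T, ‖gradient f (X n)‖ ^ 2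
      ≤ 2 * (1 / (T : ℝ) * (ε₀ * G / (L * C₀))
        + G / (L * C₀) * √((‖σ₀‖ ^ 2 + (1 + supNorm σ₁ ^ 2) * G) / T)) := by
  have h := one_sub_inv_lt_one hT hβ₂
  have h11 : β₁ < 1 := h₁.trans h
  have hβ2 : 0 < β₂ := h₀.trans_lt h₁
  have hq2 : 0 < 1 - β₂ := by linarith
  have hε' : 0 < ε := by rw [hε]; positivity
  have hη0 : 0 < η := by rw [hη]; positivity
  have hT0 : (2 : ℝ) ≤ T := by exact_mod_cast hT
  have hall : ∀ t ≤ T, ‖gradient f (X t)‖ ^ 2 ≤ G := by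
    intro t
    -- Strong induction, since the energy inequality up to `t` uses the bound at every earlier
    -- point.
    induction t using Nat.strong_induction_on with
    | _ t ih =>
      intro ht
      exact (gradient_bound_step hL hf hb h₀ h₁ hT hβ₂ hδ hδ1 hd hε₀ hε hη hC hX hG hN hlam
        hnoise ht (hmart t ht) (fun n hn => ih n hn (hn.le.trans ht))).1
  have hsum := (gradient_bound_step hL hf hb h₀ h₁ hT hβ₂ hδ hδ1 hd hε₀ hε hη hC hX hG hN hlam
    hnoise le_rfl (hmart T le_rfl) (fun n hn => hall n hn.le)).2
  have hG0 : 0 ≤ G := (sq_nonneg _).trans (hall 0 (Nat.zero_le _))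
  set A := supNorm σ₀ ^ 2 + (1 + supNorm σ₁ ^ 2) * G with hA
  have hA0 : 0 ≤ A := by positivity
  obtain ⟨B, hBdef⟩ : ∃ B, B = √(2 * A) := ⟨_, rfl⟩
  have hB0 : 0 ≤ B := by rw [hBdef]; positivity
  have hBsq : B ^ 2 = 2 * A := by rw [hBdef]; exact Real.sq_sqrt (by positivity)
  have hprog : η / (B + ε) * ∑ n ∈ Finset.range T, ‖gradient f (X n)‖ ^ 2 ≤ G / L := by
    refine le_trans ?_ hsum
    rw [Finset.mul_sum]
    apply Finset.sum_le_sum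
    intro n hn
    have hn' := Finset.mem_range.1 hn
    exact progress_ge h₀ h11 hβ2.le h hε' hη0.le hB0 hBsq
      (fun k hk => hnoise k (hk.trans_lt hn')) (fun k hk => hall k (hk.trans hn'.le))
  set S := ∑ n ∈ Finset.range T, ‖gradient f (X n)‖ ^ 2
  have hBε : 0 < B + ε := by positivity
  have hS : S ≤ G / L * ((B + ε) / η) := by
    rw [div_mul_eq_mul_div, div_le_iff₀ hBε] at hprog
    rw [← mul_div_assoc, le_div_iff₀ hη0]
    linarith
  have hTs : √(T : ℝ) ^ 2 = T := Real.sq_sqrt (by linarith)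
  have hTp : 0 < √(T : ℝ) := Real.sqrt_pos.2 (by linarith)
  have hs : √(1 - β₂) = 1 / √T := by
    rw [hβ₂, sub_sub_cancel, Real.sqrt_div zero_le_one, Real.sqrt_one]
  have hmain : 1 / (T : ℝ) * (G / L * ((B + ε) / η))
      = 1 / (T : ℝ) * (ε₀ * G / (L * C₀)) + G / (L * C₀) * (B / √T) := by
    rw [hε, hη, hs, show 1 / (T : ℝ) = 1 / √(T : ℝ) ^ 2 by rw [hTs]]
    field_simp
    ring
  have hBT : B / √T ≤ 2 * √((‖σ₀‖ ^ 2 + (1 + supNorm σ₁ ^ 2) * G) / T) := by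
    have e : √((2 : ℝ) ^ 2) = 2 := Real.sqrt_sq (by norm_num)
    rw [hBdef, ← Real.sqrt_div (by positivity), ← e, ← Real.sqrt_mul (by norm_num)]
    apply Real.sqrt_le_sqrt
    rw [e, ← mul_div_assoc]
    apply div_le_div_of_nonneg_right _ (by linarith)
    have := pow_le_pow_left₀ (supNorm_nonneg σ₀) (supNorm_le_norm σ₀) 2
    nlinarith
  have hGL : 0 ≤ G / (L * C₀) := by positivity
  have hfirst : 0 ≤ 1 / (T : ℝ) * (ε₀ * G / (L * C₀)) := by positivity
  calc 1 / (T : ℝ) * S ≤ 1 / (T : ℝ) * (G / L * ((B + ε) / η)) := by gcongr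
    _ = _ := hmain
    _ ≤ 1 / (T : ℝ) * (ε₀ * G / (L * C₀)) + G / (L * C₀)
        * (2 * √((‖σ₀‖ ^ 2 + (1 + supNorm σ₁ ^ 2) * G) / T)) := by gcongr
    _ ≤ _ := by linarith

end path

/-! ### Independent samples and the exponential supermartingale; predictability is invariance under
`truncSeq`. -/

/-- Forget the entries of a sequence beyond index `n`. -/
def truncSeq {Z : Type*} (n : ℕ) (z : ℕ → Z) : ℕ → Z := fun i => if i ≤ n then z i else z 0

theorem truncSeq_of_le {Z : Type*} {n i : ℕ} (z : ℕ → Z) (h : i ≤ n) : truncSeq n z i = z i := by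
  simp [truncSeq, h]

theorem truncSeq_truncSeq {Z : Type*} {m n : ℕ} (z : ℕ → Z) (h : m ≤ n) :
    truncSeq m (truncSeq n z) = truncSeq m z := by
  funext i
  unfold truncSeq
  split_ifs <;> first | rfl | omega

section sampling

variable {Z Ω : Type*} [MeasurableSpace Z] [MeasurableSpace Ω] {ν : Measure Z} {P : Measure Ω}
  {ζ : ℕ → Ω → Z}

theorem measurable_truncSeq (n : ℕ) : Measurable (truncSeq n : (ℕ → Z) → ℕ → Z) := by
  refine measurable_pi_lambda _ fun i => ?_
  unfold truncSeq
  split_ifs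
  · exact measurable_pi_apply i
  · exact measurable_pi_apply 0

theorem IsSampling.measurable_seq (hζ : IsSampling ν P ζ) : Measurable fun ω k => ζ k ω :=
  measurable_pi_lambda _ hζ.measurable

theorem IsSampling.indepFun_truncSeq (hζ : IsSampling ν P ζ) (n : ℕ) :
    IndepFun (fun ω => truncSeq n fun k => ζ k ω) (ζ (n + 1)) P := by
  have h := hζ.indep.indepFun_finset (Finset.range (n + 1)) {n + 1} (by simp) hζ.measurable
  let φ : (Finset.range (n + 1) → Z) → ℕ → Z :=
    fun w i => if hi : i ≤ n then w ⟨i, by simp; omega⟩ else w ⟨0, by simp⟩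
  have hφ : Measurable φ := by
    refine measurable_pi_lambda _ fun i => ?_
    by_cases hi : i ≤ n
    · simp only [φ, hi, dif_pos]; exact measurable_pi_apply _
    · simp only [φ, hi, dif_neg, not_false_eq_true]; exact measurable_pi_apply _
  let ψ : (({n + 1} : Finset ℕ) → Z) → Z := fun w => w ⟨n + 1, by simp⟩
  have hψ : Measurable ψ := measurable_pi_apply _
  have h2 := h.comp hφ hψ
  have e : (fun ω => truncSeq n fun k => ζ k ω)
      = φ ∘ fun ω (i : Finset.range (n + 1)) => ζ i ω := by
    funext ω i
    simp only [truncSeq, φ, Function.comp]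
    split_ifs <;> rfl
  rw [e]
  exact h2

theorem IsSampling.map_truncSeq_prod [IsProbabilityMeasure P] (hζ : IsSampling ν P ζ) (n : ℕ) :
    P.map (fun ω => (truncSeq n (fun k => ζ k ω), ζ (n + 1) ω))
      = (P.map fun ω => truncSeq n fun k => ζ k ω).prod ν := by
  have hm : Measurable fun ω => truncSeq n fun k => ζ k ω :=
    (measurable_truncSeq n).comp hζ.measurable_seq
  rw [(indepFun_iff_map_prod_eq_prod_map_map hm.aemeasurable
    (hζ.measurable _).aemeasurable).1 (hζ.indepFun_truncSeq n), hζ.law]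

/-- By independence the joint law of past and fresh sample is a product measure, so Fubini transfers
a property that is almost sure for each frozen past to the random past. -/
theorem IsSampling.ae_of_forall_ae [IsProbabilityMeasure P] [IsProbabilityMeasure ν]
    (hζ : IsSampling ν P ζ) (n : ℕ) {p : (ℕ → Z) × Z → Prop} (hp : MeasurableSet {x | p x})
    (h : ∀ z, ∀ᵐ x ∂ν, p (z, x)) :
    ∀ᵐ ω ∂P, p (truncSeq n (fun k => ζ k ω), ζ (n + 1) ω) := by
  have hm : Measurable fun ω => (truncSeq n (fun k => ζ k ω), ζ (n + 1) ω) :=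
    ((measurable_truncSeq n).comp hζ.measurable_seq).prodMk (hζ.measurable _)
  have h1 : ∀ᵐ x ∂(P.map fun ω => (truncSeq n (fun k => ζ k ω), ζ (n + 1) ω)), p x := by
    rw [hζ.map_truncSeq_prod n]
    exact (Measure.ae_prod_iff_ae_ae hp).2 (Filter.Eventually.of_forall h)
  exact ae_of_ae_map hm.aemeasurable h1

theorem IsSampling.lintegral_eq [IsProbabilityMeasure P] [IsProbabilityMeasure ν]
    (hζ : IsSampling ν P ζ) (n : ℕ) {Φ : (ℕ → Z) × Z → ENNReal} (hΦ : Measurable Φ) :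
    ∫⁻ ω, Φ (truncSeq n (fun k => ζ k ω), ζ (n + 1) ω) ∂P
      = ∫⁻ ω, ∫⁻ x, Φ (truncSeq n (fun k => ζ k ω), x) ∂ν ∂P := by
  have hm : Measurable fun ω => (truncSeq n (fun k => ζ k ω), ζ (n + 1) ω) :=
    ((measurable_truncSeq n).comp hζ.measurable_seq).prodMk (hζ.measurable _)
  have hm' : Measurable fun ω => truncSeq n fun k => ζ k ω :=
    (measurable_truncSeq n).comp hζ.measurable_seq
  rw [← lintegral_map hΦ hm, hζ.map_truncSeq_prod n, lintegral_prod _ hΦ.aemeasurable,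
    lintegral_map hΦ.lintegral_prod_right' hm']

/-- Hoeffding's lemma on `[-s, s]`: the variance proxy is `((s - (-s)) / 2) ^ 2 = s ^ 2`. -/
theorem lintegral_exp_le_one [IsProbabilityMeasure ν] {X : Z → ℝ} {s : ℝ} (hX : Measurable X)
    (h0 : ∫ x, X x ∂ν = 0) (hs : ∀ᵐ x ∂ν, |X x| ≤ s) (lam : ℝ) :
    ∫⁻ x, ENNReal.ofReal (Real.exp (lam * X x - lam ^ 2 / 2 * s ^ 2)) ∂ν ≤ 1 := by
  have hsub := hasSubgaussianMGF_of_mem_Icc_of_integral_eq_zero (a := -s) (b := s)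
    hX.aemeasurable (by filter_upwards [hs] with x hx using abs_le.1 hx) h0
  have hint := (hsub.integrable_exp_mul lam).mul_const (Real.exp (-(lam ^ 2 / 2 * s ^ 2)))
  have e : ∀ x, Real.exp (lam * X x - lam ^ 2 / 2 * s ^ 2)
      = Real.exp (lam * X x) * Real.exp (-(lam ^ 2 / 2 * s ^ 2)) := by
    intro x; rw [← Real.exp_add]; ring_nf
  simp only [e]
  rw [← ofReal_integral_eq_lintegral_ofReal hint
    (Filter.Eventually.of_forall fun x => by positivity), integral_mul_const,
    ENNReal.ofReal_le_one]
  have h1 : ∫ x, Real.exp (lam * X x) ∂ν ≤ Real.exp (lam ^ 2 / 2 * s ^ 2) := by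
    refine (hsub.mgf_le lam).trans (le_of_eq ?_)
    congr 1
    have : ‖s - -s‖ ^ 2 = (2 * s) ^ 2 := by
      rw [Real.norm_eq_abs, sq_abs]; ring
    push_cast
    rw [div_pow, this]
    ring
  calc (∫ x, Real.exp (lam * X x) ∂ν) * Real.exp (-(lam ^ 2 / 2 * s ^ 2))
      ≤ Real.exp (lam ^ 2 / 2 * s ^ 2) * Real.exp (-(lam ^ 2 / 2 * s ^ 2)) := by gcongr
    _ = 1 := by rw [← Real.exp_add, add_neg_cancel, Real.exp_zero]

variable {D : ℕ → (ℕ → Z) → Z → ℝ} {s : ℕ → (ℕ → Z) → ℝ}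

/-- The logarithm of the exponential supermartingale of a martingale difference sequence `D` with
predictable envelopes `s`. -/
def logSupermartingale (D : ℕ → (ℕ → Z) → Z → ℝ) (s : ℕ → (ℕ → Z) → ℝ) (lam : ℝ) (t : ℕ)
    (z : ℕ → Z) : ℝ :=
  ∑ n ∈ Finset.range t, (lam * D n z (z (n + 1)) - lam ^ 2 / 2 * s n z ^ 2)

theorem measurable_logSupermartingale (hD : ∀ n, Measurable (Function.uncurry (D n)))
    (hs : ∀ n, Measurable (s n)) (lam : ℝ) (t : ℕ) :
    Measurable (logSupermartingale D s lam t) := by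
  refine Finset.measurable_sum _ fun n _ => ?_
  have h1 : Measurable fun z : ℕ → Z => D n z (z (n + 1)) :=
    (hD n).comp (measurable_id.prodMk (measurable_pi_apply (n + 1)))
  exact (h1.const_mul lam).sub (((hs n).pow_const 2).const_mul _)

/-- Induction on time: the last factor is integrated over its fresh sample with the past frozen, and
Hoeffding's lemma bounds that integral by `1`. -/
theorem lintegral_exp_logSupermartingale_le [IsProbabilityMeasure P] [IsProbabilityMeasure ν]
    (hζ : IsSampling ν P ζ) (hD : ∀ n, Measurable (Function.uncurry (D n)))
    (hs : ∀ n, Measurable (s n)) (hDt : ∀ n z, D n (truncSeq n z) = D n z)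
    (hst : ∀ n z, s n (truncSeq n z) = s n z) (h0 : ∀ n z, ∫ x, D n z x ∂ν = 0)
    (hb : ∀ n z, ∀ᵐ x ∂ν, |D n z x| ≤ s n z) (lam : ℝ) (t : ℕ) :
    ∫⁻ ω, ENNReal.ofReal (Real.exp (logSupermartingale D s lam t fun k => ζ k ω)) ∂P ≤ 1 := by
  induction t with
  | zero => simp [logSupermartingale]
  | succ t ih =>
    have hW : ∀ z : ℕ → Z, logSupermartingale D s lam t (truncSeq t z)
        = logSupermartingale D s lam t z := by
      intro z
      refine Finset.sum_congr rfl fun n hn => ?_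
      have hn' := Finset.mem_range.1 hn
      rw [← hDt n (truncSeq t z), ← hst n (truncSeq t z), truncSeq_truncSeq z hn'.le, hDt, hst,
        truncSeq_of_le z hn']
    let Φ : (ℕ → Z) × Z → ENNReal := fun p =>
      ENNReal.ofReal (Real.exp (logSupermartingale D s lam t p.1))
        * ENNReal.ofReal (Real.exp (lam * D t p.1 p.2 - lam ^ 2 / 2 * s t p.1 ^ 2))
    have hWm := measurable_logSupermartingale hD hs lam t
    have hΦ : Measurable Φ := by
      have h1 : Measurable fun p : (ℕ → Z) × Z => lam * D t p.1 p.2 :=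
        Measurable.const_mul (f := fun p : (ℕ → Z) × Z => D t p.1 p.2) (hD t) lam
      have h2 : Measurable fun p : (ℕ → Z) × Z => lam ^ 2 / 2 * s t p.1 ^ 2 :=
        (((hs t).comp measurable_fst).pow_const 2).const_mul _
      exact (hWm.comp measurable_fst).exp.ennreal_ofReal.mul (h1.sub h2).exp.ennreal_ofReal
    have e : ∀ ω, ENNReal.ofReal (Real.exp (logSupermartingale D s lam (t + 1) fun k => ζ k ω))
        = Φ (truncSeq t (fun k => ζ k ω), ζ (t + 1) ω) := by
      intro ω
      simp only [Φ]
      rw [hW, hDt, hst, ← ENNReal.ofReal_mul (Real.exp_pos _).le, ← Real.exp_add]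
      congr 2
      exact Finset.sum_range_succ _ _
    simp only [e]
    rw [hζ.lintegral_eq t hΦ]
    refine le_trans (lintegral_mono fun ω => ?_) ih
    simp only [Φ]
    rw [lintegral_const_mul' _ _ ENNReal.ofReal_ne_top, hW]
    refine mul_le_of_le_one_right' ?_
    exact lintegral_exp_le_one ((hD t).comp measurable_prodMk_left) (h0 t _) (hb t _) lam

/-- Markov's inequality at level `T / δ` for each fixed time, then a union bound over the `T` times.
The resulting `log (T / δ)` is already allowed by `ℓ₁`, so no maximal inequality is needed. -/
theorem measureReal_exists_lt_logSupermartingale_le [IsProbabilityMeasure P]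
    [IsProbabilityMeasure ν]
    (hζ : IsSampling ν P ζ) (hD : ∀ n, Measurable (Function.uncurry (D n)))
    (hs : ∀ n, Measurable (s n)) (hDt : ∀ n z, D n (truncSeq n z) = D n z)
    (hst : ∀ n z, s n (truncSeq n z) = s n z) (h0 : ∀ n z, ∫ x, D n z x ∂ν = 0)
    (hb : ∀ n z, ∀ᵐ x ∂ν, |D n z x| ≤ s n z) (lam : ℝ) {T : ℕ} (hT : 0 < T) {δ : ℝ}
    (hδ : 0 < δ) :
    P.real (⋃ t ∈ Finset.Icc 1 T,
      {ω | Real.log (T / δ) < logSupermartingale D s lam t fun k => ζ k ω}) ≤ δ := by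
  have hT0 : (0 : ℝ) < T := by exact_mod_cast hT
  have hone : ∀ t, P.real {ω | Real.log (T / δ) < logSupermartingale D s lam t fun k => ζ k ω}
      ≤ δ / T := by
    intro t
    have hm : Measurable fun ω =>
        ENNReal.ofReal (Real.exp (logSupermartingale D s lam t fun k => ζ k ω)) :=
      (((measurable_logSupermartingale hD hs lam t).comp hζ.measurable_seq).exp).ennreal_ofReal
    have h1 := (mul_meas_ge_le_lintegral (μ := P) hm (ENNReal.ofReal (T / δ))).trans
      (lintegral_exp_logSupermartingale_le hζ hD hs hDt hst h0 hb lam t)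
    have hsub : {ω | Real.log (T / δ) < logSupermartingale D s lam t fun k => ζ k ω}
        ⊆ {ω | ENNReal.ofReal (T / δ)
          ≤ ENNReal.ofReal (Real.exp (logSupermartingale D s lam t fun k => ζ k ω))} := by
      intro ω hω
      apply ENNReal.ofReal_le_ofReal
      have : Real.exp (Real.log (T / δ)) ≤ _ := Real.exp_le_exp.2 (le_of_lt hω)
      rwa [Real.exp_log (by positivity)] at this
    have h2 := (mul_le_mul_right (measure_mono hsub) (ENNReal.ofReal (T / δ))).trans h1
    have h3 := ENNReal.toReal_mono ENNReal.one_ne_top h2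
    rw [ENNReal.toReal_mul, ENNReal.toReal_ofReal (by positivity), ENNReal.toReal_one] at h3
    change T / δ * P.real _ ≤ 1 at h3
    rw [div_mul_eq_mul_div, div_le_one hδ] at h3
    rw [le_div_iff₀ hT0]
    linarith
  refine (measureReal_biUnion_finset_le _ _).trans ?_
  refine (Finset.sum_le_sum fun t _ => hone t).trans (le_of_eq ?_)
  simp
  field_simp

end sampling

/-! ### The Adam recursion as a path: identification, predictability, measurability, centred noise.
-/

theorem accum_congr {β : ℝ} {g g' : ℕ → ℝ} {n : ℕ} (h : ∀ k < n, g k = g' k) :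
    accum β g n = accum β g' n := by
  induction n with
  | zero => rfl
  | succ n ih =>
    simp only [accum]
    rw [ih fun k hk => h k (hk.trans n.lt_succ_self), h n n.lt_succ_self]

section run

variable {d : ℕ} {Z : Type*} {β₁ β₂ η ε : ℝ} {f : E d → ℝ} {σ₀ σ₁ : E d}
  {g : E d → Z → E d} {x₁ : E d}

/-- The point reached by Adam after `n` iterations. -/
def adamPoint (β₁ β₂ η ε : ℝ) (g : E d → Z → E d) (x₁ : E d) (z : ℕ → Z) (n : ℕ) : E d :=
  (adamState β₁ β₂ η ε g x₁ z n).x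

/-- The stochastic gradient used by Adam in iteration `n + 1`. -/
def adamGrad (β₁ β₂ η ε : ℝ) (g : E d → Z → E d) (x₁ : E d) (z : ℕ → Z) (n : ℕ) : E d :=
  g (adamPoint β₁ β₂ η ε g x₁ z n) (z (n + 1))

theorem adamState_m (z : ℕ → Z) (n : ℕ) (i : Fin d) :
    (adamState β₁ β₂ η ε g x₁ z n).m i
      = mom β₁ (fun k => adamGrad β₁ β₂ η ε g x₁ z k i) n := by
  induction n with
  | zero => rfl
  | succ n ih =>
    simp only [adamState, adamStep, mom, ih]
    rfl

theorem adamState_v (z : ℕ → Z) (n : ℕ) (i : Fin d) :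
    (adamState β₁ β₂ η ε g x₁ z n).v i
      = (1 - β₂) * accum β₂ (fun k => adamGrad β₁ β₂ η ε g x₁ z k i) n := by
  induction n with
  | zero => simp [adamState, accum]
  | succ n ih =>
    simp only [adamState, adamStep, accum, ih, adamGrad, adamPoint]
    ring

/-- The factor `√(1 - β₂ ^ (n + 1))` is common to `ηs`, `√v` and `εs`; cancelling it leaves the
bias-corrected form with constant `ε`. -/
theorem isAdamPath_adamPoint (h₀ : 0 ≤ β₂) (h : β₂ < 1) (z : ℕ → Z) :
    IsAdamPath β₁ β₂ η ε (adamPoint β₁ β₂ η ε g x₁ z) (adamGrad β₁ β₂ η ε g x₁ z) := by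
  intro n i
  have e1 := adamState_m (β₁ := β₁) (β₂ := β₂) (η := η) (ε := ε) (g := g) (x₁ := x₁) z (n + 1) i
  have e2 := adamState_v (β₁ := β₁) (β₂ := β₂) (η := η) (ε := ε) (g := g) (x₁ := x₁) z (n + 1) i
  have hr : 0 < 1 - β₂ ^ (n + 1) := one_sub_pow_pos h₀ h n.succ_ne_zero
  have hx : adamPoint β₁ β₂ η ε g x₁ z (n + 1) i = adamPoint β₁ β₂ η ε g x₁ z n i
      - η * √(1 - β₂ ^ (n + 1)) / (1 - β₁ ^ (n + 1))
        / (√((adamState β₁ β₂ η ε g x₁ z (n + 1)).v i) + ε * √(1 - β₂ ^ (n + 1)))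
        * (adamState β₁ β₂ η ε g x₁ z (n + 1)).m i := rfl
  rw [hx, e1, e2]
  congr 2
  have hv := vhat_nonneg (g := fun k => adamGrad β₁ β₂ η ε g x₁ z k i) h₀ h.le (n + 1)
  have e3 : (1 - β₂) * accum β₂ (fun k => adamGrad β₁ β₂ η ε g x₁ z k i) (n + 1)
      = vhat β₂ (fun k => adamGrad β₁ β₂ η ε g x₁ z k i) (n + 1) * (1 - β₂ ^ (n + 1)) := by
    unfold vhat; field_simp
  have hs : √(1 - β₂ ^ (n + 1)) ≠ 0 := (Real.sqrt_pos.2 hr).ne'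
  rw [e3, Real.sqrt_mul hv, ← add_mul, stepSize, bhat, mul_div_right_comm,
    mul_div_mul_right _ _ hs]

theorem adamState_congr {z z' : ℕ → Z} {n : ℕ} (h : ∀ k ≤ n, z k = z' k) :
    adamState β₁ β₂ η ε g x₁ z n = adamState β₁ β₂ η ε g x₁ z' n := by
  induction n with
  | zero => rfl
  | succ n ih =>
    simp only [adamState]
    rw [ih fun k hk => h k (hk.trans n.le_succ), h (n + 1) le_rfl]

theorem adamPoint_truncSeq {m n : ℕ} (hmn : m ≤ n) (z : ℕ → Z) :
    adamPoint β₁ β₂ η ε g x₁ (truncSeq n z) m = adamPoint β₁ β₂ η ε g x₁ z m :=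
  congrArg AdamState.x (adamState_congr fun _ hk => truncSeq_of_le z (hk.trans hmn))

theorem adamGrad_truncSeq {m n : ℕ} (hmn : m < n) (z : ℕ → Z) :
    adamGrad β₁ β₂ η ε g x₁ (truncSeq n z) m = adamGrad β₁ β₂ η ε g x₁ z m := by
  unfold adamGrad
  rw [adamPoint_truncSeq hmn.le, truncSeq_of_le z hmn]

theorem pathProxy_truncSeq (n : ℕ) (z : ℕ → Z) (i : Fin d) :
    pathProxy β₁ β₂ η ε f σ₀ σ₁ (adamPoint β₁ β₂ η ε g x₁ (truncSeq n z))
        (adamGrad β₁ β₂ η ε g x₁ (truncSeq n z)) n i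
      = pathProxy β₁ β₂ η ε f σ₀ σ₁ (adamPoint β₁ β₂ η ε g x₁ z)
        (adamGrad β₁ β₂ η ε g x₁ z) n i := by
  unfold pathProxy vhat
  rw [adamPoint_truncSeq le_rfl, accum_congr fun k hk => by rw [adamGrad_truncSeq hk]]

/-- The noise term of iteration `n + 1`, as a function of the past and of the fresh sample. -/
def adamNoise (β₁ β₂ η ε : ℝ) (f : E d → ℝ) (σ₀ σ₁ : E d) (g : E d → Z → E d) (x₁ : E d)
    (n : ℕ) (z : ℕ → Z) (x : Z) : ℝ :=
  ∑ i, -(pathProxy β₁ β₂ η ε f σ₀ σ₁ (adamPoint β₁ β₂ η ε g x₁ z) (adamGrad β₁ β₂ η ε g x₁ z) n i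
    * gradient f (adamPoint β₁ β₂ η ε g x₁ z n) i
    * (g (adamPoint β₁ β₂ η ε g x₁ z n) x i - gradient f (adamPoint β₁ β₂ η ε g x₁ z n) i))

/-- The envelope of the noise of iteration `n + 1`, as a function of the past. -/
def adamEnvelope (β₁ β₂ η ε : ℝ) (f : E d → ℝ) (σ₀ σ₁ : E d) (g : E d → Z → E d) (x₁ : E d)
    (n : ℕ) (z : ℕ → Z) : ℝ :=
  noiseEnvelope β₁ β₂ η ε f σ₀ σ₁ (adamPoint β₁ β₂ η ε g x₁ z) (adamGrad β₁ β₂ η ε g x₁ z) n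

theorem adamNoise_truncSeq (n : ℕ) (z : ℕ → Z) :
    adamNoise β₁ β₂ η ε f σ₀ σ₁ g x₁ n (truncSeq n z)
      = adamNoise β₁ β₂ η ε f σ₀ σ₁ g x₁ n z := by
  funext x
  simp only [adamNoise, pathProxy_truncSeq, adamPoint_truncSeq le_rfl]

theorem adamEnvelope_truncSeq (n : ℕ) (z : ℕ → Z) :
    adamEnvelope β₁ β₂ η ε f σ₀ σ₁ g x₁ n (truncSeq n z)
      = adamEnvelope β₁ β₂ η ε f σ₀ σ₁ g x₁ n z := by
  simp only [adamEnvelope, noiseEnvelope, pathProxy_truncSeq, adamPoint_truncSeq le_rfl]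

variable [MeasurableSpace Z] {ν : Measure Z}

theorem measurable_coord (i : Fin d) : Measurable fun w : E d => w i :=
  (measurable_pi_apply i).comp (WithLp.measurable_ofLp 2 _)

theorem measurable_adamState (hg : Measurable (Function.uncurry g)) (n : ℕ) :
    (Measurable fun z => (adamState β₁ β₂ η ε g x₁ z n).x)
      ∧ (Measurable fun z => (adamState β₁ β₂ η ε g x₁ z n).m)
      ∧ (Measurable fun z => (adamState β₁ β₂ η ε g x₁ z n).v) := by
  induction n with
  | zero => exact ⟨measurable_const, measurable_const, measurable_const⟩
  | succ n ih =>
    obtain ⟨hx, hm, hv⟩ := ih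
    have hgs : Measurable fun z : ℕ → Z =>
        g (adamState β₁ β₂ η ε g x₁ z n).x (z (n + 1)) :=
      hg.comp (hx.prodMk (measurable_pi_apply (n + 1)))
    have hgi := fun i => (measurable_coord i).comp hgs
    have hm' : Measurable fun z => (adamState β₁ β₂ η ε g x₁ z (n + 1)).m :=
      measurable_pi_lambda _ fun i =>
        (((measurable_pi_apply i).comp hm).const_mul β₁).add ((hgi i).const_mul (1 - β₁))
    have hv' : Measurable fun z => (adamState β₁ β₂ η ε g x₁ z (n + 1)).v :=
      measurable_pi_lambda _ fun i => (((measurable_pi_apply i).comp hv).const_mul β₂).add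
        (((hgi i).pow_const 2).const_mul (1 - β₂))
    refine ⟨?_, hm', hv'⟩
    refine (WithLp.measurable_toLp 2 _).comp (measurable_pi_lambda _ fun i => ?_)
    refine ((measurable_coord i).comp hx).sub (Measurable.mul ?_ ((measurable_pi_apply i).comp hm'))
    exact (((measurable_pi_apply i).comp hv').sqrt.add_const _).const_div _

theorem measurable_adamPoint (hg : Measurable (Function.uncurry g)) (n : ℕ) :
    Measurable fun z => adamPoint β₁ β₂ η ε g x₁ z n :=
  (measurable_adamState hg n).1

theorem measurable_vhat_adamGrad (hg : Measurable (Function.uncurry g)) (n : ℕ) (i : Fin d) :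
    Measurable fun z => vhat β₂ (fun k => adamGrad β₁ β₂ η ε g x₁ z k i) n := by
  have : (fun z => vhat β₂ (fun k => adamGrad β₁ β₂ η ε g x₁ z k i) n)
      = fun z => (adamState β₁ β₂ η ε g x₁ z n).v i / (1 - β₂ ^ n) := by
    funext z
    rw [adamState_v, vhat]
  rw [this]
  exact ((measurable_pi_apply i).comp (measurable_adamState hg n).2.2).div_const _

theorem measurable_gradient_adamPoint (hf : Continuous (gradient f))
    (hg : Measurable (Function.uncurry g)) (n : ℕ) (i : Fin d) :
    Measurable fun z => gradient f (adamPoint β₁ β₂ η ε g x₁ z n) i :=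
  (measurable_coord i).comp (hf.measurable.comp (measurable_adamPoint hg n))

theorem measurable_noiseLevel {a b : ℝ} : Measurable (noiseLevel a b) := by
  unfold noiseLevel
  fun_prop

theorem measurable_pathProxy (hf : Continuous (gradient f))
    (hg : Measurable (Function.uncurry g)) (n : ℕ) (i : Fin d) :
    Measurable fun z => pathProxy β₁ β₂ η ε f σ₀ σ₁ (adamPoint β₁ β₂ η ε g x₁ z)
      (adamGrad β₁ β₂ η ε g x₁ z) n i := by
  have h1 := measurable_vhat_adamGrad (β₁ := β₁) (β₂ := β₂) (η := η) (ε := ε) (x₁ := x₁) hg n i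
  have h2 := measurable_gradient_adamPoint (β₁ := β₁) (β₂ := β₂) (η := η) (ε := ε) (x₁ := x₁)
    hf hg n i
  have h3 := measurable_noiseLevel (a := σ₀ i) (b := σ₁ i) |>.comp h2
  unfold pathProxy proxyStep proxyDen
  refine Measurable.const_div (Measurable.add_const (Measurable.sqrt ?_) _) _
  exact (h1.const_mul _).add (((h2.pow_const 2).add (h3.pow_const 2)).const_mul _)

theorem measurable_adamEnvelope (hf : Continuous (gradient f))
    (hg : Measurable (Function.uncurry g)) (n : ℕ) :
    Measurable (adamEnvelope β₁ β₂ η ε f σ₀ σ₁ g x₁ n) := by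
  unfold adamEnvelope noiseEnvelope
  refine Finset.measurable_fun_sum _ fun i _ => ?_
  have h2 := measurable_gradient_adamPoint (β₁ := β₁) (β₂ := β₂) (η := η) (ε := ε) (x₁ := x₁)
    hf hg n i
  have h3 := measurable_noiseLevel (a := σ₀ i) (b := σ₁ i) |>.comp h2
  have h4 : Measurable fun z => |gradient f (adamPoint β₁ β₂ η ε g x₁ z n) i| := by
    simpa only [Real.norm_eq_abs] using h2.norm
  exact ((measurable_pathProxy hf hg n i).mul h4).mul h3

theorem measurable_sample_sub (hf : Continuous (gradient f))
    (hg : Measurable (Function.uncurry g)) (n : ℕ) (i : Fin d) :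
    Measurable fun p : (ℕ → Z) × Z => g (adamPoint β₁ β₂ η ε g x₁ p.1 n) p.2 i
      - gradient f (adamPoint β₁ β₂ η ε g x₁ p.1 n) i := by
  have h2 := measurable_gradient_adamPoint (β₁ := β₁) (β₂ := β₂) (η := η) (ε := ε) (x₁ := x₁)
    hf hg n i
  have h1 : Measurable fun p : (ℕ → Z) × Z => g (adamPoint β₁ β₂ η ε g x₁ p.1 n) p.2 :=
    hg.comp (((measurable_adamPoint hg n).comp measurable_fst).prodMk measurable_snd)
  exact ((measurable_coord i).comp h1).sub (h2.comp measurable_fst)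

theorem measurable_adamNoise (hf : Continuous (gradient f))
    (hg : Measurable (Function.uncurry g)) (n : ℕ) :
    Measurable (Function.uncurry (adamNoise β₁ β₂ η ε f σ₀ σ₁ g x₁ n)) := by
  simp only [Function.uncurry_def, adamNoise]
  refine Finset.measurable_fun_sum _ fun i _ => ?_
  have h2 := measurable_gradient_adamPoint (β₁ := β₁) (β₂ := β₂) (η := η) (ε := ε) (x₁ := x₁)
    hf hg n i
  exact ((((measurable_pathProxy hf hg n i).comp measurable_fst).mul
    (h2.comp measurable_fst)).mul (measurable_sample_sub hf hg n i)).neg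

theorem IsGradientOracle.integrable_coord (ho : IsGradientOracle f σ₀ σ₁ ν g) (x : E d)
    (i : Fin d) : Integrable (fun z => g x z i) ν :=
  (EuclideanSpace.proj (𝕜 := ℝ) i).integrable_comp (ho.integrable x)

theorem IsGradientOracle.integral_coord (ho : IsGradientOracle f σ₀ σ₁ ν g) (x : E d)
    (i : Fin d) : ∫ z, g x z i ∂ν = gradient f x i := by
  have := (EuclideanSpace.proj (𝕜 := ℝ) i).integral_comp_comm (ho.integrable x)
  rw [ho.unbiased x] at this
  exact this

theorem IsGradientOracle.ae_noise (ho : IsGradientOracle f σ₀ σ₁ ν g) (x : E d) :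
    ∀ᵐ z ∂ν, ∀ i, |g x z i - gradient f x i| ≤ noiseLevel (σ₀ i) (σ₁ i) (gradient f x i) := by
  rw [ae_all_iff]
  intro i
  filter_upwards [ho.affine_noise x i] with z hz
  exact Real.abs_le_sqrt hz

theorem integral_adamNoise [IsProbabilityMeasure ν] (ho : IsGradientOracle f σ₀ σ₁ ν g) (n : ℕ)
    (z : ℕ → Z) : ∫ x, adamNoise β₁ β₂ η ε f σ₀ σ₁ g x₁ n z x ∂ν = 0 := by
  unfold adamNoise
  have hi := fun i => ho.integrable_coord (adamPoint β₁ β₂ η ε g x₁ z n) i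
  rw [integral_finsetSum]
  swap
  · exact fun i _ => (((hi i).sub (integrable_const _)).const_mul _).neg
  refine Finset.sum_eq_zero fun i _ => ?_
  rw [integral_neg, integral_const_mul, integral_sub (hi i) (integrable_const _),
    ho.integral_coord]
  simp

theorem ae_abs_adamNoise_le (h₀ : 0 ≤ β₁) (h : β₁ < 1) (hε : 0 < ε) (hη : 0 ≤ η)
    (ho : IsGradientOracle f σ₀ σ₁ ν g) (n : ℕ) (z : ℕ → Z) :
    ∀ᵐ x ∂ν, |adamNoise β₁ β₂ η ε f σ₀ σ₁ g x₁ n z x|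
      ≤ adamEnvelope β₁ β₂ η ε f σ₀ σ₁ g x₁ n z := by
  filter_upwards [ho.ae_noise (adamPoint β₁ β₂ η ε g x₁ z n)] with x hx
  refine (Finset.abs_sum_le_sum_abs _ _).trans (Finset.sum_le_sum fun i _ => ?_)
  have he := pathProxy_nonneg (β₂ := β₂) (f := f) (σ₀ := σ₀) (σ₁ := σ₁)
    (X := adamPoint β₁ β₂ η ε g x₁ z) (gs := adamGrad β₁ β₂ η ε g x₁ z) h₀ h hε hη n i
  rw [abs_neg, abs_mul, abs_mul, abs_of_nonneg he]
  gcongr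
  exact hx i

variable {Ω : Type*} [MeasurableSpace Ω] {P : Measure Ω} {ζ : ℕ → Ω → Z}

/-- The oracle's exceptional null set depends on the point, and the iterates are random;
independence of the fresh sample from the iterate makes the bound hold almost surely along the whole
trajectory. -/
theorem ae_noise_path [IsProbabilityMeasure P] [IsProbabilityMeasure ν]
    (hf : Continuous (gradient f)) (ho : IsGradientOracle f σ₀ σ₁ ν g)
    (hζ : IsSampling ν P ζ) : ∀ᵐ ω ∂P, ∀ n i,
      |adamGrad β₁ β₂ η ε g x₁ (fun k => ζ k ω) n i
          - gradient f (adamPoint β₁ β₂ η ε g x₁ (fun k => ζ k ω) n) i|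
        ≤ noiseLevel (σ₀ i) (σ₁ i)
          (gradient f (adamPoint β₁ β₂ η ε g x₁ (fun k => ζ k ω) n) i) := by
  rw [ae_all_iff]
  intro n
  have hm : MeasurableSet {p : (ℕ → Z) × Z | ∀ i, |g (adamPoint β₁ β₂ η ε g x₁ p.1 n) p.2 i
      - gradient f (adamPoint β₁ β₂ η ε g x₁ p.1 n) i|
        ≤ noiseLevel (σ₀ i) (σ₁ i) (gradient f (adamPoint β₁ β₂ η ε g x₁ p.1 n) i)} := by
    rw [Set.ofPred_forall]
    refine MeasurableSet.iInter fun i => measurableSet_le ?_ ?_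
    · simpa only [Real.norm_eq_abs] using (measurable_sample_sub hf ho.measurable n i).norm
    · exact measurable_noiseLevel.comp
        ((measurable_gradient_adamPoint hf ho.measurable n i).comp measurable_fst)
  filter_upwards [hζ.ae_of_forall_ae n hm fun z => ho.ae_noise (adamPoint β₁ β₂ η ε g x₁ z n)] with ω hω
  simp only [adamPoint_truncSeq le_rfl] at hω
  exact hω

end run

/-! ### Growth of `G₁` and of the bound in `log T`. -/

section growth

open Asymptotics Filter

variable {d : ℕ} {L C₀ ε₀ β₁ δ Δ g₁ : ℝ} {σ₀ σ₁ : E d}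

/-- The admissible horizons: the integers `T ≥ 2` with `β₁ < 1 - 1 / T`. -/
def horizons (β₁ : ℝ) : Set ℕ := {T | 2 ≤ T ∧ β₁ < 1 - 1 / (T : ℝ)}

theorem half_le_log {T : ℕ} (hT : 2 ≤ T) : 1 / 2 ≤ Real.log T := by
  have h1 : Real.log 2 ≤ Real.log T := Real.log_le_log (by norm_num) (by exact_mod_cast hT)
  linarith [Real.log_two_gt_d9]

theorem const_isBigO_log_pow (c : ℝ) (k : ℕ) :
    (fun _ : ℕ => c) =O[𝓟 (horizons β₁)] fun T => Real.log T ^ k := by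
  rw [isBigO_principal]
  refine ⟨|c| * 2 ^ k, fun T hT => ?_⟩
  have h := half_le_log hT.1
  have h1 : 1 ≤ (2 * Real.log T) ^ k := one_le_pow₀ (by linarith)
  rw [Real.norm_eq_abs, Real.norm_of_nonneg (by positivity), mul_assoc, ← mul_pow]
  exact le_mul_of_one_le_right (abs_nonneg _) h1

theorem isBigO_one_of_le {x : ℕ → ℝ} {c : ℝ} (h : ∀ T ∈ horizons β₁, |x T| ≤ c) :
    x =O[𝓟 (horizons β₁)] fun _ => (1 : ℝ) := by
  rw [isBigO_principal]
  exact ⟨c, fun T hT => by simpa using h T hT⟩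

/-- Uniformity rests on `T` being an integer: `T > 1 / (1 - β₁)` forces `T ≥ ⌊1 / (1 - β₁)⌋ + 1`,
which keeps `β₁ / β₂ ≤ β₁ + 1 / T` away from `1`. -/
theorem momentum_ratio_isBigO (h₀ : 0 ≤ β₁) :
    (fun T : ℕ => (1 - β₁ / (1 - 1 / (T : ℝ)))⁻¹) =O[𝓟 (horizons β₁)] fun _ => (1 : ℝ) := by
  have key : ∀ T ∈ horizons β₁, 0 < 1 - β₁ - 1 / ((⌊1 / (1 - β₁)⌋₊ : ℝ) + 1)
      ∧ 1 - β₁ - 1 / ((⌊1 / (1 - β₁)⌋₊ : ℝ) + 1) ≤ 1 - β₁ / (1 - 1 / (T : ℝ)) := by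
    rintro T ⟨hT, hβ⟩
    have hT0 : (2 : ℝ) ≤ T := by exact_mod_cast hT
    have hTi : 0 < 1 / (T : ℝ) := by positivity
    have hq : 0 < 1 - β₁ := by linarith
    have h1 := Nat.lt_floor_add_one (1 / (1 - β₁))
    have hfl : ((⌊1 / (1 - β₁)⌋₊ : ℝ) + 1) ≤ T := by
      have : ⌊1 / (1 - β₁)⌋₊ < T := by
        rw [Nat.floor_lt (by positivity), div_lt_iff₀ hq]
        have : (T : ℝ) * (1 / T) = 1 := by field_simp
        nlinarith
      exact_mod_cast this
    have hp : (0 : ℝ) < (⌊1 / (1 - β₁)⌋₊ : ℝ) + 1 := by positivity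
    constructor
    · rw [sub_pos, div_lt_iff₀ hp]
      rw [div_lt_iff₀ hq] at h1
      linarith
    · have h2 : 1 / (T : ℝ) ≤ 1 / ((⌊1 / (1 - β₁)⌋₊ : ℝ) + 1) := one_div_le_one_div_of_le hp hfl
      have hβ2 : 0 < 1 - 1 / (T : ℝ) := by linarith
      have h3 : β₁ / (1 - 1 / (T : ℝ)) ≤ β₁ + 1 / T := by
        rw [div_le_iff₀ hβ2]
        nlinarith
      linarith
  refine isBigO_one_of_le (c := (1 - β₁ - 1 / ((⌊1 / (1 - β₁)⌋₊ : ℝ) + 1))⁻¹) fun T hT => ?_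
  obtain ⟨h1, h2⟩ := key T hT
  rw [abs_of_nonneg (inv_nonneg.2 (h1.le.trans h2))]
  exact inv_anti₀ h1 h2

theorem log_card_div_isBigO (hδ : 0 < δ) :
    (fun T : ℕ => Real.log (d * T / δ)) =O[𝓟 (horizons β₁)] fun T => Real.log T := by
  rcases Nat.eq_zero_or_pos d with rfl | hd
  · simpa using isBigO_zero _ _
  · have hd' : (d : ℝ) ≠ 0 := by positivity
    have h1 : (fun T : ℕ => Real.log (d / δ) + Real.log T)
        =O[𝓟 (horizons β₁)] fun T => Real.log T := by
      have := const_isBigO_log_pow (β₁ := β₁) (Real.log (d / δ)) 1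
      simp only [pow_one] at this
      exact this.add (isBigO_refl _ _)
    refine h1.congr' ?_ EventuallyEq.rfl
    rw [EventuallyEq, eventually_principal]
    intro T hT
    have hT0 : (T : ℝ) ≠ 0 := by have := hT.1; positivity
    rw [← Real.log_mul (by positivity) hT0]
    congr 1
    ring

/-- Since `ε ^ 2 = ε₀ ^ 2 / T`, the polynomial gains one degree and is at most a constant times `T ^
4`. -/
theorem log_calF_isBigO (h₀ : 0 ≤ β₁) :
    (fun T : ℕ => Real.log (calF d T L C₀ ε₀ β₁ (1 - 1 / (T : ℝ)) g₁ σ₀ σ₁ / Real.exp (-2)))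
      =O[𝓟 (horizons β₁)] fun T => Real.log T := by
  obtain ⟨R, hR⟩ := isBigO_principal.1 (momentum_ratio_isBigO h₀)
  simp only [norm_one, mul_one, Real.norm_eq_abs] at hR
  have hRpos : ∀ T ∈ horizons β₁, 0 < 1 - β₁ / (1 - 1 / (T : ℝ)) := by
    rintro T ⟨hT, hβ⟩
    exact sub_pos.2 ((div_lt_one (h₀.trans_lt hβ)).2 hβ)
  set a := 2 / ε₀ ^ 2 * (supNorm σ₀ ^ 2 + 2 * (1 + supNorm σ₁ ^ 2) * g₁ ^ 2) with ha
  set b := 2 / ε₀ ^ 2 * (2 * (1 + supNorm σ₁ ^ 2) * d * L ^ 2 * C₀ ^ 2) with hb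
  have ha0 : 0 ≤ a := by positivity
  have hb0 : 0 ≤ b := by positivity
  set c := 1 + a + b * |R| with hc
  have hc1 : 1 ≤ c := by
    have : 0 ≤ b * |R| := by positivity
    linarith
  have hF : ∀ T ∈ horizons β₁, 1 ≤ calF d T L C₀ ε₀ β₁ (1 - 1 / (T : ℝ)) g₁ σ₀ σ₁
      ∧ calF d T L C₀ ε₀ β₁ (1 - 1 / (T : ℝ)) g₁ σ₀ σ₁ ≤ c * T ^ 4 := by
    intro T hT
    refine ⟨calF_ge_one (hRpos T hT).le, ?_⟩
    have hT0 : (2 : ℝ) ≤ T := by exact_mod_cast hT.1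
    have hTpos : (0 : ℝ) < T := by linarith
    have e : calF d T L C₀ ε₀ β₁ (1 - 1 / (T : ℝ)) g₁ σ₀ σ₁
        = 1 + a * T ^ 2 + b * (1 - β₁ / (1 - 1 / (T : ℝ)))⁻¹ * T ^ 4 := by
      have h1 : (ε₀ * √(1 - (1 - 1 / (T : ℝ)))) ^ 2 = ε₀ ^ 2 * (1 / T) := by
        rw [sub_sub_cancel, mul_pow, Real.sq_sqrt (by positivity)]
      have h2 : 2 / (ε₀ ^ 2 * (1 / (T : ℝ))) = 2 / ε₀ ^ 2 * T := by
        rw [mul_one_div, div_div_eq_mul_div, div_mul_eq_mul_div]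
      rw [calF, h1, h2, ha, hb]
      ring
    have h3 : (1 - β₁ / (1 - 1 / (T : ℝ)))⁻¹ ≤ |R| := by
      exact (le_abs_self _).trans ((hR T hT).trans (le_abs_self _))
    have h4 : (1 : ℝ) ≤ T ^ 4 := one_le_pow₀ (by linarith)
    have h5 : (T : ℝ) ^ 2 ≤ T ^ 4 := pow_le_pow_right₀ (by linarith) (by norm_num)
    have h6 : b * (1 - β₁ / (1 - 1 / (T : ℝ)))⁻¹ * T ^ 4 ≤ b * |R| * T ^ 4 := by gcongr
    have h7 : a * T ^ 2 ≤ a * (T : ℝ) ^ 4 := by gcongr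
    rw [e, hc]
    linarith
  have h1 : (fun T : ℕ => 2 + Real.log c + 4 * Real.log T)
      =O[𝓟 (horizons β₁)] fun T => Real.log T := by
    have := const_isBigO_log_pow (β₁ := β₁) (2 + Real.log c) 1
    simp only [pow_one] at this
    exact this.add ((isBigO_refl _ _).const_mul_left 4)
  refine IsBigO.trans (IsBigO.of_bound 1 ?_) h1
  rw [eventually_principal]
  intro T hT
  obtain ⟨hF1, hF2⟩ := hF T hT
  have hT0 : (0 : ℝ) < T := by have := hT.1; positivity
  have h2 := two_le_log_calF hF1
  have h3 := Real.log_le_log (by linarith) hF2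
  rw [Real.log_mul (by positivity) (by positivity), Real.log_pow] at h3
  have h4 : Real.log (calF d T L C₀ ε₀ β₁ (1 - 1 / (T : ℝ)) g₁ σ₀ σ₁ / Real.exp (-2))
      = Real.log (calF d T L C₀ ε₀ β₁ (1 - 1 / (T : ℝ)) g₁ σ₀ σ₁) + 2 := by
    rw [Real.log_div (by linarith) (Real.exp_pos _).ne', Real.log_exp]
    ring
  rw [one_mul, Real.norm_of_nonneg (by linarith)]
  refine le_trans ?_ (le_abs_self _)
  push_cast at h3
  linarith

theorem sigmaMax_le_one {β₂ : ℝ} (h : 1 / 2 ≤ β₂) : sigmaMax β₂ ≤ 1 := by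
  refine max_le le_rfl ?_
  have : √((1 + β₂) / β₂) ≤ 2 := by
    rw [Real.sqrt_le_left (by norm_num), div_le_iff₀ (by linarith)]
    linarith
  linarith

theorem adamG₁_isBigO (h₀ : 0 ≤ β₁) (hδ : 0 < δ) :
    (fun T : ℕ => adamG₁ d T L C₀ ε₀ β₁ δ Δ g₁ σ₀ σ₁)
      =O[𝓟 (horizons β₁)] fun T => Real.log T ^ 2 := by
  have hR := momentum_ratio_isBigO h₀
  have hb : (fun T : ℕ => (1 - 1 / (T : ℝ))⁻¹) =O[𝓟 (horizons β₁)] fun _ => (1 : ℝ) := by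
    refine isBigO_one_of_le (c := 2) fun T hT => ?_
    have h := half_le_one_sub_inv hT.1 rfl
    rw [abs_of_nonneg (by positivity), inv_le_comm₀ (by linarith) (by norm_num)]
    linarith
  have hsb : (fun T : ℕ => (√(1 - 1 / (T : ℝ)))⁻¹) =O[𝓟 (horizons β₁)] fun _ => (1 : ℝ) := by
    refine isBigO_one_of_le (c := 2) fun T hT => ?_
    have h := half_le_one_sub_inv hT.1 rfl
    have h1 : (1 : ℝ) / 2 ≤ √(1 - 1 / (T : ℝ)) := Real.le_sqrt_of_sq_le (by linarith)
    rw [abs_of_nonneg (by positivity), inv_le_comm₀ (by linarith) (by norm_num)]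
    linarith
  have hS : (fun T : ℕ => sigmaMax (1 - 1 / (T : ℝ))) =O[𝓟 (horizons β₁)] fun _ => (1 : ℝ) := by
    refine isBigO_one_of_le (c := 1) fun T hT => ?_
    rw [abs_of_nonneg (zero_le_one.trans (sigmaMax_ge _))]
    exact sigmaMax_le_one (half_le_one_sub_inv hT.1 rfl)
  have hc : ∀ c : ℝ, (fun _ : ℕ => c) =O[𝓟 (horizons β₁)] fun _ => (1 : ℝ) :=
    fun c => isBigO_one_of_le fun _ _ => le_rfl
  have hℓ₁ := log_card_div_isBigO (d := d) (β₁ := β₁) hδ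
  have hℓ₂ := log_calF_isBigO (d := d) (L := L) (C₀ := C₀) (ε₀ := ε₀) (g₁ := g₁) (σ₀ := σ₀)
    (σ₁ := σ₁) h₀
  have h10 : (fun _ : ℕ => (1 : ℝ)) =O[𝓟 (horizons β₁)] fun T => Real.log T ^ 2 :=
    const_isBigO_log_pow 1 2
  have h12 : (fun T : ℕ => Real.log T) =O[𝓟 (horizons β₁)] fun T => Real.log T ^ 2 := by
    have := (const_isBigO_log_pow (β₁ := β₁) 1 1).mul
      (isBigO_refl (fun T : ℕ => Real.log T) (𝓟 (horizons β₁)))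
    simpa [pow_two] using this
  have hm1 : ∀ {x y : ℕ → ℝ}, x =O[𝓟 (horizons β₁)] (fun _ => (1 : ℝ)) →
      y =O[𝓟 (horizons β₁)] (fun _ => (1 : ℝ)) →
      (fun T => x T * y T) =O[𝓟 (horizons β₁)] fun _ => (1 : ℝ) := by
    intro x y hx hy
    simpa using hx.mul hy
  have hm2 : ∀ {x y w : ℕ → ℝ}, x =O[𝓟 (horizons β₁)] (fun _ => (1 : ℝ)) →
      y =O[𝓟 (horizons β₁)] w → (fun T => x T * y T) =O[𝓟 (horizons β₁)] w := by
    intro x y w hx hy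
    simpa using hx.mul hy
  have t1 := (hc (8 * L * Δ)).trans h10
  have t2 := (hm1 (hc (256 * L ^ 2 * C₀ ^ 2 * β₁ ^ 2 * d ^ 2 / (1 - β₁) ^ 3
    + 4 * L ^ 2 * C₀ ^ 2 * β₁ ^ 2 * d / (1 - β₁) ^ 2)) hR).trans h10
  have t3 := (hm2 (hc (48 * L * C₀ * supNorm σ₀ / (1 - β₁) * d)) hℓ₁).trans h12
  have t4 := (hm2 (hm1 (hm1 (hc (8 * L * C₀ * β₁ ^ 2 / (1 - β₁) ^ 2 * d)) hR)
    (((hm1 (hc (4 * supNorm σ₀)) hb).add (hm1 (hc (ε₀ + √2 * supNorm σ₀)) hsb)).add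
      (hm1 (hc (L * C₀ / 2)) ((hc 1).add (hm1 (hc 4) (hm1 hS hS)))))) hℓ₂).trans h12
  have t5 := (hm2 (hc (8 * (3 * L ^ 2 * C₀ ^ 2 / (1 - β₁) ^ 2
    + 8 * L * supNorm σ₀ * C₀ / (1 - β₁)) * d)) hℓ₂).trans h12
  have t6 := hm2 (hc (2304 * L ^ 2 * C₀ ^ 2 * supNorm σ₁ ^ 2 / (1 - β₁) ^ 2 * d ^ 2))
    (hℓ₁.pow 2)
  have t7 := hm2 ((hc (256 * (16 * L ^ 2 * C₀ ^ 2 * supNorm σ₁ ^ 2 / (1 - β₁) ^ 2) * d ^ 2)).add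
    (hm1 (hc (256 * (9 * L ^ 2 * C₀ ^ 2 * β₁ ^ 4 * (1 + supNorm σ₁ ^ 2) / (1 - β₁) ^ 4) * d ^ 2))
      (hm1 (hm1 hb hb) (hm1 hR hR)))) (hℓ₂.pow 2)
  refine ((((((t1.add t2).add t3).add t4).add t5).add t6).add t7).congr_left fun T => ?_
  simp only [adamG₁, adamG]
  -- Nested expressions are made atoms from the outside in, so that `ring` sees only independent
  -- variables and their inverses.
  generalize Real.log (d * T / δ) = ℓ₁
  generalize Real.log (calF d T L C₀ ε₀ β₁ (1 - 1 / (T : ℝ)) g₁ σ₀ σ₁ / Real.exp (-2)) = ℓ₂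
  generalize sigmaMax (1 - 1 / (T : ℝ)) = S
  generalize √(1 - 1 / (T : ℝ)) = w
  generalize 1 - β₁ / (1 - 1 / (T : ℝ)) = ρ
  generalize 1 - 1 / (T : ℝ) = b
  generalize 1 - β₁ = q
  ring

theorem adamG₁_le (h₀ : 0 ≤ β₁) (hδ : 0 < δ) : ∃ C : ℝ, 0 ≤ C ∧ ∀ T : ℕ, 2 ≤ T →
    β₁ < 1 - 1 / (T : ℝ) → adamG₁ d T L C₀ ε₀ β₁ δ Δ g₁ σ₀ σ₁ ≤ C * Real.log T ^ 2 := by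
  obtain ⟨c, hc⟩ := isBigO_principal.1 (adamG₁_isBigO (d := d) (L := L) (C₀ := C₀) (ε₀ := ε₀)
    (Δ := Δ) (g₁ := g₁) (σ₀ := σ₀) (σ₁ := σ₁) h₀ hδ)
  refine ⟨|c|, abs_nonneg c, fun T hT hβ => ?_⟩
  have h := hc T ⟨hT, hβ⟩
  rw [Real.norm_of_nonneg (show 0 ≤ Real.log T ^ 2 by positivity)] at h
  refine (le_abs_self _).trans (h.trans ?_)
  gcongr
  exact le_abs_self c

/-- Here `a` stands for `log T`, and `G ^ (3/2)` contributes `a ^ 3`. Lower powers of `a` are raised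
to the third by means of `1 ≤ 2 * a`, and `1 / T` is weakened to `1 / √T`. -/
theorem rate_le {K G C A B a : ℝ} {T : ℕ} (hK : 0 ≤ K) (hL : 0 < L) (hC₀ : 0 < C₀) (hε₀ : 0 ≤ ε₀)
    (hA : 0 ≤ A) (hB : 0 ≤ B) (hT : 2 ≤ T) (ha : 1 / 2 ≤ a) (hG0 : 0 ≤ G) (hG : G ≤ C * a ^ 2)
    (hC : 0 ≤ C) :
    K * (1 / (T : ℝ) * (ε₀ * G / (L * C₀)) + G / (L * C₀) * √((A + B * G) / T))
      ≤ K * (2 * (ε₀ * C / (L * C₀)) + C / (L * C₀) * √(4 * A + B * C)) * a ^ 3 / √T := by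
  have hT0 : (2 : ℝ) ≤ T := by exact_mod_cast hT
  have hTp : 0 < √(T : ℝ) := Real.sqrt_pos.2 (by linarith)
  have h1 : 1 / (T : ℝ) ≤ 1 / √T := by
    apply one_div_le_one_div_of_le hTp
    rw [Real.sqrt_le_left (by linarith)]
    nlinarith
  have h2 : a ^ 2 ≤ 2 * a ^ 3 := by nlinarith [sq_nonneg a]
  have h3 : √((A + B * G) / T) ≤ √(4 * A + B * C) * a / √T := by
    rw [Real.sqrt_div (by positivity)]
    apply div_le_div_of_nonneg_right _ hTp.le
    have ha0 : 0 ≤ a := by linarith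
    rw [← Real.sqrt_sq ha0, ← Real.sqrt_mul (by positivity)]
    apply Real.sqrt_le_sqrt
    have h4 : 1 ≤ 4 * a ^ 2 := by nlinarith
    nlinarith [mul_le_mul_of_nonneg_left hG hB, mul_le_mul_of_nonneg_left h4 hA]
  have hLC : 0 < L * C₀ := by positivity
  have h5 : ε₀ * G / (L * C₀) ≤ ε₀ * C / (L * C₀) * (2 * a ^ 3) := by
    rw [div_mul_eq_mul_div, div_le_div_iff_of_pos_right hLC, mul_assoc]
    exact mul_le_mul_of_nonneg_left (hG.trans (mul_le_mul_of_nonneg_left h2 hC)) hε₀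
  have h6 : G / (L * C₀) ≤ C / (L * C₀) * a ^ 2 := by
    rw [div_mul_eq_mul_div]
    gcongr
  have ha0 : 0 ≤ a := by linarith
  calc K * (1 / (T : ℝ) * (ε₀ * G / (L * C₀)) + G / (L * C₀) * √((A + B * G) / T))
      ≤ K * (1 / √T * (ε₀ * C / (L * C₀) * (2 * a ^ 3))
        + C / (L * C₀) * a ^ 2 * (√(4 * A + B * C) * a / √T)) := by gcongr
    _ = _ := by ring

end growth

/-! ### From the good event to the probability bound. -/

section probability

variable {d : ℕ} {L β₁ β₂ ε η C₀ fstar δ ε₀ G : ℝ} {f : E d → ℝ} {σ₀ σ₁ x₁ : E d} {T : ℕ}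
  {Z : Type*} {g : E d → Z → E d}

theorem adamG₁_nonneg (hL : 0 ≤ L) (hC : 0 ≤ C₀) (hε₀ : 0 ≤ ε₀) (h₀ : 0 ≤ β₁)
    (h₁ : β₁ < 1 - 1 / (T : ℝ)) (hT : 2 ≤ T) (hδ : 0 < δ) (hδ1 : δ < 1) {Δ g₁ : ℝ} (hΔ : 0 ≤ Δ) :
    0 ≤ adamG₁ d T L C₀ ε₀ β₁ δ Δ g₁ σ₀ σ₁ := by
  have h := one_sub_inv_lt_one hT rfl
  have hρ : 0 < 1 - β₁ / (1 - 1 / (T : ℝ)) := sub_pos.2 ((div_lt_one (h₀.trans_lt h₁)).2 h₁)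
  have hq1 : 0 < 1 - β₁ := by linarith
  have hℓ₁ := log_card_div_nonneg (d := d) hT hδ hδ1
  have hℓ₂ : 0 ≤ Real.log (calF d T L C₀ ε₀ β₁ (1 - 1 / (T : ℝ)) g₁ σ₀ σ₁ / Real.exp (-2)) := by
    linarith [two_le_log_calF (calF_ge_one (T := T) (d := d) (L := L) (C₀ := C₀) (ε₀ := ε₀)
      (g₁ := g₁) (σ₀ := σ₀) (σ₁ := σ₁) hρ.le)]
  have hs0 := supNorm_nonneg σ₀
  refine le_trans ?_ (adamG_ge hL hC hε₀ h₀ h₁ h rfl rfl hℓ₂ rfl rfl)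
  positivity

theorem sum_Icc_adamIterate (F : E d → ℝ) (z : ℕ → Z) (T : ℕ) :
    ∑ s ∈ Finset.Icc 1 T, F (adamIterate β₁ β₂ η ε g x₁ z s)
      = ∑ n ∈ Finset.range T, F (adamPoint β₁ β₂ η ε g x₁ z n) := by
  induction T with
  | zero => simp
  | succ T ih =>
    rw [Finset.sum_Icc_succ_top (by omega), ih, Finset.sum_range_succ]
    rfl

variable {Ω : Type*} [MeasurableSpace Z] [MeasurableSpace Ω] {ν : Measure Z} {P : Measure Ω}
  {ζ : ℕ → Ω → Z}

theorem measureReal_average_le [IsProbabilityMeasure ν] [IsProbabilityMeasure P]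
    (hL : 0 < L) (hf : IsLSmooth L f) (hb : ∀ x, fstar ≤ f x)
    (h₀ : 0 ≤ β₁) (h₁ : β₁ < β₂) (hT : 2 ≤ T) (hβ₂ : β₂ = 1 - 1 / (T : ℝ)) (hδ : 0 < δ)
    (hδ1 : δ < 1) (hε₀ : 0 < ε₀) (hε : ε = ε₀ * √(1 - β₂))
    (hη : η = C₀ * √(1 - β₂)) (hC : 0 < C₀)
    (hG : G = adamG₁ d T L C₀ ε₀ β₁ δ (f x₁ - fstar) ‖gradient f x₁‖ σ₀ σ₁)
    (ho : IsGradientOracle f σ₀ σ₁ ν g) (hζ : IsSampling ν P ζ) :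
    1 - δ ≤ P.real {ω | 1 / (T : ℝ) * ∑ s ∈ Finset.Icc 1 T,
        ‖gradient f (adamIterate β₁ β₂ η ε g x₁ (fun n => ζ n ω) s)‖ ^ 2
      ≤ 2 * (1 / (T : ℝ) * (ε₀ * G / (L * C₀))
        + G / (L * C₀) * √((‖σ₀‖ ^ 2 + (1 + supNorm σ₁ ^ 2) * G) / T))} := by
  have h := one_sub_inv_lt_one hT hβ₂
  have h11 : β₁ < 1 := h₁.trans h
  have hq2 : 0 < 1 - β₂ := by linarith
  have hε' : 0 < ε := by rw [hε]; positivity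
  have hη0 : 0 ≤ η := by rw [hη]; positivity
  have hT0 : (2 : ℝ) ≤ T := by exact_mod_cast hT
  have hG0 : 0 ≤ G := by
    rw [hG]
    exact adamG₁_nonneg hL.le hC.le hε₀.le h₀ (hβ₂ ▸ h₁) hT hδ hδ1 (sub_nonneg.2 (hb _))
  -- In dimension zero all gradients vanish; the comparison `log (T / δ) ≤ log (d T / δ)` used in
  -- the main case needs `d ≥ 1`.
  rcases Nat.eq_zero_or_pos d with rfl | hd
  · have hall : ∀ w : E 0, ‖w‖ = 0 := fun w => by rw [Subsingleton.elim w 0, norm_zero]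
    have hrhs : 0 ≤ 2 * (1 / (T : ℝ) * (ε₀ * G / (L * C₀))
        + G / (L * C₀) * √((‖σ₀‖ ^ 2 + (1 + supNorm σ₁ ^ 2) * G) / T)) := by positivity
    have : {ω | 1 / (T : ℝ) * ∑ s ∈ Finset.Icc 1 T,
        ‖gradient f (adamIterate β₁ β₂ η ε g x₁ (fun n => ζ n ω) s)‖ ^ 2
      ≤ 2 * (1 / (T : ℝ) * (ε₀ * G / (L * C₀))
        + G / (L * C₀) * √((‖σ₀‖ ^ 2 + (1 + supNorm σ₁ ^ 2) * G) / T))} = Set.univ := by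
      refine Set.eq_univ_of_forall fun ω => ?_
      rw [Set.mem_ofPred_eq]
      refine le_trans (le_of_eq ?_) hrhs
      simp only [hall]
      simp
    rw [this, probReal_univ]
    linarith
  obtain ⟨N, hN⟩ : ∃ N, N = supNorm σ₀ + supNorm σ₁ * √G := ⟨_, rfl⟩
  obtain ⟨lam, hlam⟩ : ∃ lam, lam = 1 / (2 * (d * C₀ * N / (1 - β₁))) := ⟨_, rfl⟩
  have hgc := hf.continuous_gradient hL
  have hbad := measureReal_exists_lt_logSupermartingale_le
    (D := adamNoise β₁ β₂ η ε f σ₀ σ₁ g x₁) (s := adamEnvelope β₁ β₂ η ε f σ₀ σ₁ g x₁) hζ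
    (measurable_adamNoise hgc ho.measurable) (measurable_adamEnvelope hgc ho.measurable)
    adamNoise_truncSeq adamEnvelope_truncSeq (integral_adamNoise ho)
    (ae_abs_adamNoise_le h₀ h11 hε' hη0 ho) lam (show 0 < T by omega) hδ
  have hnoise := ae_noise_path (β₁ := β₁) (β₂ := β₂) (η := η) (ε := ε) (x₁ := x₁) hgc ho hζ
  set U := ⋃ t ∈ Finset.Icc 1 T, {ω | Real.log (T / δ)
    < logSupermartingale (adamNoise β₁ β₂ η ε f σ₀ σ₁ g x₁)
      (adamEnvelope β₁ β₂ η ε f σ₀ σ₁ g x₁) lam t fun k => ζ k ω} with hU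
  have hle : P Uᶜ ≤ P {ω | 1 / (T : ℝ) * ∑ s ∈ Finset.Icc 1 T,
        ‖gradient f (adamIterate β₁ β₂ η ε g x₁ (fun n => ζ n ω) s)‖ ^ 2
      ≤ 2 * (1 / (T : ℝ) * (ε₀ * G / (L * C₀))
        + G / (L * C₀) * √((‖σ₀‖ ^ 2 + (1 + supNorm σ₁ ^ 2) * G) / T))} := by
    apply measure_mono_ae
    filter_upwards [hnoise] with ω hω hωU
    change _ ≤ _
    rw [sum_Icc_adamIterate fun x => ‖gradient f x‖ ^ 2]
    refine average_le hL hf hb h₀ h₁ hT hβ₂ hδ hδ1 hd hε₀ hε hη hC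
      (isAdamPath_adamPoint (h₀.trans h₁.le) h _) hG hN hlam (fun n _ => hω n) fun t ht => ?_
    -- Time `0` is not part of the union bound: both sums are empty and `log (T / δ) ≥ 0`.
    rcases Nat.eq_zero_or_pos t with rfl | ht0
    · have : 0 ≤ Real.log (T / δ) := by
        apply Real.log_nonneg
        rw [le_div_iff₀ hδ]
        linarith
      simpa using this
    · by_contra hcon
      apply hωU
      refine Set.mem_iUnion₂.2 ⟨t, Finset.mem_Icc.2 ⟨ht0, ht⟩, ?_⟩
      rw [Set.mem_ofPred_eq, logSupermartingale, Finset.sum_sub_distrib, ← Finset.mul_sum, ← Finset.mul_sum]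
      push Not at hcon
      simp only [adamNoise, adamEnvelope]
      simp only [noiseTerm, adamGrad] at hcon
      linarith
  -- Subadditivity is enough here, so measurability of `U` is not used.
  have h2 : 1 ≤ P.real U + P.real Uᶜ := by
    have := measureReal_union_le (μ := P) U Uᶜ
    rwa [Set.union_compl_self, probReal_univ] at this
  have h3 := ENNReal.toReal_mono (measure_ne_top P _) hle
  change P.real Uᶜ ≤ P.real _ at h3
  linarith

end probability

end AdamConv

end

/-! ### The main theorem. -/

theorem mainTheorem3 :
    -- the universal constant of the bound, and the degree of the polynomial in `log T`
    ∃ K : ℝ, 0 < K ∧ ∃ k : ℕ,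
    ∀ (d : ℕ) (f : AdamConv.E d → ℝ) (L fstar : ℝ) (x₁ σ₀ σ₁ : AdamConv.E d)
      (β₁ C₀ ε₀ δ : ℝ),
      0 < L → AdamConv.IsLSmooth L f → (∀ x, fstar ≤ f x) →
      (∀ i, 0 ≤ σ₀ i) → (∀ i, 0 ≤ σ₁ i) →
      0 ≤ β₁ → 0 < C₀ → 0 < ε₀ → 0 < δ → δ < 1 →
      ∃ C : ℝ, 0 < C ∧
      ∀ (T : ℕ) (β₂ η ε G₁ : ℝ),
        2 ≤ T → β₂ = 1 - 1 / (T : ℝ) → β₁ < β₂ →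
        η = C₀ * √(1 - β₂) → ε = ε₀ * √(1 - β₂) →
        G₁ = AdamConv.adamG₁ d T L C₀ ε₀ β₁ δ (f x₁ - fstar) ‖gradient f x₁‖ σ₀ σ₁ →
        G₁ ≤ C * Real.log T ^ k ∧
        ∀ (Z : Type*) [MeasurableSpace Z] (ν : MeasureTheory.Measure Z)
          [MeasureTheory.IsProbabilityMeasure ν]
          (g : AdamConv.E d → Z → AdamConv.E d)
          (Ω : Type*) [MeasurableSpace Ω] (P : MeasureTheory.Measure Ω)
          [MeasureTheory.IsProbabilityMeasure P] (ζ : ℕ → Ω → Z),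
          AdamConv.IsGradientOracle f σ₀ σ₁ ν g → AdamConv.IsSampling ν P ζ →
          1 - δ ≤ P.real {ω |
            (1 / (T : ℝ)) * ∑ s ∈ Finset.Icc 1 T,
                ‖gradient f (AdamConv.adamIterate β₁ β₂ η ε g x₁ (fun n => ζ n ω) s)‖ ^ 2
              ≤ K * (1 / (T : ℝ) * (ε₀ * G₁ / (L * C₀))
                  + G₁ / (L * C₀)
                    * √((‖σ₀‖ ^ 2 + (1 + AdamConv.supNorm σ₁ ^ 2) * G₁) / T)) ∧
            (1 / (T : ℝ)) * ∑ s ∈ Finset.Icc 1 T,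
                ‖gradient f (AdamConv.adamIterate β₁ β₂ η ε g x₁ (fun n => ζ n ω) s)‖ ^ 2
              ≤ C * Real.log T ^ k / √(T : ℝ)} := by
  -- The constant `2` is that of `average_le`; the exponent `3` is `3 / 2` times the degree `2` of
  -- `G₁` in `log T`.
  refine ⟨2, by norm_num, 3, ?_⟩
  intro d f L fstar x₁ σ₀ σ₁ β₁ C₀ ε₀ δ hL hf hb _ _ h₀ hC₀ hε₀ hδ hδ1
  obtain ⟨c, hc0, hc⟩ := AdamConv.adamG₁_le (d := d) (L := L) (C₀ := C₀) (ε₀ := ε₀)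
    (Δ := f x₁ - fstar) (g₁ := ‖gradient f x₁‖) (σ₀ := σ₀) (σ₁ := σ₁) h₀ hδ
  set r := 2 * (2 * (ε₀ * c / (L * C₀))
    + c / (L * C₀) * √(4 * ‖σ₀‖ ^ 2 + (1 + AdamConv.supNorm σ₁ ^ 2) * c)) with hr
  have hr0 : 0 ≤ r := by positivity
  -- `2 * c` serves the bound on `G₁`, as `log² T ≤ 2 log³ T`; `r` is the constant from `rate_le`;
  -- `1` ensures positivity.
  refine ⟨2 * c + r + 1, by positivity, ?_⟩
  intro T β₂ η ε G₁ hT hβ₂ h₁ hη hε hG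
  have ha := AdamConv.half_le_log hT
  have hG2 : G₁ ≤ c * Real.log T ^ 2 := hG ▸ hc T hT (hβ₂ ▸ h₁)
  have hG0 : 0 ≤ G₁ := hG ▸ AdamConv.adamG₁_nonneg hL.le hC₀.le hε₀.le h₀ (hβ₂ ▸ h₁) hT hδ hδ1
    (sub_nonneg.2 (hb _))
  have ha0 : 0 ≤ Real.log T := by linarith
  have ha3 : 0 ≤ Real.log T ^ 3 := by positivity
  refine ⟨?_, ?_⟩
  · have h2 : Real.log T ^ 2 ≤ 2 * Real.log T ^ 3 := by nlinarith [sq_nonneg (Real.log T)]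
    have h3 := mul_le_mul_of_nonneg_left h2 hc0
    nlinarith [mul_nonneg hr0 ha3]
  · intro Z _ ν _ g Ω _ P _ ζ ho hζ
    -- The second inequality follows from the first deterministically, so both hold on the same
    -- event and no probability is lost.
    refine (AdamConv.measureReal_average_le hL hf hb h₀ h₁ hT hβ₂ hδ hδ1 hε₀ hε hη hC₀ hG ho
      hζ).trans (measureReal_mono fun ω hω => ⟨hω, ?_⟩)
    refine (show _ ≤ _ from hω).trans ((AdamConv.rate_le (by norm_num) hL hC₀ hε₀.le
      (sq_nonneg ‖σ₀‖) (by positivity) hT ha hG0 hG2 hc0).trans ?_)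
    rw [← hr]
    gcongr
    linarith
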